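/- Consider $n\ge 1$ units with binary potential outcomes. The observed data are an assignment $Z^{\mathrm{obs}}\in\{0,1\}^n$ (1 = treatment, 0 = control) and outcomes $Y^{\mathrm{obs}}\in\{0,1\}^n$. Let $S=\sum_i Y_i^{\mathrm{obs}}(2Z_i^{\mathrm{obs}}-1)$, $n_1=\sum_i Z_i^{\mathrm{obs}}$ and $$\mathcal T=\Bigl\{\tfrac{S-n_1+k}{n}:\ k=0,1,\dots,n\Bigr\}.$$ For a table $\tilde Y=(\tilde Y_i(1),\tilde Y_i(0))_{i\le n}$ with entries in $\{0,1\}$ let $\tau(\tilde Y)=\frac1n\sum_i(\tilde Y_i(1)-\tilde Y_i(0))$, and for $Z\in\{0,1\}^n$ let $$T(\tilde Y,Z)=\tfrac1n\Bigl(\sum_{i:Z_i=1}2\tilde Y_i(1)-\sum_{i:Z_i=0}2\tilde Y_i(0)\Bigr).$$ For a design $\mathcal D$ (a probability distribution on $\{0,1\}^n$) let $$p(\tilde Y,Z^{\mathrm{obs}})=\Pr_{\tilde Z\sim\mathcal D}\bigl(|T(\tilde Y,\tilde Z)-\tau(\tilde Y)|\ge|T(\tilde Y,Z^{\mathrm{obs}})-\tau(\tilde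 Y)|\bigr).$$ For $\alpha\in(0,1)$, the confidence set $\mathcal I_\alpha=\mathcal I_\alpha(Y^{\mathrm{obs}},Z^{\mathrm{obs}})$ is the set of all $\tau_0\in\mathcal T$ for which there is a table $\tilde Y$ with $\tilde Y_i(Z_i^{\mathrm{obs}})=Y_i^{\mathrm{obs}}$ for all $i$, $\tau(\tilde Y)=\tau_0$ and $p(\tilde Y,Z^{\mathrm{obs}})\ge\alpha$. Theorem. Let $\mathcal D$ be either the balanced Bernoulli design (the $Z_i$ are independent and uniform on $\{0,1\}$), or the matched-pairs design ($n$ is even, the units are partitioned into $n/2$ pairs, and independently in each pair one unit chosen with probability $1/2$ is treated and the other is not; $Z^{\mathrm{obs}}$ treats exactly one unit of each pair). For each of these two designs there is a single algorithm in the unit-cost RAM model (each operation $+,-,\times,\div$ on exact real numbers, comparison, copy, memory access and jump takes one time unit) that, for all $n\ge1$, all $\alpha\in(0,1)$ and all observed data $(Y^{\mathrm{obs}},Z^{\mathrm{obs}})$, given $n$, $\alpha$, the observed data and, for matched pairs, the pairing, outputs a list of the elements of $\mathcal I_\alpha(Y^{\mathrm{obs}},Z^{\mathrm{obs}})$ in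 time $O(n\log^2 n)$ as $n\to\infty$, uniformly in $\alpha$, in the data and in the pairing. -/

import Mathlib

open Filter Asymptotics

noncomputable section

/-! ### Randomized experiments with binary outcomes -/

namespace RandExp

/-- The number `0` or `1` coded by a Boolean. -/
def val (b : Bool) : ℝ := if b then 1 else 0

/-- An assignment of `n` units: `true` is treatment, `false` is control. -/
abbrev Assignment (n : ℕ) := Fin n → Bool

/-- A table of binary potential outcomes: `Y i true` is the outcome of unit `i` under treatment,
`Y i false` its outcome under control. -/
abbrev Outcomes (n : ℕ) := Fin n → Bool → Bool

/-- The sample average treatment effect. -/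
def ate {n : ℕ} (Y : Outcomes n) : ℝ :=
  (1 / (n : ℝ)) * ∑ i, (val (Y i true) - val (Y i false))

/-- The Horvitz-Thompson estimator, every unit being treated with marginal probability `p`. -/
def htEstimator {n : ℕ} (p : ℝ) (Y : Outcomes n) (Z : Assignment n) : ℝ :=
  (1 / (n : ℝ)) * ((∑ i with Z i = true, val (Y i true) / p)
    - ∑ i with Z i = false, val (Y i false) / (1 - p))

/-- The Bernoulli design, as the probability mass function of the random assignment: the units are
independently treated with probability `p`. -/
def bernoulliDesign (n : ℕ) (p : ℝ) (Z : Assignment n) : ℝ :=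
  ∏ i, if Z i = true then p else 1 - p

/-- A partition of the units into pairs, given by the map that sends a unit to its partner. -/
def IsPairing {n : ℕ} (mate : Fin n → Fin n) : Prop :=
  ∀ i, mate (mate i) = i ∧ mate i ≠ i

/-- Exactly one unit of every pair is treated. -/
def RespectsPairing {n : ℕ} (mate : Fin n → Fin n) (Z : Assignment n) : Prop :=
  ∀ i, Z (mate i) = !(Z i)

open Classical in
/-- The matched-pairs design, as the probability mass function of the random assignment: each of the
`n / 2` pairs independently takes one of its two possible assignments, with probability `1/2`
each. -/
def matchedPairsDesign {n : ℕ} (mate : Fin n → Fin n) (Z : Assignment n) : ℝ :=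
  if RespectsPairing mate Z then (1 / 2 : ℝ) ^ (n / 2) else 0

open Classical in
/-- The randomization test `p`-value of the sharp null hypothesis `Y`, for the design with
probability mass function `D` and marginal treatment probability `p`. -/
def pValue {n : ℕ} (D : Assignment n → ℝ) (p : ℝ) (Y : Outcomes n) (Zobs : Assignment n) : ℝ :=
  ∑ Z with |htEstimator p Y Z - ate Y| ≥ |htEstimator p Y Zobs - ate Y|, D Z

/-- The `n + 1` candidate values `(S - n₁ + k) / n`, `0 ≤ k ≤ n`, of the average treatment effect,
where `S = ∑ Yᵢ (2 Zᵢ - 1)` and `n₁ = ∑ Zᵢ` are computed from the observed data. -/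
def candidates {n : ℕ} (Yobs : Fin n → Bool) (Zobs : Assignment n) : Set ℝ :=
  {τ | ∃ k : ℕ, k ≤ n ∧
    τ = ((∑ i, val (Yobs i) * (2 * val (Zobs i) - 1)) - (∑ i, val (Zobs i)) + (k : ℝ)) / (n : ℝ)}

/-- The table `Y` agrees with the observed data and has average treatment effect `τ₀`. -/
def Compatible {n : ℕ} (τ₀ : ℝ) (Yobs : Fin n → Bool) (Zobs : Assignment n)
    (Y : Outcomes n) : Prop :=
  (∀ i, Y i (Zobs i) = Yobs i) ∧ ate Y = τ₀

/-- The confidence set at level `α`: the candidate values `τ₀` for which some compatible table is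
accepted by its randomization test, i.e. has `p`-value at least `α`. -/
def confidenceSet {n : ℕ} (D : Assignment n → ℝ) (p α : ℝ) (Yobs : Fin n → Bool)
    (Zobs : Assignment n) : Set ℝ :=
  {τ₀ | τ₀ ∈ candidates Yobs Zobs ∧
    ∃ Y : Outcomes n, Compatible τ₀ Yobs Zobs Y ∧ α ≤ pValue D p Y Zobs}

end RandExp

/-! ### The unit-cost random access machine, with exact real arithmetic -/

namespace RAM

/-- The arithmetic operations (division by zero returns zero). -/
inductive ArithOp
  | add | sub | mul | div

/-- The value of an arithmetic operation. -/
def ArithOp.eval : ArithOp → ℝ → ℝ → ℝ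
  | .add, x, y => x + y
  | .sub, x, y => x - y
  | .mul, x, y => x * y
  | .div, x, y => x / y

/-- Instructions. The numbers `r`, `s`, `t` name registers and `l` is a position in the program. -/
inductive Instr
  /-- `reg[r] := c` -/
  | const (r : ℕ) (c : ℤ)
  /-- `reg[r] := reg[s]` -/
  | move (r s : ℕ)
  /-- `reg[r] := reg[s] op reg[t]` -/
  | arith (op : ArithOp) (r s t : ℕ)
  /-- `reg[r] := mem[reg[s]]` -/
  | load (r s : ℕ)
  /-- `mem[reg[r]] := reg[s]` -/
  | store (r s : ℕ)
  /-- go to `l` -/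
  | jump (l : ℕ)
  /-- if `reg[r] ≤ reg[s]` go to `l` -/
  | jumpLE (r s l : ℕ)
  /-- stop -/
  | halt

/-- A program is a finite list of instructions. -/
abbrev Program := List Instr

/-- A configuration: the program counter, the registers, and the memory cells, which are only
reached through an address that is held in a register. -/
structure Config where
  pc : ℕ
  reg : ℕ → ℝ
  mem : ℕ → ℝ

open Classical in
/-- One step of the machine, of unit cost. A halted machine does not change any more. A machine that
leaves its program, or uses as an address a number that is not a natural number, is stuck: it does
not change any more either, but does not count as halted. -/
def step (P : Program) (c : Config) : Config :=
  match P[c.pc]? with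
  | none => c
  | some .halt => c
  | some (.const r k) => ⟨c.pc + 1, Function.update c.reg r (k : ℝ), c.mem⟩
  | some (.move r s) => ⟨c.pc + 1, Function.update c.reg r (c.reg s), c.mem⟩
  | some (.arith op r s t) =>
      ⟨c.pc + 1, Function.update c.reg r (op.eval (c.reg s) (c.reg t)), c.mem⟩
  | some (.load r s) =>
      if c.reg s = (⌊c.reg s⌋₊ : ℝ) then
        ⟨c.pc + 1, Function.update c.reg r (c.mem ⌊c.reg s⌋₊), c.mem⟩
      else c
  | some (.store r s) =>
      if c.reg r = (⌊c.reg r⌋₊ : ℝ) then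
        ⟨c.pc + 1, c.reg, Function.update c.mem ⌊c.reg r⌋₊ (c.reg s)⟩
      else c
  | some (.jump l) => ⟨l, c.reg, c.mem⟩
  | some (.jumpLE r s l) => if c.reg r ≤ c.reg s then ⟨l, c.reg, c.mem⟩
      else ⟨c.pc + 1, c.reg, c.mem⟩

/-- Started in `c`, the program halts after at most `t` steps, in the configuration `c'`. -/
def HaltsWithin (P : Program) (c : Config) (t : ℕ) (c' : Config) : Prop :=
  ∃ k ≤ t, (step P)^[k] c = c' ∧ P[c'.pc]? = some .halt

/-- The initial configuration: `reg[0] = n`, `reg[1] = α`, the list `data` occupies the first memory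
cells, and everything else is zero. -/
def input (n : ℕ) (α : ℝ) (data : List ℝ) : Config where
  pc := 0
  reg := fun r => if r = 0 then (n : ℝ) else if r = 1 then α else 0
  mem := fun k => data.getD k 0

/-- The configuration outputs the finite set `I`: `reg[0]` is the number `K` of elements of `I`,
and the first `K` memory cells list them without repetition. -/
def Outputs (c : Config) (I : Set ℝ) : Prop :=
  ∃ K : ℕ, c.reg 0 = (K : ℝ) ∧ Set.InjOn c.mem (Set.Iio K) ∧ c.mem '' Set.Iio K = I

end RAM

namespace RandExp

/-- The observed data as an input list: first all observed outcomes, then all assignments. -/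
def observedData {n : ℕ} (Yobs : Fin n → Bool) (Zobs : Assignment n) : List ℝ :=
  List.ofFn (fun i => val (Yobs i)) ++ List.ofFn (fun i => val (Zobs i))

/-- The pairing as an input list: the index of the partner of each unit. -/
def pairingData {n : ℕ} (mate : Fin n → Fin n) : List ℝ :=
  List.ofFn (fun i => ((mate i : ℕ) : ℝ))

end RandExp

end

/-! ### Sums of independent signs with weights one and two -/

namespace RandExp

/-! With treatment probability 1/2, n(T − τ) is the sum of the scores Y_i(1) + Y_i(0) ∈ {0, 1, 2},
with sign + for treated and − for control units. Under the Bernoulli design it is therefore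
distributed as a sum of a independent signs plus twice a sum of b independent signs, where a and b
count the units of score 1 and 2. Under matched pairs the same holds with one sign per pair, the
weight being the difference of the two scores. Moreover n T(Ỹ, Zobs) depends on the observed data
only, so the critical value x is fixed by the candidate τ₀ (`imbalance_add_totalEffect`). A
candidate is thus accepted iff some feasible pair (a, b) passes a sign test at x, and the question
is which feasible pair is best.

For a ≥ 1 the number of sign patterns whose sum lies in a window of length two is symmetric and
unimodal in the window (`unimodal_signCDF`), so lower tails at negative points are convex at step
two (`two_mul_signCDF_le`). Hence adding two unit signs does not lower the normalized tail, and
neither does replacing two of at least three unit signs by a doubled one. At fixed parity of a, the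
p-value therefore grows with b and with a + 2b (`signCDF_dominate`). For each candidate one explicit
table maximizes both quantities at once. Only tables with a = 0, whose sums live on a lattice of
step four, need tests of their own.

As the candidate varies, the best pair (a, b) and the degree k of the tail run along a bounded
number of lines (`bernoulliAccepted`, `matchedAccepted`). The tail is a partial sum of the
coefficients of (1 + z)^a (1 + z²)^b. This polynomial satisfies a first order differential equation,
so its coefficients obey a recurrence of fixed length (`genCoeff_recurrence`), and three consecutive
coefficients together with one partial sum can be carried from one test to the next by boundedly
many arithmetic operations (`SweepState.move`). The total time is linear in n, which is stronger
than required.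

The algorithm is written in a small structured language that compiles to the machine
(`Exec.reaches`), and is verified by specifications with time bounds (`Spec`). The sweeps set flags
in memory, so that a candidate found twice is still listed once by the final pass. -/

/-- The number of sign patterns for which the sum of `a` terms `±1` and `b` terms `±2` is at most
`v`. -/
def signCDF : ℕ → ℕ → ℤ → ℝ
  | 0, 0, v => if 0 ≤ v then 1 else 0
  | 0, b + 1, v => signCDF 0 b (v - 2) + signCDF 0 b (v + 2)
  | a + 1, b, v => signCDF a b (v - 1) + signCDF a b (v + 1)

theorem signCDF_succ_left (a b : ℕ) (v : ℤ) :
    signCDF (a + 1) b v = signCDF a b (v - 1) + signCDF a b (v + 1) := by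
  rw [signCDF]

/-- The definition removes the unit signs first; this is the commutation that allows a doubled sign
to be removed in their presence. -/
theorem signCDF_succ_right (a b : ℕ) (v : ℤ) :
    signCDF a (b + 1) v = signCDF a b (v - 2) + signCDF a b (v + 2) := by
  induction a generalizing v with
  | zero => rw [signCDF]
  | succ a ih =>
    simp only [signCDF_succ_left, ih]
    ring_nf

/-- Induction over the two numbers of terms, for properties of `signCDF a b`. -/
theorem signCDF_induction {p : ℕ → ℕ → Prop} (h0 : p 0 0) (hb : ∀ b, p 0 b → p 0 (b + 1))
    (ha : ∀ a b, p a b → p (a + 1) b) (a b : ℕ) : p a b := by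
  induction a with
  | zero =>
    induction b with
    | zero => exact h0
    | succ b ih => exact hb b ih
  | succ a ih => exact ha a b ih

theorem signCDF_nonneg (a b : ℕ) (v : ℤ) : 0 ≤ signCDF a b v := by
  revert v
  induction a, b using signCDF_induction with
  | h0 => intro v; rw [signCDF]; split_ifs <;> norm_num
  | hb b ih => intro v; rw [signCDF_succ_right]; exact add_nonneg (ih _) (ih _)
  | ha a b ih => intro v; rw [signCDF_succ_left]; exact add_nonneg (ih _) (ih _)

theorem signCDF_mono (a b : ℕ) : Monotone (signCDF a b) := by
  induction a, b using signCDF_induction with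
  | h0 =>
    intro v w h
    simp only [signCDF]
    split_ifs <;> first | omega | norm_num
  | hb b ih =>
    intro v w h
    simp only [signCDF_succ_right]
    exact add_le_add (ih (by omega)) (ih (by omega))
  | ha a b ih =>
    intro v w h
    simp only [signCDF_succ_left]
    exact add_le_add (ih (by omega)) (ih (by omega))

/-- Flipping all signs exchanges the sums at most -v - 1 with the sums at least v + 1. -/
theorem signCDF_symm (a b : ℕ) (v : ℤ) :
    signCDF a b v + signCDF a b (-v - 1) = 2 ^ (a + b) := by
  revert v
  induction a, b using signCDF_induction with
  | h0 =>
    intro v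
    simp only [signCDF]
    split_ifs <;> first | omega | norm_num
  | hb b ih =>
    intro v
    have h1 := ih (v - 2)
    have h2 := ih (v + 2)
    rw [signCDF_succ_right, signCDF_succ_right, show -v - 1 - 2 = -(v + 2) - 1 by ring,
      show -v - 1 + 2 = -(v - 2) - 1 by ring, ← add_assoc 0 b 1, pow_succ]
    linarith
  | ha a b ih =>
    intro v
    have h1 := ih (v - 1)
    have h2 := ih (v + 1)
    rw [signCDF_succ_left, signCDF_succ_left, show -v - 1 - 1 = -(v + 1) - 1 by ring,
      show -v - 1 + 1 = -(v - 1) - 1 by ring, add_right_comm a 1 b, pow_succ]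
    linarith

/-- The sum is congruent to a modulo 2, so v + 1 is not attained. -/
theorem signCDF_parity (a b : ℕ) (v : ℤ) (h : (v - a) % 2 = 0) :
    signCDF a b (v + 1) = signCDF a b v := by
  revert v
  induction a, b using signCDF_induction with
  | h0 =>
    intro v h
    simp only [signCDF]
    split_ifs <;> first | rfl | omega
  | hb b ih =>
    intro v h
    rw [signCDF_succ_right, signCDF_succ_right, show v + 1 - 2 = (v - 2) + 1 by ring,
      show v + 1 + 2 = (v + 2) + 1 by ring, ih _ (by omega), ih _ (by omega)]
  | ha a b ih =>
    intro v h
    push_cast at h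
    rw [signCDF_succ_left, signCDF_succ_left, show v + 1 - 1 = (v - 1) + 1 by ring,
      show v + 1 + 1 = (v + 1) + 1 by ring, ih _ (by omega), ih _ (by omega)]

/-- Without terms `±1` the sum lies in a residue class modulo four. -/
theorem signCDF_zero_parity (b : ℕ) (v : ℤ) (h : (v - 2 * b) % 4 ≠ 3) :
    signCDF 0 b (v + 1) = signCDF 0 b v := by
  induction b generalizing v with
  | zero =>
    simp only [signCDF]
    split_ifs <;> first | rfl | omega
  | succ b ih =>
    push_cast at h
    rw [signCDF_succ_right, signCDF_succ_right, show v + 1 - 2 = (v - 2) + 1 by ring,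
      show v + 1 + 2 = (v + 2) + 1 by ring, ih _ (by omega), ih _ (by omega)]

/-! ### Unimodality, convexity of the tails, and domination between sign sums. -/

/-- Symmetric about `1/2` and nondecreasing up to there. -/
def Unimodal (g : ℤ → ℝ) : Prop :=
  (∀ v, g v = g (1 - v)) ∧ ∀ v ≤ 0, g v ≤ g (v + 1)

/-- Adding one more unit sign preserves symmetric unimodality; this is the induction step below. A
doubled sign would not preserve it in general. -/
theorem Unimodal.smooth {g : ℤ → ℝ} (h : Unimodal g) :
    Unimodal fun v => g (v - 1) + g (v + 1) := by
  refine ⟨fun v => ?_, fun v hv => ?_⟩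
  · simp only
    rw [h.1 (v - 1), h.1 (v + 1), add_comm]
    ring_nf
  · simp only
    have e : v + 1 - 1 = v := by ring
    have e' : v - 1 + 1 = v := by ring
    have h1 := h.2 (v - 1) (by omega)
    rw [e'] at h1
    rw [e]
    rcases hv.lt_or_eq with hv | rfl
    · have h2 := h.2 (v + 1) (by omega)
      linarith
    -- At the centre the inequality is an equality: g 2 = g (-1) and g 1 = g 0 by symmetry.
    · have h2 := h.1 (0 + 1 + 1)
      have h3 := h.1 (0 + 1)
      norm_num at *
      linarith

theorem unimodal_signCDF_zero_right (a : ℕ) :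
    Unimodal fun v => signCDF a 0 v - signCDF a 0 (v - 2) := by
  induction a with
  | zero =>
    refine ⟨fun v => ?_, fun v hv => ?_⟩ <;> simp only [signCDF] <;> split_ifs <;>
      first | omega | norm_num
  | succ a ih =>
    convert ih.smooth using 2 with v
    simp only [signCDF_succ_left]
    ring_nf

/-- Doubled signs alone are unit signs rescaled by two. -/
theorem signCDF_zero_left (b : ℕ) (v : ℤ) :
    signCDF 0 b (2 * v) = signCDF b 0 v ∧ signCDF 0 b (2 * v + 1) = signCDF b 0 v := by
  induction b generalizing v with
  | zero =>
    simp only [signCDF]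
    constructor <;> split_ifs <;> first | rfl | omega
  | succ b ih =>
    simp only [signCDF_succ_left, signCDF_succ_right, ← ih]
    constructor
    · ring_nf
    · rw [(ih (v - 1)).1, (ih (v + 1)).1, ← (ih (v - 1)).2, ← (ih (v + 1)).2]
      ring_nf

/-- The induction on the unit signs starts from one of them, because without any the sums have
spacing four and a window of length two is alternately empty. With exactly one, the coefficients of
(1 + z)(1 + z²)^b are binomial coefficients, each taken twice. -/
theorem unimodal_signCDF (a b : ℕ) :
    Unimodal fun v => signCDF (a + 1) b v - signCDF (a + 1) b (v - 2) := by
  induction a with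
  | zero =>
    -- Conditioning on the unit sign, two windows of length two merge into one of length four for
    -- the doubled signs, which halving turns into a window of length two for b unit signs.
    have key : ∀ v : ℤ, signCDF (0 + 1) b v - signCDF (0 + 1) b (v - 2) =
        signCDF b 0 ((v + 1) / 2) - signCDF b 0 ((v + 1) / 2 - 2) := by
      intro v
      rw [signCDF_succ_left, signCDF_succ_left]
      have h1 := signCDF_zero_left b ((v + 1) / 2)
      have h2 := signCDF_zero_left b ((v + 1) / 2 - 2)
      rcases Int.emod_two_eq_zero_or_one (v + 1) with h | h
      · rw [← h1.1, ← h2.1, show 2 * ((v + 1) / 2) = v + 1 by omega,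
          show 2 * ((v + 1) / 2 - 2) = v - 2 - 1 by omega, show v - 2 + 1 = v - 1 by ring]
        ring
      · rw [← h1.2, ← h2.2, show 2 * ((v + 1) / 2) + 1 = v + 1 by omega,
          show 2 * ((v + 1) / 2 - 2) + 1 = v - 2 - 1 by omega, show v - 2 + 1 = v - 1 by ring]
        ring
    have hu := unimodal_signCDF_zero_right b
    refine ⟨fun v => ?_, fun v hv => ?_⟩
    · simp only [key]
      have := hu.1 ((v + 1) / 2)
      simp only at this
      rw [this, show (1 - v + 1) / 2 = 1 - (v + 1) / 2 by omega]
    · simp only [key]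
      rcases Int.emod_two_eq_zero_or_one (v + 1) with h | h
      · rw [show (v + 1 + 1) / 2 = (v + 1) / 2 by omega]
      · have := hu.2 ((v + 1) / 2) (by omega)
        simp only at this
        rwa [show (v + 1 + 1) / 2 = (v + 1) / 2 + 1 by omega]
  | succ a ih =>
    convert ih.smooth using 2 with v
    simp only [signCDF_succ_left]
    ring_nf

/-- The lower tails are convex, at steps of length two. -/
theorem two_mul_signCDF_le {a : ℕ} (ha : 1 ≤ a) (b : ℕ) {v : ℤ} (hv : v ≤ -1) :
    2 * signCDF a b v ≤ signCDF a b (v - 2) + signCDF a b (v + 2) := by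
  obtain ⟨a, rfl⟩ := Nat.exists_eq_add_of_le' ha
  have h1 := (unimodal_signCDF a b).2 v (by omega)
  have h2 := (unimodal_signCDF a b).2 (v + 1) (by omega)
  simp only at h1 h2
  rw [show v + 1 + 1 = v + 2 by ring] at h2
  rw [show v + 2 - 2 = v by ring] at h2
  linarith

/-- Two further unit signs average the tail over v - 2, v, v, v + 2, and convexity bounds this below
by the value at v. -/
theorem signCDF_add_two_left {a : ℕ} (ha : 1 ≤ a) (b : ℕ) {v : ℤ} (hv : v ≤ -1) (j : ℕ) :
    4 ^ j * signCDF a b v ≤ signCDF (a + 2 * j) b v := by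
  induction j with
  | zero => simp
  | succ j ih =>
    have h := two_mul_signCDF_le (a := a + 2 * j) (by omega) b hv
    rw [show a + 2 * (j + 1) = a + 2 * j + 1 + 1 by ring, signCDF_succ_left, signCDF_succ_left,
      signCDF_succ_left, show v - 1 - 1 = v - 2 by ring, show v - 1 + 1 = v by ring,
      show v + 1 - 1 = v by ring, show v + 1 + 1 = v + 2 by ring, pow_succ]
    linarith

/-- Two unit signs average over v - 2, v, v, v + 2, one doubled sign over v - 2, v + 2 only; by
convexity the more spread average is the larger. -/
theorem signCDF_exchange {a : ℕ} (ha : 1 ≤ a) (b : ℕ) {v : ℤ} (hv : v ≤ -1) (j : ℕ) :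
    signCDF (a + 2 * j) b v ≤ 2 ^ j * signCDF a (b + j) v := by
  induction j generalizing b with
  | zero => simp
  | succ j ih =>
    have h := two_mul_signCDF_le (a := a + 2 * j) (by omega) b hv
    have h2 := ih (b + 1)
    rw [signCDF_succ_right, show b + 1 + j = b + (j + 1) by ring] at h2
    rw [show a + 2 * (j + 1) = a + 2 * j + 1 + 1 by ring, signCDF_succ_left, signCDF_succ_left,
      signCDF_succ_left, show v - 1 - 1 = v - 2 by ring, show v - 1 + 1 = v by ring,
      show v + 1 - 1 = v by ring, show v + 1 + 1 = v + 2 by ring, pow_succ]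
    linarith

/-- This is the last exchange, which leaves no unit sign; convexity of the remaining doubled signs
is not available in general. For v in the lattice of b + 1 doubled signs, the tail of b doubled
signs does not jump between v - 2 and v, and monotonicity suffices. -/
theorem signCDF_two_le {b : ℕ} {v : ℤ} (h : (v - 2 * (b + 1)) % 4 = 0) :
    signCDF 2 b v ≤ 2 * signCDF 0 (b + 1) v := by
  have h1 : signCDF 0 b v = signCDF 0 b (v - 2) := by
    have e1 := signCDF_zero_parity b (v - 2) (by omega)
    have e2 := signCDF_zero_parity b (v - 1) (by omega)
    rw [show v - 2 + 1 = v - 1 by ring] at e1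
    rw [show v - 1 + 1 = v by ring] at e2
    rw [e2, e1]
  have h2 := signCDF_mono 0 b (show v ≤ v + 2 by omega)
  rw [signCDF_succ_left, signCDF_succ_left, signCDF_succ_left, signCDF_succ_right,
    show v - 1 - 1 = v - 2 by ring, show v - 1 + 1 = v by ring,
    show v + 1 - 1 = v by ring, show v + 1 + 1 = v + 2 by ring]
  linarith

/-- The normalized lower tail grows when the number of terms `±2` and the total weight grow. -/
theorem signCDF_dominate {a b a' b' : ℕ} {v : ℤ} (hv : v ≤ -1) (ha : 1 ≤ a) (hb : b ≤ b')
    (hs : a + 2 * b ≤ a' + 2 * b') (hp : a % 2 = a' % 2)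
    (h0 : a' = 0 → (v - 2 * b') % 4 = 0) :
    signCDF a b v * 2 ^ (a' + b') ≤ signCDF a' b' v * 2 ^ (a + b) := by
  -- The route adds i pairs of unit signs to reach the total weight a' + 2 b', then exchanges j = b'
  -- - b pairs for doubled signs, keeping at least one unit sign throughout.
  have main : ∀ a' b' : ℕ, 1 ≤ a' → b ≤ b' → a + 2 * b ≤ a' + 2 * b' → a % 2 = a' % 2 →
      signCDF a b v * 2 ^ (a' + b') ≤ signCDF a' b' v * 2 ^ (a + b) := by
    intro a' b' ha' hb hs hp
    obtain ⟨j, rfl⟩ := Nat.exists_eq_add_of_le hb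
    obtain ⟨i, hi⟩ : ∃ i, a' + 2 * j = a + 2 * i := ⟨(a' + 2 * j - a) / 2, by omega⟩
    have h1 := signCDF_add_two_left ha b hv i
    have h2 := signCDF_exchange ha' b hv j
    rw [hi] at h2
    have h3 := h1.trans h2
    have e : (2 : ℝ) ^ (a' + (b + j)) * 2 ^ j = 4 ^ i * 2 ^ (a + b) := by
      rw [show (4 : ℝ) = 2 ^ 2 by norm_num, ← pow_mul, ← pow_add, ← pow_add]
      congr 1
      omega
    have hj : (0 : ℝ) < 2 ^ j := by positivity
    have hab : (0 : ℝ) < 2 ^ (a + b) := by positivity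
    refine le_of_mul_le_mul_right ?_ hj
    calc signCDF a b v * 2 ^ (a' + (b + j)) * 2 ^ j
        = 4 ^ i * signCDF a b v * 2 ^ (a + b) := by rw [mul_assoc, e]; ring
      _ ≤ 2 ^ j * signCDF a' (b + j) v * 2 ^ (a + b) := by gcongr
      _ = signCDF a' (b + j) v * 2 ^ (a + b) * 2 ^ j := by ring
  rcases Nat.eq_zero_or_pos a' with rfl | ha'
  -- Parity gives a ≥ 2, hence b' > b. The route goes through two unit signs and b' - 1 doubled ones
  -- and ends with the special exchange.
  · obtain ⟨c, rfl⟩ : ∃ c, b' = c + 1 := ⟨b' - 1, by omega⟩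
    have h1 := main 2 c (by norm_num) (by omega) (by omega) (by omega)
    have h2 := signCDF_two_le (by simpa using h0 rfl)
    have hab : (0 : ℝ) < 2 ^ (a + b) := by positivity
    have h3 : signCDF 2 c v * 2 ^ (a + b) ≤ 2 * signCDF 0 (c + 1) v * 2 ^ (a + b) := by gcongr
    have e : (2 : ℝ) ^ (2 + c) = 2 * 2 ^ (0 + (c + 1)) := by ring
    rw [e] at h1
    linarith
  · exact main a' b' ha' hb hs hp

theorem signCDF_zero_dominate {b b' : ℕ} {v : ℤ} (hv : v ≤ -1) (hb : b ≤ b')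
    (hp : b % 2 = b' % 2) (h : v % 2 = 0) :
    signCDF 0 b v * 2 ^ b' ≤ signCDF 0 b' v * 2 ^ b := by
  obtain ⟨u, rfl⟩ : ∃ u, v = 2 * u := ⟨v / 2, by omega⟩
  rw [(signCDF_zero_left b u).1, (signCDF_zero_left b' u).1]
  rcases Nat.eq_zero_or_pos b with rfl | hb0
  · have : signCDF 0 0 u = 0 := by rw [signCDF, if_neg (by omega)]
    rw [this, zero_mul]
    exact mul_nonneg (signCDF_nonneg _ _ _) (by positivity)
  · obtain ⟨j, rfl⟩ : ∃ j, b' = b + 2 * j := ⟨(b' - b) / 2, by omega⟩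
    have h1 := signCDF_add_two_left hb0 0 (v := u) (by omega) j
    rw [pow_add, pow_mul]
    norm_num
    have hj : (0 : ℝ) < 2 ^ b := by positivity
    calc signCDF b 0 u * (2 ^ b * 4 ^ j) = 4 ^ j * signCDF b 0 u * 2 ^ b := by ring
      _ ≤ _ := by gcongr

/-- The two-sided randomization test with critical value `|x|` accepts at level `α`, when the test
statistic is a sum of `a` independent signs and twice the sum of `b` independent signs. -/
def Accepts (α : ℝ) (a b : ℕ) (x : ℤ) : Prop :=
  α * 2 ^ (a + b) ≤ 2 * signCDF a b (-|x|)

/-- By symmetry at least half of the sums are at most 0, so twice the tail is already the full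
count. -/
theorem accepts_zero {α : ℝ} (h1 : α < 1) (a b : ℕ) : Accepts α a b 0 := by
  have h := signCDF_symm a b 0
  have h2 := signCDF_mono a b (show (-0 - 1 : ℤ) ≤ 0 by norm_num)
  have h3 : (0 : ℝ) < 2 ^ (a + b) := by positivity
  unfold Accepts
  rw [abs_zero, neg_zero]
  nlinarith

theorem Accepts.dominate {α : ℝ} (h1 : α < 1) {a b a' b' : ℕ} {x : ℤ} (ha : 1 ≤ a) (hb : b ≤ b')
    (hs : a + 2 * b ≤ a' + 2 * b') (hp : a % 2 = a' % 2)
    (h0 : a' = 0 → (x - 2 * b') % 4 = 0) (h : Accepts α a b x) : Accepts α a' b' x := by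
  rcases eq_or_ne x 0 with rfl | hx
  · exact accepts_zero h1 _ _
  have hx' := abs_pos.2 hx
  have hd := signCDF_dominate (v := -|x|) (by omega) ha hb hs hp (by
    intro h
    have := h0 h
    rcases abs_choice x with e | e <;> rw [e] <;> omega)
  unfold Accepts at *
  have hab : (0 : ℝ) < 2 ^ (a + b) := by positivity
  have hab' : (0 : ℝ) < 2 ^ (a' + b') := by positivity
  refine le_of_mul_le_mul_right ?_ hab
  calc α * 2 ^ (a' + b') * 2 ^ (a + b) = α * 2 ^ (a + b) * 2 ^ (a' + b') := by ring
    _ ≤ 2 * signCDF a b (-|x|) * 2 ^ (a' + b') := by gcongr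
    _ ≤ _ := by linarith

theorem Accepts.zero_dominate {α : ℝ} (h1 : α < 1) {b b' : ℕ} {x : ℤ} (hb : b ≤ b')
    (hp : b % 2 = b' % 2) (h0 : x % 2 = 0) (h : Accepts α 0 b x) : Accepts α 0 b' x := by
  rcases eq_or_ne x 0 with rfl | hx
  · exact accepts_zero h1 _ _
  have hx' := abs_pos.2 hx
  have hd := signCDF_zero_dominate (v := -|x|) (by omega) hb hp (by
    rcases abs_choice x with e | e <;> rw [e] <;> omega)
  unfold Accepts at *
  rw [zero_add] at *
  have hab : (0 : ℝ) < 2 ^ b := by positivity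
  have hab' : (0 : ℝ) < 2 ^ b' := by positivity
  refine le_of_mul_le_mul_right ?_ hab
  calc α * 2 ^ b' * 2 ^ b = α * 2 ^ b * 2 ^ b' := by ring
    _ ≤ 2 * signCDF 0 b (-|x|) * 2 ^ b' := by gcongr
    _ ≤ _ := by linarith

/-! ### The coefficients of `(1 + z) ^ a * (1 + z ^ 2) ^ b` -/

/-- The sum of the coefficients of `(1 + z) ^ a * (1 + z ^ 2) ^ b` up to degree `k`. -/
def cumCoeff (a b : ℕ) (k : ℤ) : ℝ := signCDF a b (2 * k - (a + 2 * b))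

/-- The coefficient of `z ^ k` in `(1 + z) ^ a * (1 + z ^ 2) ^ b`. -/
def genCoeff (a b : ℕ) (k : ℤ) : ℝ := cumCoeff a b k - cumCoeff a b (k - 1)

theorem cumCoeff_zero_zero (k : ℤ) : cumCoeff 0 0 k = if 0 ≤ k then 1 else 0 := by
  simp only [cumCoeff, signCDF]
  congr 1
  simp

theorem cumCoeff_succ_left (a b : ℕ) (k : ℤ) :
    cumCoeff (a + 1) b k = cumCoeff a b k + cumCoeff a b (k - 1) := by
  simp only [cumCoeff, signCDF_succ_left]
  push_cast
  ring_nf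

theorem cumCoeff_succ_right (a b : ℕ) (k : ℤ) :
    cumCoeff a (b + 1) k = cumCoeff a b k + cumCoeff a b (k - 2) := by
  simp only [cumCoeff, signCDF_succ_right]
  push_cast
  ring_nf

theorem genCoeff_zero_zero (k : ℤ) : genCoeff 0 0 k = if k = 0 then 1 else 0 := by
  simp only [genCoeff, cumCoeff_zero_zero]
  split_ifs <;> first | omega | norm_num

theorem genCoeff_succ_left (a b : ℕ) (k : ℤ) :
    genCoeff (a + 1) b k = genCoeff a b k + genCoeff a b (k - 1) := by
  simp only [genCoeff, cumCoeff_succ_left]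
  ring

theorem genCoeff_succ_right (a b : ℕ) (k : ℤ) :
    genCoeff a (b + 1) k = genCoeff a b k + genCoeff a b (k - 2) := by
  simp only [genCoeff, cumCoeff_succ_right]
  rw [show k - 2 - 1 = k - 1 - 2 by ring]
  ring

theorem cumCoeff_of_neg (a b : ℕ) {k : ℤ} (hk : k < 0) : cumCoeff a b k = 0 := by
  revert k
  induction a, b using signCDF_induction with
  | h0 => intro k hk; rw [cumCoeff_zero_zero, if_neg (by omega)]
  | hb b ih => intro k hk; rw [cumCoeff_succ_right, ih hk, ih (by omega), add_zero]
  | ha a b ih => intro k hk; rw [cumCoeff_succ_left, ih hk, ih (by omega), add_zero]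

theorem genCoeff_of_neg (a b : ℕ) {k : ℤ} (hk : k < 0) : genCoeff a b k = 0 := by
  rw [genCoeff, cumCoeff_of_neg a b hk, cumCoeff_of_neg a b (by omega), sub_zero]

theorem cumCoeff_zero (a b : ℕ) : cumCoeff a b 0 = 1 := by
  induction a, b using signCDF_induction with
  | h0 => simp [cumCoeff_zero_zero]
  | hb b ih => rw [cumCoeff_succ_right, ih, cumCoeff_of_neg _ _ (by norm_num), add_zero]
  | ha a b ih => rw [cumCoeff_succ_left, ih, cumCoeff_of_neg _ _ (by norm_num), add_zero]

theorem genCoeff_zero (a b : ℕ) : genCoeff a b 0 = 1 := by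
  rw [genCoeff, cumCoeff_zero, cumCoeff_of_neg _ _ (by norm_num), sub_zero]

/-- For f = (1 + z)^a (1 + z²)^b one has (1 + z)(1 + z²) f' = (a(1 + z²) + 2bz(1 + z)) f; this is
the coefficient of z^k. The induction verifies it factor by factor. -/
theorem genCoeff_recurrence (a b : ℕ) (k : ℤ) :
    (k + 1) * genCoeff a b (k + 1) + (k - a) * genCoeff a b k +
      (k - 1 - 2 * b) * genCoeff a b (k - 1) + (k - 2 - a - 2 * b) * genCoeff a b (k - 2) = 0 := by
  revert k
  induction a, b using signCDF_induction with
  | h0 =>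
    intro k
    simp only [genCoeff_zero_zero]
    by_cases h1 : k + 1 = 0
    · obtain rfl : k = -1 := by omega
      norm_num
    by_cases h2 : k = 0
    · subst h2; norm_num
    by_cases h3 : k - 1 = 0
    · obtain rfl : k = 1 := by omega
      norm_num
    by_cases h4 : k - 2 = 0
    · obtain rfl : k = 2 := by omega
      norm_num
    simp [h1, h2, h3, h4]
  | hb b ih =>
    intro k
    have h1 := ih k
    have h2 := ih (k - 2)
    simp only [genCoeff_succ_right]
    rw [show k - 2 + 1 = k - 1 by ring, show k - 2 - 1 = k - 1 - 2 by ring] at h2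
    rw [show k + 1 - 2 = k - 1 by ring]
    push_cast at *
    linear_combination h1 + h2
  | ha a b ih =>
    intro k
    have h1 := ih k
    have h2 := ih (k - 1)
    simp only [genCoeff_succ_left]
    rw [show k - 1 + 1 = k by ring, show k - 1 - 1 = k - 2 by ring,
      show k - 1 - 2 = k - 2 - 1 by ring] at h2
    rw [show k + 1 - 1 = k by ring, show k - 1 - 1 = k - 2 by ring]
    push_cast at *
    linear_combination h1 + h2

theorem genCoeff_succ (a b k : ℕ) :
    genCoeff a b (k + 1) = (-((k - a) * genCoeff a b k + (k - 1 - 2 * b) * genCoeff a b (k - 1) +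
      (k - 2 - a - 2 * b) * genCoeff a b (k - 2))) / (k + 1) := by
  have h := genCoeff_recurrence a b k
  rw [eq_div_iff (by positivity)]
  push_cast at h
  linear_combination h

/-- The recurrence solved for its lowest term; the bound on k keeps the divisor away from zero. -/
theorem genCoeff_sub_three {a b : ℕ} {k : ℤ} (hk : k < a + 2 * b + 3) :
    genCoeff a b (k - 3) = (-(k * genCoeff a b k + (k - 1 - a) * genCoeff a b (k - 1) +
      (k - 2 - 2 * b) * genCoeff a b (k - 2))) / (k - 3 - a - 2 * b) := by
  have h := genCoeff_recurrence a b (k - 1)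
  have hk' : (k : ℝ) < a + 2 * b + 3 := by exact_mod_cast hk
  rw [show k - 1 + 1 = k by ring, show k - 1 - 1 = k - 2 by ring,
    show k - 1 - 2 = k - 3 by ring] at h
  rw [eq_div_iff (by linarith)]
  push_cast at h
  linear_combination h

/-- Put g = (1 + z)^(a+1) (1 + z²)^b and h = (1 + z)^a (1 + z²)^(b+1). Then (a + 1) h = (1 + z²) g'
- 2bz g and h = (1 + z²) g - z h, which together express h by g and g' without dividing by the
polynomial 1 + z. -/
theorem genCoeff_trade (a b : ℕ) (k : ℤ) :
    genCoeff a (b + 1) k = ((a + 1 - k) * genCoeff (a + 1) b k +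
      (a + 2 * b + 3 - k) * genCoeff (a + 1) b (k - 2)) / (a + 1) := by
  have h := genCoeff_recurrence a b (k - 1)
  rw [show k - 1 + 1 = k by ring, show k - 1 - 1 = k - 2 by ring,
    show k - 1 - 2 = k - 2 - 1 by ring] at h
  rw [eq_div_iff (by positivity), genCoeff_succ_left, genCoeff_succ_left, genCoeff_succ_right]
  push_cast at h
  linear_combination h

/-- With g and h as above and f the common factor, g - h = z(1 - z) f, so the partial sums differ by
one coefficient of f; and 2f = h + g - z g recovers that coefficient from known ones. -/
theorem cumCoeff_trade (a b : ℕ) (k : ℤ) :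
    cumCoeff a (b + 1) k = cumCoeff (a + 1) b k -
      (genCoeff a (b + 1) (k - 1) + genCoeff (a + 1) b (k - 1) - genCoeff (a + 1) b (k - 2)) / 2 := by
  rw [genCoeff_succ_left, genCoeff_succ_left, genCoeff_succ_right, cumCoeff_succ_left,
    cumCoeff_succ_right, show k - 1 - 2 = k - 2 - 1 by ring, show k - 1 - 1 = k - 2 by ring]
  have : genCoeff a b (k - 1) = cumCoeff a b (k - 1) - cumCoeff a b (k - 2) := by
    rw [genCoeff, show k - 1 - 1 = k - 2 by ring]
  rw [this]
  ring

/-- The acceptance condition in terms of the cumulated coefficients. -/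
theorem accepts_iff {α : ℝ} {a b : ℕ} {x k : ℤ}
    (h : 2 * k = a + 2 * b + x ∨ 2 * k = a + 2 * b - x) :
    Accepts α a b x ↔ α * 2 ^ (a + b) ≤ 2 * cumCoeff a b k ∧
      α * 2 ^ (a + b) ≤ 2 * (2 ^ (a + b) - cumCoeff a b k + genCoeff a b k) := by
  -- Requiring the inequality at both y and -y amounts to requiring it at the smaller one. The
  -- program therefore never needs the sign of x, and one degree k serves a whole sweep.
  have key : ∀ y : ℤ, (y - a) % 2 = 0 → (Accepts α a b y ↔
      α * 2 ^ (a + b) ≤ 2 * signCDF a b y ∧ α * 2 ^ (a + b) ≤ 2 * signCDF a b (-y)) := by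
    intro y hy
    constructor
    · intro h
      unfold Accepts at h
      have e1 := signCDF_mono a b (neg_abs_le y)
      have e2 := signCDF_mono a b (neg_le_neg (le_abs_self y))
      constructor <;> linarith
    · rintro ⟨h1, h2⟩
      unfold Accepts
      rcases abs_choice y with e | e <;> rw [e]
      · exact h2
      · rwa [neg_neg]
  have hneg : Accepts α a b (-x) ↔ Accepts α a b x := by simp [Accepts]
  have aux : ∀ y : ℤ, 2 * k = a + 2 * b + y → (Accepts α a b y ↔
      α * 2 ^ (a + b) ≤ 2 * cumCoeff a b k ∧
      α * 2 ^ (a + b) ≤ 2 * (2 ^ (a + b) - cumCoeff a b k + genCoeff a b k)) := by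
    intro y hy
    rw [key y (by omega)]
    have e1 : cumCoeff a b k = signCDF a b y := by
      rw [cumCoeff]; congr 1; omega
    -- The upper tail including the coefficient of degree k; parity skips the unattained value
    -- between consecutive degrees.
    have e2 : (2 : ℝ) ^ (a + b) - cumCoeff a b k + genCoeff a b k = signCDF a b (-y) := by
      have hp := signCDF_parity a b (y - 2) (by omega)
      have e3 : cumCoeff a b (k - 1) = signCDF a b (y - 2) := by
        rw [cumCoeff]; congr 1; omega
      rw [genCoeff, ← signCDF_symm a b (-y), e3, show - -y - 1 = y - 2 + 1 by ring, hp]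
      ring
    rw [e1, ← e2, e1]
  rcases h with h | h
  · exact aux x h
  · rw [← hneg]; exact aux (-x) (by omega)

end RandExp

/-! ### Randomization tests as sign tests -/

namespace RandExp

open Finset

theorem card_weights {ι : Type*} (q : ι → ℤ) (U : Finset ι) (hq : ∀ i ∈ U, |q i| ≤ 2) :
    #{i ∈ U | q i = 0} + (#{i ∈ U | |q i| = 1} + #{i ∈ U | |q i| = 2}) = #U := by
  rw [card_filter, card_filter, card_filter, card_eq_sum_ones, ← sum_add_distrib,
    ← sum_add_distrib]
  refine sum_congr rfl fun i hi => ?_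
  have h := hq i hi
  have h0 := abs_nonneg (q i)
  have h1 := abs_eq_zero (a := q i)
  split_ifs <;> first | rfl | omega

section SignedSum

variable {ι : Type*} [DecidableEq ι]

/-- The sum of the weights `q i`, `i ∈ U`, with positive signs in `T` and negative signs outside. -/
def signedSum (U : Finset ι) (q : ι → ℤ) (T : Finset ι) : ℤ :=
  ∑ i ∈ U, if i ∈ T then q i else -q i

theorem signedSum_insert {U T : Finset ι} {j : ι} (q : ι → ℤ) (hj : j ∉ U) (hT : T ⊆ U) :
    signedSum (insert j U) q T = signedSum U q T - q j := by
  rw [signedSum, sum_insert hj, if_neg fun h => hj (hT h), signedSum]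
  ring

theorem signedSum_insert_insert {U T : Finset ι} {j : ι} (q : ι → ℤ) (hj : j ∉ U) :
    signedSum (insert j U) q (insert j T) = signedSum U q T + q j := by
  rw [signedSum, sum_insert hj, if_pos (mem_insert_self _ _), signedSum, add_comm]
  congr 1
  refine sum_congr rfl fun i hi => ?_
  have : i ≠ j := fun h => hj (h ▸ hi)
  simp [this]

/-- Adding one index splits the subsets in two halves shifted by the weight, which is the recursion
of `signCDF`; a weight 0 just doubles the count, and the sign of a weight is irrelevant. -/
theorem card_signedSum_le (q : ι → ℤ) (U : Finset ι) (hq : ∀ i ∈ U, |q i| ≤ 2) (v : ℤ) :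
    (#{T ∈ U.powerset | signedSum U q T ≤ v} : ℝ) =
      2 ^ #{i ∈ U | q i = 0} * signCDF #{i ∈ U | |q i| = 1} #{i ∈ U | |q i| = 2} v := by
  induction U using Finset.induction_on generalizing v with
  | empty =>
    simp only [powerset_empty, signedSum, sum_empty, filter_empty, card_empty, signCDF]
    split_ifs with h <;> simp [Finset.filter_singleton, h]
  | insert j U hj ih =>
    have ih' := ih fun i hi => hq i (mem_insert_of_mem hi)
    have hcount : (#{T ∈ (insert j U).powerset | signedSum (insert j U) q T ≤ v} : ℝ) =
        #{T ∈ U.powerset | signedSum U q T ≤ v + q j} +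
          #{T ∈ U.powerset | signedSum U q T ≤ v - q j} := by
      rw [powerset_insert, filter_union, card_union_of_disjoint, filter_image,
        card_image_of_injOn, Nat.cast_add]
      · congr 3
        · refine filter_congr fun T hT => ?_
          rw [signedSum_insert q hj (mem_powerset.1 hT)]
          omega
        · refine filter_congr fun T hT => ?_
          rw [signedSum_insert_insert q hj]
          omega
      · intro T hT T' hT' h
        have h1 : j ∉ T := fun h => hj (mem_powerset.1 (mem_filter.1 hT).1 h)
        have h2 : j ∉ T' := fun h => hj (mem_powerset.1 (mem_filter.1 hT').1 h)
        have h' : insert j T = insert j T' := h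
        rw [← erase_insert h1, h', erase_insert h2]
      · rw [disjoint_left]
        intro T hT hT'
        obtain ⟨T', -, rfl⟩ := mem_image.1 (mem_filter.1 hT').1
        exact hj (mem_powerset.1 (mem_filter.1 hT).1 (mem_insert_self _ _))
    have hj0 : ∀ p : ι → Prop, ∀ [DecidablePred p], j ∉ filter p U :=
      fun p _ h => hj (mem_filter.1 h).1
    rw [hcount, ih', ih']
    have h2 := hq j (mem_insert_self _ _)
    rw [abs_le] at h2
    simp only [filter_insert]
    rcases (by omega : q j = 0 ∨ (q j = 1 ∨ q j = -1) ∨ q j = 2 ∨ q j = -2)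
      with h | (h | h) | h | h
    · simp only [h, abs_zero, if_true, zero_ne_one, OfNat.zero_ne_ofNat, if_false,
        card_insert_of_notMem (hj0 _)]
      ring_nf
    · simp [h, card_insert_of_notMem (hj0 _), signCDF_succ_left]
      ring
    · simp [h, card_insert_of_notMem (hj0 _), signCDF_succ_left]
      ring_nf
    · simp [h, card_insert_of_notMem (hj0 _), signCDF_succ_right]
      ring
    · simp [h, card_insert_of_notMem (hj0 _), signCDF_succ_right]
      ring_nf

/-- For x ≠ 0 the two tails are disjoint and of equal size. -/
theorem card_abs_signedSum (q : ι → ℤ) (U : Finset ι) (hq : ∀ i ∈ U, |q i| ≤ 2) {x : ℤ}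
    (hx : x ≠ 0) :
    (#{T ∈ U.powerset | |x| ≤ |signedSum U q T|} : ℝ) = 2 ^ #{i ∈ U | q i = 0} *
      (2 * signCDF #{i ∈ U | |q i| = 1} #{i ∈ U | |q i| = 2} (-|x|)) := by
  have hx' := abs_pos.2 hx
  have h1 := card_signedSum_le q U hq (-|x|)
  have h2 := card_signedSum_le q U hq (|x| - 1)
  have h3 : #{T ∈ U.powerset | |x| ≤ |signedSum U q T|} =
      #{T ∈ U.powerset | signedSum U q T ≤ -|x|} +
        #{T ∈ U.powerset | ¬ signedSum U q T ≤ |x| - 1} := by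
    rw [← card_union_of_disjoint, ← filter_or]
    · congr 1
      refine filter_congr fun T _ => ?_
      rw [le_abs]
      omega
    · rw [disjoint_filter]
      intro T _ h
      omega
  have h4 := card_filter_add_card_filter_not (s := U.powerset)
    (fun T => signedSum U q T ≤ |x| - 1)
  rw [card_powerset, ← card_weights q U hq] at h4
  have h5 := signCDF_symm #{i ∈ U | |q i| = 1} #{i ∈ U | |q i| = 2} (|x| - 1)
  rw [show -(|x| - 1) - 1 = -|x| by ring] at h5
  have h4' := congrArg (Nat.cast (R := ℝ)) h4
  push_cast at h4'
  rw [pow_add, ← h5] at h4'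
  rw [h3]
  push_cast
  linarith

/-- The randomization test based on a signed sum. -/
theorem le_card_div_iff (q : ι → ℤ) (U : Finset ι) (hq : ∀ i ∈ U, |q i| ≤ 2) {α : ℝ}
    (hα : α < 1) (x : ℤ) :
    α ≤ #{T ∈ U.powerset | |x| ≤ |signedSum U q T|} / 2 ^ #U ↔
      Accepts α #{i ∈ U | |q i| = 1} #{i ∈ U | |q i| = 2} x := by
  rcases eq_or_ne x 0 with rfl | hx
  -- At x = 0 the two tails overlap, so doubling one overcounts; but the p-value is 1 and both sides
  -- hold since α < 1.
  · refine iff_of_true ?_ (accepts_zero hα _ _)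
    rw [filter_true_of_mem (by simp), card_powerset]
    simp [hα.le]
  · rw [card_abs_signedSum q U hq hx, ← card_weights q U hq, pow_add,
      mul_div_mul_left _ _ (by positivity), le_div_iff₀ (by positivity), Accepts]

end SignedSum

/-- The integer `0` or `1` coded by a Boolean. -/
def ival (b : Bool) : ℤ := if b then 1 else 0

theorem val_eq_ival (b : Bool) : val b = ival b := by cases b <;> simp [val, ival]

/-- The sum of the two potential outcomes of a unit. -/
def score {n : ℕ} (Y : Outcomes n) (i : Fin n) : ℤ := ival (Y i true) + ival (Y i false)

/-- The difference between the Horvitz-Thompson estimator and the average treatment effect, times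
the number of units. -/
def imbalance {n : ℕ} (Y : Outcomes n) (Z : Assignment n) : ℤ :=
  ∑ i, if Z i then score Y i else -score Y i

/-- The sum of the unit treatment effects. -/
def totalEffect {n : ℕ} (Y : Outcomes n) : ℤ := ∑ i, (ival (Y i true) - ival (Y i false))

theorem ate_eq {n : ℕ} (Y : Outcomes n) : ate Y = totalEffect Y / n := by
  rw [ate, totalEffect]
  push_cast
  simp only [val_eq_ival]
  ring

/-- A treated unit contributes 2Y(1) - (Y(1) - Y(0)), a control unit -2Y(0) - (Y(1) - Y(0)); these
are plus and minus the score. -/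
theorem htEstimator_sub_ate {n : ℕ} (Y : Outcomes n) (Z : Assignment n) :
    htEstimator (1 / 2) Y Z - ate Y = imbalance Y Z / n := by
  rw [ate, htEstimator, ← mul_sub, one_div_mul_eq_div]
  congr 1
  rw [imbalance, sum_filter, sum_filter, ← sum_sub_distrib, ← sum_sub_distrib, Int.cast_sum]
  refine sum_congr rfl fun i _ => ?_
  cases Z i <;> simp [score, val_eq_ival] <;> ring

theorem pValue_eq {n : ℕ} (hn : 1 ≤ n) (D : Assignment n → ℝ) (Y : Outcomes n)
    (Z : Assignment n) :
    pValue D (1 / 2) Y Z = ∑ W with |imbalance Y Z| ≤ |imbalance Y W|, D W := by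
  rw [pValue]
  refine sum_congr (filter_congr fun W _ => ?_) fun _ _ => rfl
  have : (0 : ℝ) < n := by exact_mod_cast hn
  rw [htEstimator_sub_ate, htEstimator_sub_ate, abs_div, abs_div, ge_iff_le,
    div_le_div_iff_of_pos_right (by positivity)]
  exact_mod_cast Iff.rfl

theorem bernoulliDesign_half {n : ℕ} (Z : Assignment n) :
    bernoulliDesign n (1 / 2) Z = 1 / 2 ^ n := by
  rw [bernoulliDesign, prod_congr rfl (g := fun _ => (1 / 2 : ℝ)) (fun i _ => by split_ifs <;> norm_num)]
  simp

theorem imbalance_eq_signedSum {n : ℕ} (Y : Outcomes n) (Z : Assignment n) :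
    imbalance Y Z = signedSum univ (score Y) {i | Z i} := by
  simp [imbalance, signedSum]

theorem abs_score_le {n : ℕ} (Y : Outcomes n) (i : Fin n) : |score Y i| ≤ 2 := by
  rw [score]; cases Y i true <;> cases Y i false <;> simp [ival]

theorem le_pValue_bernoulli_iff {n : ℕ} (hn : 1 ≤ n) {α : ℝ} (hα : α < 1) (Y : Outcomes n)
    (Z : Assignment n) :
    α ≤ pValue (bernoulliDesign n (1 / 2)) (1 / 2) Y Z ↔
      Accepts α #{i | |score Y i| = 1} #{i | |score Y i| = 2} (imbalance Y Z) := by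
  rw [← le_card_div_iff (score Y) univ (fun i _ => abs_score_le Y i) hα, pValue_eq hn,
    sum_congr rfl fun W _ => bernoulliDesign_half W, sum_const, nsmul_eq_mul, card_univ,
    Fintype.card_fin, mul_one_div]
  have : #{W | |imbalance Y Z| ≤ |imbalance Y W|} =
      #{T ∈ (univ : Finset (Fin n)).powerset |
        |imbalance Y Z| ≤ |signedSum univ (score Y) T|} := by
    refine card_nbij' (fun W => ({i | W i} : Finset (Fin n))) (fun T i => decide (i ∈ T)) ?_ ?_ ?_ ?_
    · intro W hW
      simpa [← imbalance_eq_signedSum] using hW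
    · intro T hT
      simpa [imbalance_eq_signedSum] using hT
    · intro W _
      simp
    · intro T _
      simp
  rw [this]

/-! ### Matched pairs: one independent sign per pair. -/

section Pairing

variable {n : ℕ} {mate : Fin n → Fin n}

/-- The treated units index the pairs, so sums over units become sums over pairs. -/
theorem RespectsPairing.sum_eq {Z : Assignment n} (hm : IsPairing mate)
    (hZ : RespectsPairing mate Z) {M : Type*} [AddCommMonoid M] (f : Fin n → M) :
    ∑ i, f i = ∑ i with Z i, (f i + f (mate i)) := by
  rw [← sum_filter_add_sum_filter_not univ (fun i => Z i = true) f, sum_add_distrib]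
  congr 1
  refine sum_nbij' mate mate ?_ ?_ ?_ ?_ ?_
  · intro i hi
    simpa [hZ i] using hi
  · intro i hi
    simpa [hZ i] using hi
  · intro i _
    exact (hm i).1
  · intro i _
    exact (hm i).1
  · intro i _
    rw [(hm i).1]

theorem RespectsPairing.two_mul_card {Z : Assignment n} (hm : IsPairing mate)
    (hZ : RespectsPairing mate Z) : n = 2 * #{i | Z i} := by
  have h := hZ.sum_eq hm (fun _ => 1)
  simp only [sum_const, card_univ, Fintype.card_fin, smul_eq_mul, mul_one] at h
  omega

/-- The difference between the scores of a unit and its partner. -/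
def pairScore (mate : Fin n → Fin n) (Y : Outcomes n) (i : Fin n) : ℤ :=
  score Y i - score Y (mate i)

theorem abs_pairScore_le (Y : Outcomes n) (i : Fin n) : |pairScore mate Y i| ≤ 2 := by
  rw [pairScore, score, score]
  cases Y i true <;> cases Y i false <;> cases Y (mate i) true <;> cases Y (mate i) false <;>
    simp [ival]

theorem imbalance_eq_signedSum_pairs {Z W : Assignment n} (hm : IsPairing mate)
    (hZ : RespectsPairing mate Z) (hW : RespectsPairing mate W) (Y : Outcomes n) :
    imbalance Y W = signedSum {i | Z i} (pairScore mate Y) {i | Z i ∧ W i} := by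
  rw [imbalance, hZ.sum_eq hm, signedSum]
  refine sum_congr rfl fun i hi => ?_
  have hi' : Z i = true := by simpa using hi
  rw [hW i]
  cases h : W i <;> simp [hi', h, pairScore] <;> ring

theorem le_pValue_matchedPairs_iff (hn : 1 ≤ n) {α : ℝ} (hα : α < 1) (hm : IsPairing mate)
    (Y : Outcomes n) {Z : Assignment n} (hZ : RespectsPairing mate Z) :
    α ≤ pValue (matchedPairsDesign mate) (1 / 2) Y Z ↔
      Accepts α #{i | Z i ∧ |pairScore mate Y i| = 1} #{i | Z i ∧ |pairScore mate Y i| = 2}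
        (imbalance Y Z) := by
  classical
  have h := le_card_div_iff (pairScore mate Y) {i | Z i} (fun i _ => abs_pairScore_le Y i) hα
    (imbalance Y Z)
  simp only [filter_filter] at h
  rw [← h, pValue_eq hn]
  have hc := hZ.two_mul_card hm
  have hD : ∀ W, matchedPairsDesign mate W =
      if RespectsPairing mate W then (1 : ℝ) / 2 ^ #{i | Z i} else 0 := by
    intro W
    rw [matchedPairsDesign, show n / 2 = #{i | Z i} by omega, one_div_pow]
  rw [sum_congr rfl fun W _ => hD W, ← sum_filter, sum_const, nsmul_eq_mul, mul_one_div,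
    filter_filter]
  have : #{W | |imbalance Y Z| ≤ |imbalance Y W| ∧ RespectsPairing mate W} =
      #{T ∈ ({i | Z i} : Finset (Fin n)).powerset |
        |imbalance Y Z| ≤ |signedSum {i | Z i} (pairScore mate Y) T|} := by
    -- A pairing-respecting assignment is determined by its values on the units treated in Z;
    -- partners receive the opposite value.
    refine card_nbij' (fun W => ({i | Z i ∧ W i} : Finset (Fin n)))
      (fun T i => if Z i then decide (i ∈ T) else !decide (mate i ∈ T)) ?_ ?_ ?_ ?_
    · intro W hW
      simp only [coe_filter, mem_univ, true_and, Set.mem_ofPred_eq] at hW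
      simp only [coe_filter, mem_powerset, Set.mem_ofPred_eq]
      rw [← imbalance_eq_signedSum_pairs hm hZ hW.2]
      exact ⟨fun i hi => by simp at hi ⊢; exact hi.1, hW.1⟩
    · intro T hT
      simp only [coe_filter, mem_powerset, Set.mem_ofPred_eq] at hT
      have hr : RespectsPairing mate
          (fun i => if Z i then decide (i ∈ T) else !decide (mate i ∈ T)) := by
        intro i
        simp only [hZ i, (hm i).1]
        cases Z i <;> simp
      simp only [coe_filter, mem_univ, true_and, Set.mem_ofPred_eq]
      refine ⟨?_, hr⟩
      rw [imbalance_eq_signedSum_pairs hm hZ hr]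
      convert hT.2 using 3
      ext i
      constructor
      · intro hi
        simp at hi
        simpa [hi.1] using hi.2
      · intro hi
        have hZi : Z i = true := by simpa using hT.1 hi
        simp [hi, hZi]
    · intro W hW
      simp only [coe_filter, mem_univ, true_and, Set.mem_ofPred_eq] at hW
      funext i
      have h1 := hW.2 i
      have h2 := hZ i
      cases hz : Z i <;> simp [hz, h2, h1]
    · intro T hT
      simp only [coe_filter, mem_powerset, Set.mem_ofPred_eq] at hT
      ext i
      constructor
      · intro hi
        simp at hi
        simpa [hi.1] using hi.2
      · intro hi
        have hZi : Z i = true := by simpa using hT.1 hi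
        simp [hi, hZi]
  rw [this]

end Pairing

/-! ### The confidence sets in terms of the observed counts -/

theorem confidenceSet_eq {n : ℕ} (hn : 1 ≤ n) (D : Assignment n → ℝ) (p α : ℝ)
    (Yobs : Fin n → Bool) (Zobs : Assignment n) :
    confidenceSet D p α Yobs Zobs = {τ | ∃ k : ℕ, k ≤ n ∧
      (∃ Y : Outcomes n, (∀ i, Y i (Zobs i) = Yobs i) ∧
        totalEffect Y = (∑ i, ival (Yobs i) * (2 * ival (Zobs i) - 1)) - (∑ i, ival (Zobs i)) + k ∧
        α ≤ pValue D p Y Zobs) ∧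
      τ = (((∑ i, ival (Yobs i) * (2 * ival (Zobs i) - 1)) - (∑ i, ival (Zobs i)) + k : ℤ) : ℝ)
        / n} := by
  have hn' : (n : ℝ) ≠ 0 := by positivity
  ext τ
  simp only [confidenceSet, candidates, Compatible, val_eq_ival, Set.mem_ofPred_eq]
  constructor
  · rintro ⟨⟨k, hk, rfl⟩, Y, ⟨h1, h2⟩, h3⟩
    refine ⟨k, hk, ⟨Y, h1, ?_, h3⟩, by push_cast; rfl⟩
    rw [ate_eq, div_left_inj' hn'] at h2
    exact_mod_cast h2
  · rintro ⟨k, hk, ⟨Y, h1, h2, h3⟩, rfl⟩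
    refine ⟨⟨k, hk, by push_cast; rfl⟩, Y, ⟨h1, ?_⟩, h3⟩
    rw [ate_eq, h2]

end RandExp

/-! ### Tail tests and the sweeps through them. -/

namespace RandExp

open Finset

/-- The randomization test in terms of the cumulated coefficients up to degree `k`. -/
def TailTest (α : ℝ) (a b : ℕ) (k : ℤ) : Prop :=
  α * 2 ^ (a + b) ≤ 2 * cumCoeff a b k ∧
    α * 2 ^ (a + b) ≤ 2 * (2 ^ (a + b) - cumCoeff a b k + genCoeff a b k)

/-- The ways in which a sweep moves from one test to the next: to the next coefficient, to one more
factor `1 + z`, to one more factor `1 + z ^ 2`, or from a factor `1 + z` to a factor `1 + z ^ 2`. -/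
inductive Move
  | coeff | single | double | trade

/-- The number of factors `1 + z` after `i` moves. -/
def Move.singles (m : Move) (a i : ℕ) : ℕ :=
  match m with
  | .single => a + i
  | .trade => a - i
  | _ => a

/-- The number of factors `1 + z ^ 2` after `i` moves. -/
def Move.doubles (m : Move) (b i : ℕ) : ℕ :=
  match m with
  | .double => b + i
  | .trade => b + i
  | _ => b

/-- The degree after `i` moves. -/
def Move.degree (m : Move) (k i : ℕ) : ℕ :=
  match m with
  | .coeff => k + i
  | _ => k

/-- The positions `pos + δ * i` for which the `i`-th of `cnt` tests accepts. -/
def sweepSet (m : Move) (α : ℝ) (a b k : ℕ) (pos δ : ℤ) (cnt : ℕ) : Set ℕ :=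
  {q | ∃ i < cnt, (q : ℤ) = pos + δ * i ∧
    TailTest α (m.singles a i) (m.doubles b i) (m.degree k i)}

theorem tailTest_iff {α : ℝ} {a b : ℕ} {x k : ℤ}
    (h : 2 * k = a + 2 * b + x ∨ 2 * k = a + 2 * b - x) :
    TailTest α a b k ↔ Accepts α a b x := (accepts_iff h).symm

/-! ### Imputed tables -/

/-- Tables enter only through counts; this realizes any admissible family of counts by an actual set
of units. -/
theorem exists_subset_card_fibers {ι κ : Type*} [DecidableEq κ] (g : ι → κ) (U : Finset ι)
    (x : κ → ℕ) (hx : ∀ c, x c ≤ #{i ∈ U | g i = c}) :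
    ∃ T ⊆ U, ∀ c, #{i ∈ T | g i = c} = x c := by
  classical
  choose f hf hc using fun c => exists_subset_card_eq (hx c)
  refine ⟨{i ∈ U | i ∈ f (g i)}, filter_subset _ _, fun c => ?_⟩
  rw [← hc c, filter_filter]
  congr 1
  ext i
  have := @hf c i
  simp only [mem_filter] at this ⊢
  constructor
  · rintro ⟨-, h, rfl⟩
    exact h
  · intro h
    obtain ⟨h1, rfl⟩ := this h
    exact ⟨h1, h, rfl⟩

/-- The observed total. -/
def observedEffect {n : ℕ} (Yobs : Fin n → Bool) (Zobs : Assignment n) : ℤ :=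
  ∑ i, ival (Yobs i) * (2 * ival (Zobs i) - 1)

/-- The sum is n times the estimator at the observed assignment, which involves no imputed outcome.
Hence the critical value is the same for all compatible tables with the same effect. -/
theorem imbalance_add_totalEffect {n : ℕ} {Yobs : Fin n → Bool} {Zobs : Assignment n}
    {Y : Outcomes n} (hY : ∀ i, Y i (Zobs i) = Yobs i) :
    imbalance Y Zobs + totalEffect Y = 2 * observedEffect Yobs Zobs := by
  rw [imbalance, totalEffect, observedEffect, ← sum_add_distrib, mul_sum]
  refine sum_congr rfl fun i _ => ?_
  rw [← hY i, score]
  cases hz : Zobs i <;> cases h₁ : Y i true <;> cases h₀ : Y i false <;> simp [ival, h₁, h₀]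

/-! ### Bernoulli design: tables through the counts of imputed ones in the four observed cells. -/

section Bernoulli

variable {n : ℕ}

/-- The number of units with observed assignment `z` and observed outcome `y`. -/
def cellCount (Yobs : Fin n → Bool) (Zobs : Assignment n) (z y : Bool) : ℕ :=
  #{i | Zobs i = z ∧ Yobs i = y}

/-- The number of units with observed assignment `z`, observed outcome `y` and imputed outcome
`1`. -/
def imputedCount (Yobs : Fin n → Bool) (Zobs : Assignment n) (Y : Outcomes n) (z y : Bool) : ℕ :=
  #{i | Zobs i = z ∧ Yobs i = y ∧ Y i (!z) = true}

theorem imputedCount_le (Yobs : Fin n → Bool) (Zobs : Assignment n) (Y : Outcomes n)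
    (z y : Bool) : imputedCount Yobs Zobs Y z y ≤ cellCount Yobs Zobs z y :=
  card_le_card fun i => by simp +contextual

theorem observedEffect_eq (Yobs : Fin n → Bool) (Zobs : Assignment n) :
    observedEffect Yobs Zobs =
      cellCount Yobs Zobs true true - cellCount Yobs Zobs false true := by
  simp only [observedEffect, cellCount, card_filter, Nat.cast_sum, ← sum_sub_distrib]
  refine sum_congr rfl fun i _ => ?_
  cases Zobs i <;> cases Yobs i <;> simp [ival]

theorem sum_ival_eq (Yobs : Fin n → Bool) (Zobs : Assignment n) :
    ∑ i, ival (Zobs i) = cellCount Yobs Zobs true true + cellCount Yobs Zobs true false := by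
  simp only [cellCount, card_filter, Nat.cast_sum, ← sum_add_distrib]
  refine sum_congr rfl fun i _ => ?_
  cases Zobs i <;> cases Yobs i <;> simp [ival]

theorem card_eq_cellCounts (Yobs : Fin n → Bool) (Zobs : Assignment n) :
    n = cellCount Yobs Zobs true true + cellCount Yobs Zobs true false +
      cellCount Yobs Zobs false true + cellCount Yobs Zobs false false := by
  simp only [cellCount, card_filter, ← sum_add_distrib]
  rw [sum_congr rfl (g := fun _ => 1)]
  · simp
  · intro i _
    cases Zobs i <;> cases Yobs i <;> simp

variable {Yobs : Fin n → Bool} {Zobs : Assignment n} {Y : Outcomes n}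

theorem card_score_one (hY : ∀ i, Y i (Zobs i) = Yobs i) :
    #{i | |score Y i| = 1} + imputedCount Yobs Zobs Y true true +
      imputedCount Yobs Zobs Y false true =
    cellCount Yobs Zobs true true + cellCount Yobs Zobs false true +
      imputedCount Yobs Zobs Y true false + imputedCount Yobs Zobs Y false false := by
  simp only [cellCount, imputedCount, card_filter, ← sum_add_distrib]
  refine sum_congr rfl fun i _ => ?_
  have h := hY i
  rw [← h, score]
  cases hz : Zobs i <;> cases h₁ : Y i true <;> cases h₀ : Y i false <;> simp [ival, h₁, h₀]

theorem card_score_two (hY : ∀ i, Y i (Zobs i) = Yobs i) :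
    #{i | |score Y i| = 2} =
      imputedCount Yobs Zobs Y true true + imputedCount Yobs Zobs Y false true := by
  simp only [imputedCount, card_filter, ← sum_add_distrib]
  refine sum_congr rfl fun i _ => ?_
  have h := hY i
  rw [← h, score]
  cases hz : Zobs i <;> cases h₁ : Y i true <;> cases h₀ : Y i false <;> simp [ival, h₁, h₀]

theorem totalEffect_eq (hY : ∀ i, Y i (Zobs i) = Yobs i) :
    totalEffect Y = observedEffect Yobs Zobs - imputedCount Yobs Zobs Y true true -
      imputedCount Yobs Zobs Y true false + imputedCount Yobs Zobs Y false true +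
      imputedCount Yobs Zobs Y false false := by
  simp only [totalEffect, observedEffect, imputedCount, card_filter, Nat.cast_sum,
    ← sum_add_distrib, ← sum_sub_distrib]
  refine sum_congr rfl fun i _ => ?_
  have h := hY i
  rw [← h]
  cases hz : Zobs i <;> cases h₁ : Y i true <;> cases h₀ : Y i false <;> simp [ival, h₁, h₀]

theorem exists_imputedCount_eq (Yobs : Fin n → Bool) (Zobs : Assignment n) (x : Bool → Bool → ℕ)
    (hx : ∀ z y, x z y ≤ cellCount Yobs Zobs z y) :
    ∃ Y : Outcomes n, (∀ i, Y i (Zobs i) = Yobs i) ∧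
      ∀ z y, imputedCount Yobs Zobs Y z y = x z y := by
  obtain ⟨T, -, hT⟩ := exists_subset_card_fibers (fun i => (Zobs i, Yobs i)) univ
    (fun c => x c.1 c.2) (fun c => by simpa [cellCount, Prod.ext_iff] using hx c.1 c.2)
  refine ⟨fun i z => if z = Zobs i then Yobs i else decide (i ∈ T), fun i => by simp,
    fun z y => ?_⟩
  rw [← hT (z, y), imputedCount]
  congr 1
  ext i
  simp only [mem_filter, mem_univ, true_and, Prod.mk.injEq]
  constructor
  · rintro ⟨rfl, rfl, h⟩
    simpa using h
  · rintro ⟨h, rfl, rfl⟩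
    simpa using h

end Bernoulli

/-- The accepted indices for the Bernoulli design, in terms of the cell counts
`c₁₁, c₁₀, c₀₁, c₀₀` (assignment, outcome). -/
def bernoulliAccepted (α : ℝ) (c₁₁ c₁₀ c₀₁ c₀₀ : ℕ) : Set ℕ :=
  sweepSet .single α 0 (c₁₁ + c₀₁) (2 * c₁₁) (c₁₀ + c₀₁) 1 1 ∪
  sweepSet .trade α (c₀₁ + c₁₀) c₁₁ (2 * c₁₁ + c₁₀) 0 1 c₀₁ ∪
  sweepSet .single α c₁₀ (c₁₁ + c₀₁) (2 * c₁₁ + c₁₀) c₀₁ 1 (c₀₀ + 1) ∪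
  sweepSet .trade α (c₁₁ + c₀₀) c₀₁ (2 * c₀₁ + c₀₀) (c₁₁ + c₁₀ + c₀₁ + c₀₀) (-1) c₁₁ ∪
  sweepSet .single α c₀₀ (c₁₁ + c₀₁) (2 * c₀₁ + c₀₀) (c₁₀ + c₀₁ + c₀₀) (-1) (c₁₀ + 1)

/-- Both b and a + 2b grow with the imputed ones, subject to their difference between controls and
treated units being fixed by q. For q ≤ c₀₁ + c₀₀ the best choice imputes 1 to all treated units and
to q controls, using first those with outcome 1, where a score 1 becomes 2. For larger q the roles
of the two arms are exchanged. -/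
theorem mem_bernoulliAccepted_of_accepts {α : ℝ} (hα : α < 1) {c₁₁ c₁₀ c₀₁ c₀₀ q : ℕ}
    (hq : q ≤ c₁₁ + c₁₀ + c₀₁ + c₀₀) {x₁₁ x₁₀ x₀₁ x₀₀ a b : ℕ} {x : ℤ} (h₁₁ : x₁₁ ≤ c₁₁)
    (h₁₀ : x₁₀ ≤ c₁₀) (h₀₁ : x₀₁ ≤ c₀₁) (h₀₀ : x₀₀ ≤ c₀₀)
    (hd : x₀₁ + x₀₀ + (c₁₁ + c₁₀) = q + (x₁₁ + x₁₀))
    (ha : a + x₁₁ + x₀₁ = c₁₁ + c₀₁ + x₁₀ + x₀₀) (hb : b = x₁₁ + x₀₁)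
    (hx : x + q + c₀₁ = 2 * c₁₁ + c₁₀) (h : Accepts α a b x) :
    q ∈ bernoulliAccepted α c₁₁ c₁₀ c₀₁ c₀₀ := by
  -- No score 1 forces x₁₁ = c₁₁, x₀₁ = c₀₁, x₁₀ = x₀₀ = 0, hence q = c₁₀ + c₀₁: a single additional
  -- test.
  rcases Nat.eq_zero_or_pos a with rfl | ha0
  · refine Or.inl (Or.inl (Or.inl (Or.inl ⟨0, one_pos, by push_cast; omega, ?_⟩)))
    simp only [Move.singles, Move.doubles, Move.degree]
    rw [tailTest_iff (x := x) (by omega), show c₁₁ + c₀₁ = b by omega]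
    exact h
  rcases lt_or_ge q c₀₁ with h1 | h1
  · refine Or.inl (Or.inl (Or.inl (Or.inr ⟨q, h1, by ring, ?_⟩)))
    simp only [Move.singles, Move.doubles, Move.degree]
    rw [tailTest_iff (x := x) (by omega)]
    exact h.dominate hα ha0 (by omega) (by omega) (by omega) (by omega)
  rcases le_or_gt q (c₀₁ + c₀₀) with h2 | h2
  · refine Or.inl (Or.inl (Or.inr ⟨q - c₀₁, by omega, by omega, ?_⟩))
    simp only [Move.singles, Move.doubles, Move.degree]
    rw [tailTest_iff (x := x) (by omega)]
    exact h.dominate hα ha0 (by omega) (by omega) (by omega) (by omega)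
  rcases lt_or_ge (c₁₁ + c₁₀ + c₀₁ + c₀₀ - q) c₁₁ with h3 | h3
  · refine Or.inl (Or.inr ⟨c₁₁ + c₁₀ + c₀₁ + c₀₀ - q, h3, by omega, ?_⟩)
    simp only [Move.singles, Move.doubles, Move.degree]
    rw [tailTest_iff (x := x) (by omega)]
    exact h.dominate hα ha0 (by omega) (by omega) (by omega) (by omega)
  · refine Or.inr ⟨c₁₀ + c₀₁ + c₀₀ - q, by omega, by omega, ?_⟩
    simp only [Move.singles, Move.doubles, Move.degree]
    rw [tailTest_iff (x := x) (by omega)]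
    exact h.dominate hα ha0 (by omega) (by omega) (by omega) (by omega)

/-- Each test of a sweep is the test of a feasible table; the witnesses are its counts of imputed
ones. -/
theorem exists_accepts_of_mem_bernoulliAccepted {α : ℝ} {c₁₁ c₁₀ c₀₁ c₀₀ q : ℕ} {x : ℤ}
    (hx : x + q + c₀₁ = 2 * c₁₁ + c₁₀)
    (h : q ∈ bernoulliAccepted α c₁₁ c₁₀ c₀₁ c₀₀) :
    ∃ x₁₁ x₁₀ x₀₁ x₀₀ a b : ℕ, x₁₁ ≤ c₁₁ ∧ x₁₀ ≤ c₁₀ ∧ x₀₁ ≤ c₀₁ ∧ x₀₀ ≤ c₀₀ ∧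
      x₀₁ + x₀₀ + (c₁₁ + c₁₀) = q + (x₁₁ + x₁₀) ∧
      a + x₁₁ + x₀₁ = c₁₁ + c₀₁ + x₁₀ + x₀₀ ∧ b = x₁₁ + x₀₁ ∧ Accepts α a b x := by
  rcases h with (((⟨i, hi, hq, ht⟩ | ⟨i, hi, hq, ht⟩) | ⟨i, hi, hq, ht⟩) | ⟨i, hi, hq, ht⟩) |
    ⟨i, hi, hq, ht⟩ <;> simp only [Move.singles, Move.doubles, Move.degree] at ht <;>
    rw [tailTest_iff (x := x) (by omega)] at ht
  · exact ⟨c₁₁, 0, c₀₁, 0, 0, c₁₁ + c₀₁, le_rfl, by omega, le_rfl, by omega, by omega, by omega, rfl,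
      by simpa [show i = 0 by omega] using ht⟩
  · exact ⟨c₁₁, c₁₀, i, 0, c₀₁ + c₁₀ - i, c₁₁ + i, le_rfl, le_rfl, by omega, by omega, by omega, by omega, rfl, ht⟩
  · exact ⟨c₁₁, c₁₀, c₀₁, i, c₁₀ + i, c₁₁ + c₀₁, le_rfl, le_rfl, by omega, by omega, by omega, by omega, rfl, ht⟩
  · exact ⟨i, 0, c₀₁, c₀₀, c₁₁ + c₀₀ - i, c₀₁ + i, by omega, by omega, by omega, by omega, by omega, by omega,
      by omega, ht⟩
  · exact ⟨c₁₁, i, c₀₁, c₀₀, c₀₀ + i, c₁₁ + c₀₁, by omega, by omega, by omega, by omega, by omega, by omega,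
      by omega, ht⟩

/-- The confidence set for the balanced Bernoulli design. -/
theorem confidenceSet_bernoulli {n : ℕ} (hn : 1 ≤ n) {α : ℝ} (hα : α < 1) (Yobs : Fin n → Bool)
    (Zobs : Assignment n) {c₁₁ c₁₀ c₀₁ c₀₀ : ℕ} (h₁₁ : cellCount Yobs Zobs true true = c₁₁)
    (h₁₀ : cellCount Yobs Zobs true false = c₁₀) (h₀₁ : cellCount Yobs Zobs false true = c₀₁)
    (h₀₀ : cellCount Yobs Zobs false false = c₀₀) :
    confidenceSet (bernoulliDesign n (1 / 2)) (1 / 2) α Yobs Zobs =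
      {τ | ∃ q ≤ n, q ∈ bernoulliAccepted α c₁₁ c₁₀ c₀₁ c₀₀ ∧
        τ = ((-c₀₁ - c₁₀ : ℝ) + q) / n} := by
  have hn' := card_eq_cellCounts Yobs Zobs
  have hS := observedEffect_eq Yobs Zobs
  have hZ := sum_ival_eq Yobs Zobs
  rw [h₁₁, h₁₀, h₀₁, h₀₀] at hn'
  rw [h₁₁, h₀₁] at hS
  rw [h₁₁, h₁₀] at hZ
  rw [confidenceSet_eq hn, ← observedEffect, hS, hZ]
  ext τ
  refine exists_congr fun q => and_congr_right fun hq => and_congr ?_ ?_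
  · constructor
    · rintro ⟨Y, hY, ht, hp⟩
      rw [le_pValue_bernoulli_iff hn hα] at hp
      have h1 := card_score_one hY
      have h2 := card_score_two hY
      have h3 := totalEffect_eq hY
      have h4 := imbalance_add_totalEffect hY
      rw [h₁₁, h₀₁] at h1
      refine mem_bernoulliAccepted_of_accepts hα (hn' ▸ hq)
        ((imputedCount_le Yobs Zobs Y _ _).trans_eq h₁₁)
        ((imputedCount_le Yobs Zobs Y _ _).trans_eq h₁₀)
        ((imputedCount_le Yobs Zobs Y _ _).trans_eq h₀₁)
        ((imputedCount_le Yobs Zobs Y _ _).trans_eq h₀₀) ?_ h1 h2 ?_ hp <;> omega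
    · intro h
      obtain ⟨x₁₁, x₁₀, x₀₁, x₀₀, a, b, l₁₁, l₁₀, l₀₁, l₀₀, hd, ha, hb, hacc⟩ :=
        exists_accepts_of_mem_bernoulliAccepted (x := 2 * c₁₁ + c₁₀ - c₀₁ - q) (by omega) h
      obtain ⟨Y, hY, hc⟩ := exists_imputedCount_eq Yobs Zobs
        (fun z y => bif z then bif y then x₁₁ else x₁₀ else bif y then x₀₁ else x₀₀) (by
          intro z y
          cases z <;> cases y <;> simp <;> omega)
      have h1 := card_score_one hY
      have h2 := card_score_two hY
      have h3 := totalEffect_eq hY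
      have h4 := imbalance_add_totalEffect hY
      simp only [hc, cond_true, cond_false] at h1 h2 h3
      refine ⟨Y, hY, by omega, ?_⟩
      rw [le_pValue_bernoulli_iff hn hα]
      convert hacc using 1 <;> omega
  · push_cast
    ring_nf

end RandExp

namespace RandExp

open Finset

/-! ### Matched pairs: tables through the pairs whose imputed outcomes differ. -/

section MatchedPairs

variable {n : ℕ} {mate : Fin n → Fin n}

/-- The observed outcome of a unit minus that of its partner. -/
def pairDiff (mate : Fin n → Fin n) (Yobs : Fin n → Bool) (i : Fin n) : ℤ :=
  ival (Yobs i) - ival (Yobs (mate i))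

/-- The number of pairs in which the observed treated outcome exceeds the control one by `c`. -/
def pairCount (mate : Fin n → Fin n) (Yobs : Fin n → Bool) (Zobs : Assignment n) (c : ℤ) : ℕ :=
  #{i | Zobs i = true ∧ pairDiff mate Yobs i = c}

/-- The number of pairs counted by `pairCount` for which the imputed outcomes are `0` under control
and `1` under treatment. -/
def upCount (mate : Fin n → Fin n) (Yobs : Fin n → Bool) (Zobs : Assignment n) (Y : Outcomes n)
    (c : ℤ) : ℕ :=
  #{i | Zobs i = true ∧ pairDiff mate Yobs i = c ∧ Y (mate i) true = true ∧ Y i false = false}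

/-- The number of pairs counted by `pairCount` for which the imputed outcomes are `1` under control
and `0` under treatment. -/
def downCount (mate : Fin n → Fin n) (Yobs : Fin n → Bool) (Zobs : Assignment n) (Y : Outcomes n)
    (c : ℤ) : ℕ :=
  #{i | Zobs i = true ∧ pairDiff mate Yobs i = c ∧ Y (mate i) true = false ∧ Y i false = true}

theorem upCount_add_downCount_le (Yobs : Fin n → Bool) (Zobs : Assignment n) (Y : Outcomes n)
    (c : ℤ) : upCount mate Yobs Zobs Y c + downCount mate Yobs Zobs Y c ≤
      pairCount mate Yobs Zobs c := by
  rw [upCount, downCount, pairCount, ← card_union_of_disjoint]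
  · refine card_le_card fun i => ?_
    simp only [mem_union, mem_filter, mem_univ, true_and]
    rintro (⟨h1, h2, -⟩ | ⟨h1, h2, -⟩) <;> exact ⟨h1, h2⟩
  · rw [disjoint_filter]
    rintro i - ⟨-, -, h, -⟩ ⟨-, -, h', -⟩
    rw [h] at h'
    cases h'

theorem card_eq_pairCounts {Zobs : Assignment n} (hm : IsPairing mate)
    (hZ : RespectsPairing mate Zobs) (Yobs : Fin n → Bool) :
    n = 2 * (pairCount mate Yobs Zobs 1 + pairCount mate Yobs Zobs (-1) +
      pairCount mate Yobs Zobs 0) := by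
  conv_lhs => rw [hZ.two_mul_card hm]
  congr 1
  simp only [pairCount, card_filter, ← sum_add_distrib]
  refine sum_congr rfl fun i _ => ?_
  rw [pairDiff]
  cases Zobs i <;> cases Yobs i <;> cases Yobs (mate i) <;> simp [ival]

theorem sum_ival_eq_pairCounts (Yobs : Fin n → Bool) (Zobs : Assignment n) :
    ∑ i, ival (Zobs i) = pairCount mate Yobs Zobs 1 + pairCount mate Yobs Zobs (-1) +
      pairCount mate Yobs Zobs 0 := by
  simp only [pairCount, card_filter, ← sum_add_distrib, Nat.cast_sum]
  refine sum_congr rfl fun i _ => ?_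
  rw [pairDiff]
  cases Zobs i <;> cases Yobs i <;> cases Yobs (mate i) <;> simp [ival]

variable {Zobs : Assignment n}

theorem observedEffect_eq_pairCounts (hm : IsPairing mate) (hZ : RespectsPairing mate Zobs)
    (Yobs : Fin n → Bool) : observedEffect Yobs Zobs =
      pairCount mate Yobs Zobs 1 - pairCount mate Yobs Zobs (-1) := by
  simp only [observedEffect, pairCount, card_filter, Nat.cast_sum, ← sum_sub_distrib]
  rw [hZ.sum_eq hm, sum_filter]
  refine sum_congr rfl fun i _ => ?_
  rw [hZ i, pairDiff]
  cases Zobs i <;> cases Yobs i <;> cases Yobs (mate i) <;> simp [ival]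

variable {Yobs : Fin n → Bool} {Y : Outcomes n}

/-- For a treated unit i with partner m, the pair score is the observed difference plus Y_i(0) -
Y_m(1). An up pair lowers it by 1, a down pair raises it by 1, and equal imputed outcomes leave it
unchanged. -/
theorem card_pairScore_one (hZ : RespectsPairing mate Zobs) (hY : ∀ i, Y i (Zobs i) = Yobs i) :
    #{i | Zobs i ∧ |pairScore mate Y i| = 1} +
      (upCount mate Yobs Zobs Y 1 + downCount mate Yobs Zobs Y 1) +
      (upCount mate Yobs Zobs Y (-1) + downCount mate Yobs Zobs Y (-1)) =
    pairCount mate Yobs Zobs 1 + pairCount mate Yobs Zobs (-1) +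
      (upCount mate Yobs Zobs Y 0 + downCount mate Yobs Zobs Y 0) := by
  simp only [pairCount, upCount, downCount, card_filter, ← sum_add_distrib]
  refine sum_congr rfl fun i _ => ?_
  have h := hY i
  have h' := hY (mate i)
  rw [hZ i] at h'
  cases hz : Zobs i
  · simp
  · rw [hz] at h h'
    simp only [Bool.not_true] at h'
    simp only [pairScore, score, pairDiff, ← h, ← h']
    cases Y i true <;> cases Y i false <;> cases Y (mate i) true <;>
      cases Y (mate i) false <;> simp [ival]

theorem card_pairScore_two (hZ : RespectsPairing mate Zobs) (hY : ∀ i, Y i (Zobs i) = Yobs i) :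
    #{i | Zobs i ∧ |pairScore mate Y i| = 2} =
      downCount mate Yobs Zobs Y 1 + upCount mate Yobs Zobs Y (-1) := by
  simp only [upCount, downCount, card_filter, ← sum_add_distrib]
  refine sum_congr rfl fun i _ => ?_
  have h := hY i
  have h' := hY (mate i)
  rw [hZ i] at h'
  cases hz : Zobs i
  · simp
  · rw [hz] at h h'
    simp only [Bool.not_true] at h'
    simp only [pairScore, score, pairDiff, ← h, ← h']
    cases Y i true <;> cases Y i false <;> cases Y (mate i) true <;>
      cases Y (mate i) false <;> simp [ival]

theorem totalEffect_eq_pairs (hm : IsPairing mate) (hZ : RespectsPairing mate Zobs)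
    (hY : ∀ i, Y i (Zobs i) = Yobs i) :
    totalEffect Y = observedEffect Yobs Zobs +
      (upCount mate Yobs Zobs Y 1 + upCount mate Yobs Zobs Y (-1) + upCount mate Yobs Zobs Y 0) -
      (downCount mate Yobs Zobs Y 1 + downCount mate Yobs Zobs Y (-1) +
        downCount mate Yobs Zobs Y 0) := by
  simp only [totalEffect, observedEffect, upCount, downCount, card_filter, Nat.cast_sum]
  rw [hZ.sum_eq hm, hZ.sum_eq hm (fun i => ival (Yobs i) * (2 * ival (Zobs i) - 1)), sum_filter,
    sum_filter]
  simp only [← sum_add_distrib, ← sum_sub_distrib]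
  refine sum_congr rfl fun i _ => ?_
  have h := hY i
  have h' := hY (mate i)
  rw [hZ i] at h' ⊢
  cases hz : Zobs i
  · simp
  · rw [hz] at h h'
    simp only [Bool.not_true] at h'
    simp only [pairDiff, ← h, ← h']
    cases Y i true <;> cases Y i false <;> cases Y (mate i) true <;>
      cases Y (mate i) false <;> simp [ival]

/-- T selects the pairs with unequal imputed outcomes and P ⊆ T those that go up; in the other pairs
both imputed outcomes are 0. -/
theorem exists_upCount_downCount_eq (hm : IsPairing mate) (hZ : RespectsPairing mate Zobs)
    (Yobs : Fin n → Bool) (u d : ℤ → ℕ) (h : ∀ c, u c + d c ≤ pairCount mate Yobs Zobs c) :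
    ∃ Y : Outcomes n, (∀ i, Y i (Zobs i) = Yobs i) ∧
      (∀ c, upCount mate Yobs Zobs Y c = u c) ∧ ∀ c, downCount mate Yobs Zobs Y c = d c := by
  obtain ⟨T, hT, hTc⟩ := exists_subset_card_fibers (pairDiff mate Yobs) {i | Zobs i = true}
    (fun c => u c + d c) (fun c => by rw [filter_filter]; exact h c)
  obtain ⟨P, hP, hPc⟩ := exists_subset_card_fibers (pairDiff mate Yobs) T u
    (fun c => by rw [hTc]; omega)
  have hQc : ∀ c, #{i ∈ T \ P | pairDiff mate Yobs i = c} = d c := by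
    intro c
    have h1 : ({i ∈ T \ P | pairDiff mate Yobs i = c} : Finset (Fin n)) =
        {i ∈ T | pairDiff mate Yobs i = c} \ {i ∈ P | pairDiff mate Yobs i = c} := by
      ext i
      simp only [mem_filter, Finset.mem_sdiff]
      tauto
    rw [h1, card_sdiff_of_subset (filter_subset_filter _ hP), hTc, hPc]
    omega
  have hTZ : ∀ i ∈ T, Zobs i = true := fun i hi => by simpa using hT hi
  refine ⟨fun i z => if z = Zobs i then Yobs i else if z then decide (mate i ∈ P) else
    decide (i ∈ T \ P), fun i => by simp, fun c => ?_, fun c => ?_⟩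
  · rw [← hPc c, upCount]
    congr 1
    ext i
    simp only [mem_filter, mem_univ, true_and, hZ i, (hm i).1]
    constructor
    · rintro ⟨h1, h2, h3, -⟩
      exact ⟨by simpa [h1] using h3, h2⟩
    · rintro ⟨h1, h2⟩
      have h3 := hTZ i (hP h1)
      exact ⟨h3, h2, by simpa [h3] using h1, by simp [h3, h1]⟩
  · rw [← hQc c, downCount]
    congr 1
    ext i
    simp only [mem_filter, mem_univ, true_and, hZ i, (hm i).1]
    constructor
    · rintro ⟨h1, h2, -, h3⟩
      exact ⟨by simpa [h1] using h3, h2⟩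
    · rintro ⟨h1, h2⟩
      have h3 := hTZ i (Finset.mem_sdiff.1 h1).1
      exact ⟨h3, h2, by simpa [h3] using (Finset.mem_sdiff.1 h1).2, by simpa [h3] using h1⟩

end MatchedPairs

/-- The accepted indices for the matched-pairs design, in terms of the numbers `A`, `C`, `E` of
pairs in which the treated unit has the larger, the smaller and the same observed outcome. -/
def matchedAccepted (α : ℝ) (A C E : ℕ) : Set ℕ :=
  sweepSet .double α 0 C (2 * C) (2 * A + 2 * C + E) (-2) (A + 1) ∪
  sweepSet .double α 0 A (2 * A) E 2 (C + 1) ∪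
  sweepSet .double α E C (E + 2 * C) (2 * (A + C + E)) (-2) (A + 1) ∪
  sweepSet .double α (E + 1) C (E + 2 * C) (2 * (A + C + E) - 1) (-2) A ∪
  sweepSet .double α E A (E + 2 * A) 0 2 (C + 1) ∪
  sweepSet .double α (E + 1) A (E + 2 * A) 1 2 C ∪
  sweepSet .coeff α E (A + C) (2 * C) (2 * C) 2 (E + 1) ∪
  sweepSet .coeff α (E - 1) (A + C) (2 * C) (2 * C + 1) 2 E

/-- Doubled signs come from down pairs among the A and up pairs among the C, unit signs from unequal
pairs among the E. The net number of up pairs is fixed by q. In the middle range all A go down, all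
C go up and the E absorb the rest; beyond it the E all go one way and part of the A or C is turned.
The parity of q decides whether one pair must stay equal, which is why the sweeps have step two. -/
theorem mem_matchedAccepted_of_accepts {α : ℝ} (hα : α < 1) {A C E q : ℕ}
    (hq : q ≤ 2 * (A + C + E)) {uA dA uC dC uE dE a b : ℕ} {x : ℤ} (hA : uA + dA ≤ A)
    (hC : uC + dC ≤ C) (hE : uE + dE ≤ E) (hd : uA + uC + uE + (A + C + E) = q + (dA + dC + dE))
    (ha : a + (uA + dA) + (uC + dC) = A + C + (uE + dE)) (hb : b = dA + uC)
    (hx : x + q = 2 * A + E) (h : Accepts α a b x) : q ∈ matchedAccepted α A C E := by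
  rcases Nat.eq_zero_or_pos a with rfl | ha0
  -- Here every A and C pair is unequal, every E pair equal, and q determines uC - dA. The sum dA +
  -- uC is largest when uC = C or dA = A, whichever bound is met first.
  · rcases le_or_gt (C + dA) (A + uC) with h1 | h1
    · refine Or.inl (Or.inl (Or.inl (Or.inl (Or.inl (Or.inl (Or.inl
        ⟨C + dA - uC, by omega, by omega, ?_⟩))))))
      simp only [Move.singles, Move.doubles, Move.degree]
      rw [tailTest_iff (x := x) (by omega)]
      exact h.zero_dominate hα (by omega) (by omega) (by omega)
    · refine Or.inl (Or.inl (Or.inl (Or.inl (Or.inl (Or.inl (Or.inr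
        ⟨A + uC - dA, by omega, by omega, ?_⟩))))))
      simp only [Move.singles, Move.doubles, Move.degree]
      rw [tailTest_iff (x := x) (by omega)]
      exact h.zero_dominate hα (by omega) (by omega) (by omega)
  rcases le_or_gt (2 * C + 2 * E) q with h1 | h1
  · rcases Nat.even_or_odd' q with ⟨j, rfl | rfl⟩
    · refine Or.inl (Or.inl (Or.inl (Or.inl (Or.inl (Or.inr
        ⟨A + C + E - j, by omega, by omega, ?_⟩)))))
      simp only [Move.singles, Move.doubles, Move.degree]
      rw [tailTest_iff (x := x) (by omega)]
      exact h.dominate hα ha0 (by omega) (by omega) (by omega) (by omega)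
    · refine Or.inl (Or.inl (Or.inl (Or.inl (Or.inr
        ⟨A + C + E - (j + 1), by omega, by omega, ?_⟩))))
      simp only [Move.singles, Move.doubles, Move.degree]
      rw [tailTest_iff (x := x) (by omega)]
      exact h.dominate hα ha0 (by omega) (by omega) (by omega) (by omega)
  rcases le_or_gt q (2 * C) with h2 | h2
  · rcases Nat.even_or_odd' q with ⟨j, rfl | rfl⟩
    · refine Or.inl (Or.inl (Or.inl (Or.inr ⟨j, by omega, by omega, ?_⟩)))
      simp only [Move.singles, Move.doubles, Move.degree]
      rw [tailTest_iff (x := x) (by omega)]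
      exact h.dominate hα ha0 (by omega) (by omega) (by omega) (by omega)
    · refine Or.inl (Or.inl (Or.inr ⟨j, by omega, by omega, ?_⟩))
      simp only [Move.singles, Move.doubles, Move.degree]
      rw [tailTest_iff (x := x) (by omega)]
      exact h.dominate hα ha0 (by omega) (by omega) (by omega) (by omega)
  · rcases Nat.even_or_odd' q with ⟨j, rfl | rfl⟩
    · refine Or.inl (Or.inr ⟨j - C, by omega, by omega, ?_⟩)
      simp only [Move.singles, Move.doubles, Move.degree]
      rw [tailTest_iff (x := x) (by omega)]
      exact h.dominate hα ha0 (by omega) (by omega) (by omega) (by omega)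
    · refine Or.inr ⟨j - C, by omega, by omega, ?_⟩
      simp only [Move.singles, Move.doubles, Move.degree]
      rw [tailTest_iff (x := x) (by omega)]
      exact h.dominate hα ha0 (by omega) (by omega) (by omega) (by omega)

theorem exists_accepts_of_mem_matchedAccepted {α : ℝ} {A C E q : ℕ} {x : ℤ}
    (hx : x + q = 2 * A + E) (h : q ∈ matchedAccepted α A C E) :
    ∃ uA dA uC dC uE dE a b : ℕ, uA + dA ≤ A ∧ uC + dC ≤ C ∧ uE + dE ≤ E ∧
      uA + uC + uE + (A + C + E) = q + (dA + dC + dE) ∧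
      a + (uA + dA) + (uC + dC) = A + C + (uE + dE) ∧ b = dA + uC ∧ Accepts α a b x := by
  rcases h with ((((((⟨i, hi, hq, ht⟩ | ⟨i, hi, hq, ht⟩) | ⟨i, hi, hq, ht⟩) | ⟨i, hi, hq, ht⟩) |
    ⟨i, hi, hq, ht⟩) | ⟨i, hi, hq, ht⟩) | ⟨i, hi, hq, ht⟩) | ⟨i, hi, hq, ht⟩ <;>
    simp only [Move.singles, Move.doubles, Move.degree] at ht <;>
    rw [tailTest_iff (x := x) (by omega)] at ht
  · exact ⟨A - i, i, C, 0, 0, 0, 0, C + i, by omega, by omega, by omega, by omega, by omega,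
      by omega, ht⟩
  · exact ⟨0, A, i, C - i, 0, 0, 0, A + i, by omega, by omega, by omega, by omega, by omega,
      by omega, ht⟩
  · exact ⟨A - i, i, C, 0, E, 0, E, C + i, by omega, by omega, by omega, by omega, by omega,
      by omega, ht⟩
  · exact ⟨A - i - 1, i, C, 0, E, 0, E + 1, C + i, by omega, by omega, by omega, by omega,
      by omega, by omega, ht⟩
  · exact ⟨0, A, i, C - i, 0, E, E, A + i, by omega, by omega, by omega, by omega, by omega,
      by omega, ht⟩
  · exact ⟨0, A, i, C - i - 1, 0, E, E + 1, A + i, by omega, by omega, by omega, by omega,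
      by omega, by omega, ht⟩
  · exact ⟨0, A, C, 0, i, E - i, E, A + C, by omega, by omega, by omega, by omega, by omega,
      by omega, ht⟩
  -- This sweep has E tests, so an index in it forces E ≥ 1 and the truncated subtraction is exact.
  · exact ⟨0, A, C, 0, i, E - 1 - i, E - 1, A + C, by omega, by omega, by omega, by omega,
      by omega, by omega, ht⟩

/-- The confidence set for the matched-pairs design. -/
theorem confidenceSet_matchedPairs {n : ℕ} (hn : 1 ≤ n) {α : ℝ} (hα : α < 1)
    {mate : Fin n → Fin n} (hm : IsPairing mate) (Yobs : Fin n → Bool) {Zobs : Assignment n}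
    (hZ : RespectsPairing mate Zobs) {A C E : ℕ} (hA : pairCount mate Yobs Zobs 1 = A)
    (hC : pairCount mate Yobs Zobs (-1) = C) (hE : pairCount mate Yobs Zobs 0 = E) :
    confidenceSet (matchedPairsDesign mate) (1 / 2) α Yobs Zobs =
      {τ | ∃ q ≤ n, q ∈ matchedAccepted α A C E ∧ τ = ((-2 * C - E : ℝ) + q) / n} := by
  have hn' := card_eq_pairCounts hm hZ Yobs
  have hS := observedEffect_eq_pairCounts hm hZ Yobs
  have hN := sum_ival_eq_pairCounts (mate := mate) Yobs Zobs
  rw [hA, hC, hE] at hn'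
  rw [hA, hC] at hS
  rw [hA, hC, hE] at hN
  rw [confidenceSet_eq hn, ← observedEffect, hS, hN]
  ext τ
  refine exists_congr fun q => and_congr_right fun hq => and_congr ?_ ?_
  · constructor
    · rintro ⟨Y, hY, ht, hp⟩
      rw [le_pValue_matchedPairs_iff hn hα hm Y hZ] at hp
      have h1 := card_pairScore_one hZ hY
      have h2 := card_pairScore_two hZ hY
      have h3 := totalEffect_eq_pairs hm hZ hY
      have h4 := imbalance_add_totalEffect hY
      rw [hA, hC] at h1
      refine mem_matchedAccepted_of_accepts hα (hn' ▸ hq)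
        ((upCount_add_downCount_le (mate := mate) Yobs Zobs Y _).trans_eq hA)
        ((upCount_add_downCount_le (mate := mate) Yobs Zobs Y _).trans_eq hC)
        ((upCount_add_downCount_le (mate := mate) Yobs Zobs Y _).trans_eq hE)
        ?_ h1 h2 ?_ hp <;> omega
    · intro h
      obtain ⟨uA, dA, uC, dC, uE, dE, a, b, lA, lC, lE, hd, ha, hb, hacc⟩ :=
        exists_accepts_of_mem_matchedAccepted (x := 2 * A + E - q) (by omega) h
      obtain ⟨Y, hY, hu, hd'⟩ := exists_upCount_downCount_eq hm hZ Yobs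
        (fun c => if c = 1 then uA else if c = -1 then uC else if c = 0 then uE else 0)
        (fun c => if c = 1 then dA else if c = -1 then dC else if c = 0 then dE else 0) (by
          intro c
          split_ifs with e1 e2 e3
          · rw [e1, hA]; exact lA
          · rw [e2, hC]; exact lC
          · rw [e3, hE]; exact lE
          · exact Nat.zero_le _)
      have h1 := card_pairScore_one hZ hY
      have h2 := card_pairScore_two hZ hY
      have h3 := totalEffect_eq_pairs hm hZ hY
      have h4 := imbalance_add_totalEffect hY
      norm_num [hu, hd'] at h1 h2 h3
      refine ⟨Y, hY, by omega, ?_⟩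
      rw [le_pValue_matchedPairs_iff hn hα hm Y hZ]
      convert hacc using 1 <;> omega
  · push_cast
    ring_nf

end RandExp

/-! ### A structured language for the random access machine -/

namespace RAM

/-- Arithmetic expressions over the variables `V`. -/
inductive Expr (V : Type)
  | var (v : V)
  | num (c : ℤ)
  | bin (op : ArithOp) (e e' : Expr V)

namespace Expr

variable {V : Type}

instance : Add (Expr V) := ⟨bin .add⟩
instance : Sub (Expr V) := ⟨bin .sub⟩
instance : Mul (Expr V) := ⟨bin .mul⟩
instance : Div (Expr V) := ⟨bin .div⟩
instance (k : ℕ) : OfNat (Expr V) k := ⟨num k⟩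

/-- The value of an expression. -/
noncomputable def eval (x : V → ℝ) : Expr V → ℝ
  | var v => x v
  | num c => c
  | bin op e e' => op.eval (e.eval x) (e'.eval x)

@[simp] theorem eval_var (x : V → ℝ) (v : V) : (var v).eval x = x v := rfl

@[simp] theorem eval_num (x : V → ℝ) (c : ℤ) : (num c).eval x = c := rfl

@[simp] theorem eval_add (x : V → ℝ) (e e' : Expr V) : (e + e').eval x = e.eval x + e'.eval x := rfl

@[simp] theorem eval_sub (x : V → ℝ) (e e' : Expr V) : (e - e').eval x = e.eval x - e'.eval x := rfl

@[simp] theorem eval_mul (x : V → ℝ) (e e' : Expr V) : (e * e').eval x = e.eval x * e'.eval x := rfl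

@[simp] theorem eval_div (x : V → ℝ) (e e' : Expr V) : (e / e').eval x = e.eval x / e'.eval x := rfl

@[simp] theorem eval_ofNat (x : V → ℝ) (k : ℕ) :
    (no_index (OfNat.ofNat k : Expr V)).eval x = ((OfNat.ofNat k : ℕ) : ℝ) := by
  change ((k : ℤ) : ℝ) = k
  simp

/-- The number of instructions that evaluate an expression. -/
def size : Expr V → ℕ
  | var _ => 1
  | num _ => 1
  | bin _ e e' => e.size + e'.size + 1

/-- Code that puts the value of an expression into the `j`-th odd register, where the variable `v`
is kept in the even register `2 * ρ v`. -/
def code (ρ : V → ℕ) : Expr V → ℕ → List Instr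
  | var v, j => [.move (2 * j + 1) (2 * ρ v)]
  | num c, j => [.const (2 * j + 1) c]
  | bin op e e', j =>
      e.code ρ j ++ e'.code ρ (j + 1) ++ [.arith op (2 * j + 1) (2 * j + 1) (2 * (j + 1) + 1)]

theorem length_code (ρ : V → ℕ) (e : Expr V) (j : ℕ) : (e.code ρ j).length = e.size := by
  induction e generalizing j with
  | var v => rfl
  | num c => rfl
  | bin op e e' ih ih' => simp [code, size, ih, ih', add_assoc]

end Expr

/-- The program contains a piece of code at a given position. -/
def CodeAt (P : Program) (l : ℕ) (code : List Instr) : Prop :=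
  ∀ i < code.length, P[l + i]? = code[i]?

theorem CodeAt.left {P : Program} {l : ℕ} {c c' : List Instr} (h : CodeAt P l (c ++ c')) :
    CodeAt P l c := by
  intro i hi
  rw [h i (by rw [List.length_append]; omega), List.getElem?_append_left hi]

theorem CodeAt.right {P : Program} {l : ℕ} {c c' : List Instr} (h : CodeAt P l (c ++ c')) :
    CodeAt P (l + c.length) c' := by
  intro i hi
  have := h (c.length + i) (by rw [List.length_append]; omega)
  rw [List.getElem?_append_right (by omega)] at this
  rw [add_assoc, this]
  congr 1
  omega

theorem CodeAt.head {P : Program} {l : ℕ} {a : Instr} {c : List Instr} (h : CodeAt P l (a :: c)) :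
    P[l]? = some a := by
  simpa using h 0 (by simp)

/-- The machine gets from `c` to `c'` in `t` steps. -/
def Reaches (P : Program) (c : Config) (t : ℕ) (c' : Config) : Prop := (step P)^[t] c = c'

theorem Reaches.trans {P : Program} {c c' c'' : Config} {t t' : ℕ} (h : Reaches P c t c')
    (h' : Reaches P c' t' c'') : Reaches P c (t + t') c'' := by
  rw [Reaches, add_comm, Function.iterate_add_apply, h, h']

theorem Reaches.single {P : Program} {c c' : Config} (h : step P c = c') : Reaches P c 1 c' := h

/-- The code of an expression is correct. -/
theorem Expr.reaches {V : Type} {P : Program} (ρ : V → ℕ) {x : V → ℝ} (e : Expr V) {l j : ℕ}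
    (h : CodeAt P l (e.code ρ j)) {reg mem : ℕ → ℝ} (hr : ∀ v, reg (2 * ρ v) = x v) :
    ∃ reg', Reaches P ⟨l, reg, mem⟩ e.size ⟨l + e.size, reg', mem⟩ ∧
      reg' (2 * j + 1) = e.eval x ∧ (∀ i, reg' (2 * i) = reg (2 * i)) ∧
      ∀ i < j, reg' (2 * i + 1) = reg (2 * i + 1) := by
  induction e generalizing l j reg with
  | var v =>
    refine ⟨Function.update reg (2 * j + 1) (x v), Reaches.single ?_, by simp, fun i => ?_,
      fun i hi => ?_⟩
    · simp [step, CodeAt.head h, Expr.size, hr]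
    · rw [Function.update_of_ne (by omega)]
    · rw [Function.update_of_ne (by omega)]
  | num c =>
    refine ⟨Function.update reg (2 * j + 1) c, Reaches.single ?_, by simp, fun i => ?_,
      fun i hi => ?_⟩
    · simp [step, CodeAt.head h, Expr.size]
    · rw [Function.update_of_ne (by omega)]
    · rw [Function.update_of_ne (by omega)]
  | bin op e e' ih ih' =>
    rw [Expr.code] at h
    obtain ⟨r1, h1, v1, e1, o1⟩ := ih h.left.left hr
    have hc := h.left.right
    rw [Expr.length_code] at hc
    -- The odd registers serve as a stack: the second operand is evaluated one place higher, so the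
    -- first value survives.
    obtain ⟨r2, h2, v2, e2, o2⟩ := ih' hc (reg := r1) (fun v => (e1 _).trans (hr v))
    have hd := h.right.head
    rw [List.length_append, Expr.length_code, Expr.length_code, ← add_assoc] at hd
    refine ⟨Function.update r2 (2 * j + 1) (op.eval (e.eval x) (e'.eval x)),
      (h1.trans h2).trans (Reaches.single ?_), by simp [Expr.eval], fun i => ?_, fun i hi => ?_⟩
    · simp [step, hd, Expr.size, v2, o2 j (Nat.lt_succ_self j), v1, ← add_assoc]
    · rw [Function.update_of_ne (by omega), e2, e1]
    · rw [Function.update_of_ne (by omega), o2 i (by omega), o1 i hi]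

/-- The values of the variables and the contents of the memory. -/
structure Store (V : Type) where
  var : V → ℝ
  mem : ℕ → ℝ

/-- Structured programs. The conditions of `ite` and `loop` are inequalities `e ≤ e'`. -/
inductive Cmd (V : Type)
  | skip
  | assign (v : V) (e : Expr V)
  | load (v : V) (e : Expr V)
  | store (e e' : Expr V)
  | seq (c c' : Cmd V)
  | ite (e e' : Expr V) (c c' : Cmd V)
  | loop (e e' : Expr V) (c : Cmd V)

/-! ### Structured programs and their compilation. -/

namespace Cmd

variable {V : Type}

/-- The number of instructions of a structured program. -/
def size : Cmd V → ℕ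
  | skip => 0
  | assign _ e => e.size + 1
  | load _ e => e.size + 1
  | store e e' => e.size + e'.size + 1
  | seq c c' => c.size + c'.size
  | ite e e' c c' => e.size + e'.size + 1 + c'.size + 1 + c.size
  | loop e e' c => e.size + e'.size + 1 + 1 + c.size + 1

/-- The code of a structured program, to be put at position `l`. -/
def code (ρ : V → ℕ) : Cmd V → ℕ → List Instr
  | skip, _ => []
  | assign v e, _ => e.code ρ 0 ++ [.move (2 * ρ v) 1]
  | load v e, _ => e.code ρ 0 ++ [.load (2 * ρ v) 1]
  | store e e', _ => e.code ρ 0 ++ e'.code ρ 1 ++ [.store 1 3]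
  | seq c c', l => c.code ρ l ++ c'.code ρ (l + c.size)
  | ite e e' c c', l =>
      e.code ρ 0 ++ e'.code ρ 1 ++ [.jumpLE 1 3 (l + (e.size + e'.size + 1 + c'.size + 1))] ++
        c'.code ρ (l + (e.size + e'.size + 1)) ++
        [.jump (l + (e.size + e'.size + 1 + c'.size + 1 + c.size))] ++
        c.code ρ (l + (e.size + e'.size + 1 + c'.size + 1))
  | loop e e' c, l =>
      e.code ρ 0 ++ e'.code ρ 1 ++ [.jumpLE 1 3 (l + (e.size + e'.size + 1 + 1))] ++
        [.jump (l + (e.size + e'.size + 1 + 1 + c.size + 1))] ++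
        c.code ρ (l + (e.size + e'.size + 1 + 1)) ++ [.jump l]

theorem length_code (ρ : V → ℕ) (c : Cmd V) (l : ℕ) : (c.code ρ l).length = c.size := by
  induction c generalizing l <;> simp_all [code, size, Expr.length_code] <;> omega

/-- Two expressions are evaluated and compared. -/
theorem reaches_compare {P : Program} (ρ : V → ℕ) {e e' : Expr V} {l m : ℕ} {x : V → ℝ}
    (h : CodeAt P l (e.code ρ 0 ++ e'.code ρ 1 ++ [.jumpLE 1 3 m])) {reg : ℕ → ℝ}
    (mem : ℕ → ℝ) (hr : ∀ v, reg (2 * ρ v) = x v) :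
    ∃ reg', (∀ v, reg' (2 * ρ v) = x v) ∧
      (e.eval x ≤ e'.eval x → Reaches P ⟨l, reg, mem⟩ (e.size + e'.size + 1) ⟨m, reg', mem⟩) ∧
      (¬ e.eval x ≤ e'.eval x → Reaches P ⟨l, reg, mem⟩ (e.size + e'.size + 1)
        ⟨l + (e.size + e'.size + 1), reg', mem⟩) := by
  obtain ⟨r1, h1, v1, e1, o1⟩ := e.reaches (mem := mem) ρ h.left.left hr
  have hc := h.left.right
  rw [Expr.length_code] at hc
  obtain ⟨r2, h2, v2, e2, o2⟩ := e'.reaches (mem := mem) ρ hc (reg := r1) (fun v => (e1 _).trans (hr v))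
  have hd := h.right.head
  rw [List.length_append, Expr.length_code, Expr.length_code, ← add_assoc] at hd
  have o := o2 0 one_pos
  rw [v1] at o
  norm_num at o v2
  refine ⟨r2, fun v => by rw [e2, e1, hr], fun hle => (h1.trans h2).trans (Reaches.single ?_),
    fun hle => (h1.trans h2).trans (Reaches.single ?_)⟩
  · simp [step, hd, o, v2, hle]
  · simp [step, hd, o, v2, hle, ← add_assoc]

/-! ### Timed semantics, correctness of the compilation, and specifications with time bounds. -/

variable [DecidableEq V]

/-- In the store `s` the program runs for `t` steps and ends in the store `s'`. -/
inductive Exec : Cmd V → Store V → ℕ → Store V → Prop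
  | skip (s : Store V) : Exec skip s 0 s
  | assign (v : V) (e : Expr V) (s : Store V) :
      Exec (assign v e) s (e.size + 1) ⟨Function.update s.var v (e.eval s.var), s.mem⟩
  | load (v : V) (e : Expr V) (s : Store V) (k : ℕ) (h : e.eval s.var = k) :
      Exec (load v e) s (e.size + 1) ⟨Function.update s.var v (s.mem k), s.mem⟩
  | store (e e' : Expr V) (s : Store V) (k : ℕ) (h : e.eval s.var = k) :
      Exec (store e e') s (e.size + e'.size + 1)
        ⟨s.var, Function.update s.mem k (e'.eval s.var)⟩
  | seq {c c' : Cmd V} {s s' s'' : Store V} {t t' : ℕ} (h : Exec c s t s') (h' : Exec c' s' t' s'') :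
      Exec (seq c c') s (t + t') s''
  | ite_pos {e e' : Expr V} {c c' : Cmd V} {s s' : Store V} {t : ℕ}
      (he : e.eval s.var ≤ e'.eval s.var) (h : Exec c s t s') :
      Exec (ite e e' c c') s (e.size + e'.size + 1 + t) s'
  | ite_neg {e e' : Expr V} {c c' : Cmd V} {s s' : Store V} {t : ℕ}
      (he : ¬ e.eval s.var ≤ e'.eval s.var) (h : Exec c' s t s') :
      Exec (ite e e' c c') s (e.size + e'.size + 1 + t + 1) s'
  | loop_pos {e e' : Expr V} {c : Cmd V} {s s' s'' : Store V} {t t' : ℕ}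
      (he : e.eval s.var ≤ e'.eval s.var) (h : Exec c s t s') (h' : Exec (loop e e' c) s' t' s'') :
      Exec (loop e e' c) s (e.size + e'.size + 1 + t + 1 + t') s''
  | loop_neg {e e' : Expr V} {c : Cmd V} {s : Store V} (he : ¬ e.eval s.var ≤ e'.eval s.var) :
      Exec (loop e e' c) s (e.size + e'.size + 1 + 1) s

/-- The code of a structured program is correct. -/
theorem Exec.reaches {P : Program} {ρ : V → ℕ} (hρ : Function.Injective ρ) {c : Cmd V}
    {s s' : Store V} {t : ℕ} (h : Exec c s t s') {l : ℕ} (hc : CodeAt P l (c.code ρ l))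
    {reg : ℕ → ℝ} (hr : ∀ v, reg (2 * ρ v) = s.var v) :
    ∃ reg', Reaches P ⟨l, reg, s.mem⟩ t ⟨l + c.size, reg', s'.mem⟩ ∧
      ∀ v, reg' (2 * ρ v) = s'.var v := by
  -- Injectivity of the numbering makes a write to one variable invisible to the others.
  have hupd : ∀ (r : ℕ → ℝ) (x : V → ℝ) (v : V) (y : ℝ), (∀ w, r (2 * ρ w) = x w) →
      ∀ w, Function.update r (2 * ρ v) y (2 * ρ w) = Function.update x v y w := by
    intro r x v y h w
    rcases eq_or_ne w v with rfl | hw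
    · simp
    · rw [Function.update_of_ne hw, Function.update_of_ne, h]
      have := hρ.ne hw
      omega
  induction h generalizing l reg with
  | skip s => exact ⟨reg, rfl, hr⟩
  | assign v e s =>
    obtain ⟨r1, h1, v1, e1, -⟩ := e.reaches (mem := s.mem) ρ hc.left hr
    have hd := hc.right.head
    rw [Expr.length_code] at hd
    refine ⟨Function.update r1 (2 * ρ v) (e.eval s.var), h1.trans (Reaches.single ?_),
      hupd _ _ _ _ fun w => by rw [e1, hr]⟩
    norm_num at v1
    simp [step, hd, v1, size, add_assoc]
  | load v e s k hk =>
    obtain ⟨r1, h1, v1, e1, -⟩ := e.reaches (mem := s.mem) ρ hc.left hr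
    have hd := hc.right.head
    rw [Expr.length_code] at hd
    refine ⟨Function.update r1 (2 * ρ v) (s.mem k), h1.trans (Reaches.single ?_),
      hupd _ _ _ _ fun w => by rw [e1, hr]⟩
    norm_num at v1
    simp [step, hd, v1, hk, size, add_assoc]
  | store e e' s k hk =>
    obtain ⟨r1, h1, v1, e1, o1⟩ := e.reaches (mem := s.mem) ρ hc.left.left hr
    have hc' := hc.left.right
    rw [Expr.length_code] at hc'
    obtain ⟨r2, h2, v2, e2, o2⟩ := e'.reaches (mem := s.mem) ρ hc' (reg := r1) (fun v => (e1 _).trans (hr v))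
    have hd := hc.right.head
    rw [List.length_append, Expr.length_code, Expr.length_code, ← add_assoc] at hd
    have o := o2 0 one_pos
    rw [v1] at o
    norm_num at o v2
    refine ⟨r2, (h1.trans h2).trans (Reaches.single ?_), fun v => by rw [e2, e1, hr]⟩
    simp [step, hd, o, v2, hk, size, ← add_assoc]
  | @seq c c' s s' s'' t t' h h' ih ih' =>
    obtain ⟨r1, h1, e1⟩ := ih hc.left hr
    have hc' := hc.right
    rw [length_code] at hc'
    obtain ⟨r2, h2, e2⟩ := ih' hc' e1
    exact ⟨r2, by simpa [size, add_assoc] using h1.trans h2, e2⟩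
  | @ite_pos e e' c c' s s' t he h ih =>
    obtain ⟨r1, e1, h1, -⟩ := reaches_compare ρ hc.left.left.left s.mem hr
    have hc' := hc.right
    simp only [List.length_append, Expr.length_code, length_code, List.length_singleton] at hc'
    obtain ⟨r2, h2, e2⟩ := ih hc' e1
    exact ⟨r2, by simpa [size, add_assoc] using (h1 he).trans h2, e2⟩
  | @ite_neg e e' c c' s s' t he h ih =>
    obtain ⟨r1, e1, -, h1⟩ := reaches_compare ρ hc.left.left.left s.mem hr
    have hc' := hc.left.left.right
    simp only [List.length_append, Expr.length_code, List.length_singleton] at hc'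
    obtain ⟨r2, h2, e2⟩ := ih hc' e1
    have hd := hc.left.right.head
    simp only [List.length_append, Expr.length_code, length_code, List.length_singleton] at hd
    refine ⟨r2, ((h1 he).trans h2).trans (Reaches.single ?_), e2⟩
    rw [add_assoc l]
    simp [step, hd, size]
  | @loop_pos e e' c s s' s'' t t' he h h' ih ih' =>
    obtain ⟨r1, e1, h1, -⟩ := reaches_compare ρ hc.left.left.left s.mem hr
    have hc' := hc.left.right
    simp only [List.length_append, Expr.length_code, List.length_singleton] at hc'
    obtain ⟨r2, h2, e2⟩ := ih hc' e1
    have hd := hc.right.head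
    simp only [List.length_append, Expr.length_code, length_code, List.length_singleton] at hd
    obtain ⟨r3, h3, e3⟩ := ih' hc e2
    refine ⟨r3, (((h1 he).trans h2).trans (Reaches.single ?_)).trans h3, e3⟩
    rw [add_assoc l]
    simp [step, hd]
  | @loop_neg e e' c s he =>
    obtain ⟨r1, e1, -, h1⟩ := reaches_compare ρ hc.left.left.left s.mem hr
    have hd := hc.left.left.right.head
    simp only [List.length_append, Expr.length_code, List.length_singleton] at hd
    refine ⟨r1, (h1 he).trans (Reaches.single ?_), e1⟩
    simp [step, hd, size]

/-- Started in `s`, the program takes at most `t` steps and establishes `Q`. -/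
def Spec (c : Cmd V) (s : Store V) (t : ℕ) (Q : Store V → Prop) : Prop :=
  ∃ t' ≤ t, ∃ s', Exec c s t' s' ∧ Q s'

theorem Spec.mono {c : Cmd V} {s : Store V} {t t' : ℕ} {Q Q' : Store V → Prop}
    (h : Spec c s t Q) (ht : t ≤ t') (hQ : ∀ s, Q s → Q' s) : Spec c s t' Q' := by
  obtain ⟨u, hu, s', he, hq⟩ := h
  exact ⟨u, hu.trans ht, s', he, hQ _ hq⟩

theorem Spec.seq {c c' : Cmd V} {s : Store V} {t t' : ℕ} {Q R : Store V → Prop}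
    (h : Spec c s t Q) (h' : ∀ s, Q s → Spec c' s t' R) : Spec (seq c c') s (t + t') R := by
  obtain ⟨u, hu, s', he, hq⟩ := h
  obtain ⟨u', hu', s'', he', hr⟩ := h' s' hq
  exact ⟨u + u', by omega, s'', he.seq he', hr⟩

theorem Spec.ite {e e' : Expr V} {c c' : Cmd V} {s : Store V} {t : ℕ} {Q : Store V → Prop}
    (h : e.eval s.var ≤ e'.eval s.var → Spec c s t Q)
    (h' : ¬ e.eval s.var ≤ e'.eval s.var → Spec c' s t Q) :
    Spec (ite e e' c c') s (e.size + e'.size + 2 + t) Q := by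
  by_cases he : e.eval s.var ≤ e'.eval s.var
  · obtain ⟨u, hu, s', hx, hq⟩ := h he
    exact ⟨_, by omega, s', hx.ite_pos he, hq⟩
  · obtain ⟨u, hu, s', hx, hq⟩ := h' he
    exact ⟨_, by omega, s', hx.ite_neg he, hq⟩

/-- The invariant is indexed by the number of completed rounds, so the exact count N yields both
termination and the time bound. -/
theorem Spec.loop {e e' : Expr V} {c : Cmd V} {N t : ℕ} {I : ℕ → Store V → Prop}
    (hI : ∀ i < N, ∀ s, I i s → e.eval s.var ≤ e'.eval s.var ∧ Spec c s t (I (i + 1)))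
    (hN : ∀ s, I N s → ¬ e.eval s.var ≤ e'.eval s.var) {s : Store V} (h : I 0 s) :
    Spec (loop e e' c) s ((N + 1) * (e.size + e'.size + 2 + t)) (I N) := by
  -- Induction on the number j of rounds still to come.
  have key : ∀ j ≤ N, ∀ s, I (N - j) s →
      Spec (Cmd.loop e e' c) s ((j + 1) * (e.size + e'.size + 2 + t)) (I N) := by
    intro j
    induction j with
    | zero =>
      intro _ s h
      refine ⟨_, ?_, s, Exec.loop_neg (hN s h), h⟩
      omega
    | succ j ih =>
      intro hj s h
      obtain ⟨he, u, hu, s', hx, h'⟩ := hI _ (by omega) s h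
      rw [show N - (j + 1) + 1 = N - j by omega] at h'
      obtain ⟨u', hu', s'', hx', h''⟩ := ih (by omega) s' h'
      refine ⟨_, ?_, s'', hx.loop_pos he hx', h''⟩
      rw [add_mul (j + 1)]
      omega
  exact key N le_rfl s (by simpa using h)

/-- The program may assign to the variable. -/
def writes : Cmd V → V → Bool
  | skip, _ => false
  | assign w _, v => w = v
  | load w _, v => w = v
  | store _ _, _ => false
  | seq c c', v => c.writes v || c'.writes v
  | ite _ _ c c', v => c.writes v || c'.writes v
  | loop _ _ c, v => c.writes v

/-- The program may change the memory. -/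
def stores : Cmd V → Bool
  | store _ _ => true
  | seq c c' => c.stores || c'.stores
  | ite _ _ c c' => c.stores || c'.stores
  | loop _ _ c => c.stores
  | _ => false

theorem Exec.var_eq {c : Cmd V} {s s' : Store V} {t : ℕ} (h : Exec c s t s') {v : V}
    (hv : c.writes v = false) : s'.var v = s.var v := by
  induction h with
  | skip s => rfl
  | assign w e s => exact Function.update_of_ne (by simpa [writes, eq_comm] using hv) _ _
  | load w e s k hk => exact Function.update_of_ne (by simpa [writes, eq_comm] using hv) _ _
  | store e e' s k hk => rfl
  | seq h h' ih ih' =>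
    simp only [writes, Bool.or_eq_false_iff] at hv
    rw [ih' hv.2, ih hv.1]
  | ite_pos he h ih =>
    simp only [writes, Bool.or_eq_false_iff] at hv
    exact ih hv.1
  | ite_neg he h ih =>
    simp only [writes, Bool.or_eq_false_iff] at hv
    exact ih hv.2
  | loop_pos he h h' ih ih' => rw [ih' hv, ih hv]
  | loop_neg he => rfl

theorem Exec.mem_eq {c : Cmd V} {s s' : Store V} {t : ℕ} (h : Exec c s t s')
    (hc : c.stores = false) : s'.mem = s.mem := by
  induction h with
  | skip s => rfl
  | assign w e s => rfl
  | load w e s k hk => rfl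
  | store e e' s k hk => cases hc
  | seq h h' ih ih' =>
    simp only [stores, Bool.or_eq_false_iff] at hc
    rw [ih' hc.2, ih hc.1]
  | ite_pos he h ih =>
    simp only [stores, Bool.or_eq_false_iff] at hc
    exact ih hc.1
  | ite_neg he h ih =>
    simp only [stores, Bool.or_eq_false_iff] at hc
    exact ih hc.2
  | loop_pos he h h' ih ih' => rw [ih' hc, ih hc]
  | loop_neg he => rfl

/-- `writes` and `stores` are computable, so for concrete programs the preservation of a variable or
of the memory is checked by `rfl`. -/
theorem Spec.frame {c : Cmd V} {s : Store V} {t : ℕ} {Q : Store V → Prop} (h : Spec c s t Q) :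
    Spec c s t fun s' => Q s' ∧ (∀ v, c.writes v = false → s'.var v = s.var v) ∧
      (c.stores = false → s'.mem = s.mem) := by
  obtain ⟨u, hu, s', he, hq⟩ := h
  exact ⟨u, hu, s', he, hq, fun v => he.var_eq, he.mem_eq⟩

/-- A sequence of assignments. -/
def assigns : List (V × Expr V) → Cmd V
  | [] => skip
  | p :: l => seq (assign p.1 p.2) (assigns l)

/-- The values of the variables after a sequence of assignments. -/
noncomputable def runAssigns : List (V × Expr V) → (V → ℝ) → V → ℝ
  | [], x => x
  | p :: l, x => runAssigns l (Function.update x p.1 (p.2.eval x))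

theorem spec_assigns (l : List (V × Expr V)) (s : Store V) {Q : Store V → Prop}
    (h : Q ⟨runAssigns l s.var, s.mem⟩) : Spec (assigns l) s (assigns l).size Q := by
  induction l generalizing s with
  | nil => exact ⟨0, le_rfl, s, Exec.skip s, h⟩
  | cons p l ih => exact Spec.seq ⟨_, le_rfl, _, Exec.assign _ _ _, rfl⟩ fun s' hs' => ih s' (hs' ▸ h)

theorem spec_load {v : V} {e : Expr V} {s : Store V} {Q : Store V → Prop} (k : ℕ)
    (hk : e.eval s.var = k) (h : Q ⟨Function.update s.var v (s.mem k), s.mem⟩) :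
    Spec (load v e) s (e.size + 1) Q :=
  ⟨_, le_rfl, _, Exec.load v e s k hk, h⟩

theorem spec_store {e e' : Expr V} {s : Store V} {Q : Store V → Prop} (k : ℕ)
    (hk : e.eval s.var = k) (h : Q ⟨s.var, Function.update s.mem k (e'.eval s.var)⟩) :
    Spec (store e e') s (e.size + e'.size + 1) Q :=
  ⟨_, le_rfl, _, Exec.store e e' s k hk, h⟩

theorem spec_skip {s : Store V} {Q : Store V → Prop} (h : Q s) : Spec skip s 0 Q :=
  ⟨0, le_rfl, s, Exec.skip s, h⟩

/-- The machine program of a structured program. The second input register is copied to the place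
of the variable number one. -/
def program (ρ : V → ℕ) (c : Cmd V) : Program := .move 2 1 :: (c.code ρ 1 ++ [.halt])

/-- Register 1 holds an input but is also the bottom of the expression stack; the initial move
rescues it to register 2 and costs the extra step. -/
theorem Spec.haltsWithin {ρ : V → ℕ} (hρ : Function.Injective ρ) {v w : V} (hv : ρ v = 0)
    (hw : ρ w = 1) {c : Cmd V} {n t : ℕ} {α : ℝ} {data : List ℝ} {I : Set ℝ}
    (h : ∀ s : Store V, s.var v = n → s.var w = α → (s.mem = fun k => data.getD k 0) →
      Spec c s t fun s' => ∃ K : ℕ, s'.var v = K ∧ Set.InjOn s'.mem (Set.Iio K) ∧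
        s'.mem '' Set.Iio K = I) :
    ∃ c' : Config, HaltsWithin (program ρ c) (input n α data) (t + 1) c' ∧ Outputs c' I := by
  set reg := Function.update (input n α data).reg 2 α with hreg
  obtain ⟨u, hu, s', hx, K, hK, hinj, himg⟩ := h ⟨fun x => reg (2 * ρ x), (input n α data).mem⟩
    (by simp [hv, hreg, input]) (by simp [hw, hreg]) rfl
  have hP : CodeAt (program ρ c) 1 (c.code ρ 1 ++ [.halt]) := fun i _ => by
    rw [program, add_comm, List.getElem?_cons_succ]
  obtain ⟨r, h1, e1⟩ := hx.reaches hρ hP.left (reg := reg) fun _ => rfl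
  have hd := hP.right.head
  rw [length_code] at hd
  have h0 : Reaches (program ρ c) (input n α data) 1 ⟨1, reg, (input n α data).mem⟩ := by
    refine Reaches.single ?_
    simp [step, program, input, hreg]
  refine ⟨⟨1 + c.size, r, s'.mem⟩, ⟨1 + u, by omega, h0.trans h1, hd⟩, K, ?_, hinj, himg⟩
  have := e1 v
  rw [hv] at this
  simpa [hK] using this

end Cmd

end RAM

/-! ### Sweeps through randomization tests -/

namespace RandExp

open RAM RAM.Cmd

/-- The variables of the programs: the input `size` and `level`, four counts that are computed from
the observed data, and working variables. -/
inductive Var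
  | size | level | n₁ | n₂ | n₃ | n₄ | a | b | k | c₀ | c₁ | c₂ | c₃ | c₄ | cum | tot | steps | rem
  | cnt | pos | i | data₁ | data₂ | data₃ | out
  deriving DecidableEq

/-- The values of the first six variables. -/
structure Inputs (x : Var → ℝ) (n : ℕ) (α : ℝ) (n₁ n₂ n₃ n₄ : ℕ) : Prop where
  size_eq : x .size = n
  level_eq : x .level = α
  n₁_eq : x .n₁ = n₁
  n₂_eq : x .n₂ = n₂
  n₃_eq : x .n₃ = n₃
  n₄_eq : x .n₄ = n₄

/-- The state of a sweep: the coefficients of `(1 + z) ^ a * (1 + z ^ 2) ^ b` around degree `k`. -/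
structure SweepState (x : Var → ℝ) (a b k : ℕ) : Prop where
  a_eq : x .a = a
  b_eq : x .b = b
  k_eq : x .k = k
  c₀_eq : x .c₀ = genCoeff a b k
  c₁_eq : x .c₁ = genCoeff a b (k - 1)
  c₂_eq : x .c₂ = genCoeff a b (k - 2)
  cum_eq : x .cum = cumCoeff a b k
  tot_eq : x .tot = 2 ^ (a + b)

/-! The variables as expressions. -/

namespace Val

abbrev size : Expr Var := .var .size
abbrev level : Expr Var := .var .level
abbrev n₁ : Expr Var := .var .n₁
abbrev n₂ : Expr Var := .var .n₂
abbrev n₃ : Expr Var := .var .n₃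
abbrev n₄ : Expr Var := .var .n₄
abbrev a : Expr Var := .var .a
abbrev b : Expr Var := .var .b
abbrev k : Expr Var := .var .k
abbrev c₀ : Expr Var := .var .c₀
abbrev c₁ : Expr Var := .var .c₁
abbrev c₂ : Expr Var := .var .c₂
abbrev c₃ : Expr Var := .var .c₃
abbrev c₄ : Expr Var := .var .c₄
abbrev cum : Expr Var := .var .cum
abbrev tot : Expr Var := .var .tot
abbrev steps : Expr Var := .var .steps
abbrev rem : Expr Var := .var .rem
abbrev cnt : Expr Var := .var .cnt
abbrev pos : Expr Var := .var .pos
abbrev i : Expr Var := .var .i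
abbrev data₁ : Expr Var := .var .data₁
abbrev data₂ : Expr Var := .var .data₂
abbrev data₃ : Expr Var := .var .data₃
abbrev out : Expr Var := .var .out

end Val

section

open Val

/-- The computation of two coefficients of smaller degree. -/
def lowerCoeffs : List (Var × Expr Var) :=
  [(.c₃, (0 - (k * c₀ + (k - 1 - a) * c₁ + (k - 2 - 2 * b) * c₂)) / (k - 3 - a - 2 * b)),
    (.c₄, (0 - ((k - 1) * c₁ + (k - 2 - a) * c₂ + (k - 3 - 2 * b) * c₃)) / (k - 4 - a - 2 * b))]

/-- The assignments that perform a move. -/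
def Move.assigns : Move → List (Var × Expr Var)
  | .coeff => [(.c₃, (0 - ((k - a) * c₀ + (k - 1 - 2 * b) * c₁ + (k - 2 - a - 2 * b) * c₂)) / (k + 1)),
      (.c₂, c₁), (.c₁, c₀), (.c₀, c₃), (.cum, cum + c₀), (.k, k + 1)]
  | .single => lowerCoeffs ++
      [(.cum, 2 * cum - c₀), (.c₀, c₀ + c₁), (.c₁, c₁ + c₂), (.c₂, c₂ + c₃), (.a, a + 1),
        (.tot, 2 * tot)]
  | .double => lowerCoeffs ++
      [(.cum, 2 * cum - c₀ - c₁), (.c₀, c₀ + c₂), (.c₁, c₁ + c₃), (.c₂, c₂ + c₄), (.b, b + 1),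
        (.tot, 2 * tot)]
  | .trade => lowerCoeffs ++
      [(.cum, cum - (c₁ - c₂) / 2), (.c₀, ((a - k) * c₀ + (a + 2 * b + 2 - k) * c₂) / a),
        (.c₁, ((a + 1 - k) * c₁ + (a + 2 * b + 3 - k) * c₃) / a),
        (.c₂, ((a + 2 - k) * c₂ + (a + 2 * b + 4 - k) * c₄) / a), (.cum, cum - c₁ / 2),
        (.a, a - 1), (.b, b + 1)]

end

theorem runAssigns_append {V : Type} [DecidableEq V] (l l' : List (V × Expr V)) (x : V → ℝ) :
    runAssigns (l ++ l') x = runAssigns l' (runAssigns l x) := by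
  induction l generalizing x with
  | nil => rfl
  | cons p l ih => exact ih _

/-- One more factor brings coefficients of degree k - 3 and k - 4 into the window k, k - 1, k - 2.
They are recomputed from the window by the downward recurrence, whose divisors are nonzero by the
bound on k. -/
theorem SweepState.lower {x : Var → ℝ} {a b k : ℕ} (h : SweepState x a b k)
    (hk : k ≤ a + 2 * b + 2) :
    SweepState (runAssigns lowerCoeffs x) a b k ∧
      runAssigns lowerCoeffs x .c₃ = genCoeff a b (k - 3) ∧
      runAssigns lowerCoeffs x .c₄ = genCoeff a b (k - 4) := by
  have h3 := genCoeff_sub_three (a := a) (b := b) (k := k) (by omega)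
  have h4 := genCoeff_sub_three (a := a) (b := b) (k := k - 1) (by omega)
  rw [show (k : ℤ) - 1 - 3 = k - 4 by ring, show (k : ℤ) - 1 - 1 = k - 2 by ring,
    show (k : ℤ) - 1 - 2 = k - 3 by ring, h3] at h4
  refine ⟨?_, ?_, ?_⟩
  · constructor <;>
      simp [runAssigns, lowerCoeffs, h.a_eq, h.b_eq, h.k_eq, h.c₀_eq, h.c₁_eq, h.c₂_eq, h.cum_eq,
        h.tot_eq]
  · simp only [runAssigns, lowerCoeffs, Function.update_apply, h3]
    simp [h.a_eq, h.b_eq, h.k_eq, h.c₀_eq, h.c₁_eq, h.c₂_eq]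
  · simp only [runAssigns, lowerCoeffs, Function.update_apply, h4]
    simp [h.a_eq, h.b_eq, h.k_eq, h.c₀_eq, h.c₁_eq, h.c₂_eq]
    ring_nf

/-- The moves of a sweep that are covered by the recurrences. -/
def Move.Valid (m : Move) (a b k cnt : ℕ) : Prop :=
  match m with
  | .coeff => True
  | .trade => k ≤ a + 2 * b + 2 ∧ cnt ≤ a
  | _ => k ≤ a + 2 * b + 2

theorem SweepState.move {m : Move} {x : Var → ℝ} {a b k : ℕ} (h : SweepState x a b k)
    (hm : m.Valid a b k 1) : SweepState (runAssigns m.assigns x) (m.singles a 1) (m.doubles b 1)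
      (m.degree k 1) := by
  cases m with
  | coeff =>
    have h1 := genCoeff_succ a b k
    have h2 : cumCoeff a b (k + 1) = cumCoeff a b k + genCoeff a b (k + 1) := by
      rw [genCoeff]; ring_nf
    constructor <;> simp [Move.assigns, runAssigns, Move.singles,
      Move.doubles, Move.degree, h.a_eq, h.b_eq, h.k_eq, h.c₀_eq, h.c₁_eq, h.c₂_eq, h.cum_eq, h.tot_eq, h1, h2]
    congr 1
    ring
  | single =>
    obtain ⟨h', h3, h4⟩ := h.lower hm
    have e1 : (k : ℤ) - 1 - 1 = k - 2 := by ring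
    have e2 : (k : ℤ) - 2 - 1 = k - 3 := by ring
    have e3 : cumCoeff a b (k - 1) = cumCoeff a b k - genCoeff a b k := by rw [genCoeff]; ring
    rw [Move.assigns, runAssigns_append]
    constructor <;> simp [runAssigns, Move.singles,
      Move.doubles, Move.degree, h'.a_eq, h'.b_eq, h'.k_eq, h'.c₀_eq, h'.c₁_eq, h'.c₂_eq, h'.cum_eq, h'.tot_eq, h3,
      genCoeff_succ_left, cumCoeff_succ_left, e1, e2, e3]
    · ring
    · ring
  | double =>
    obtain ⟨h', h3, h4⟩ := h.lower hm
    have e1 : (k : ℤ) - 1 - 2 = k - 3 := by ring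
    have e2 : (k : ℤ) - 2 - 2 = k - 4 := by ring
    have e3 : cumCoeff a b (k - 2) = cumCoeff a b k - genCoeff a b k - genCoeff a b (k - 1) := by
      rw [genCoeff, genCoeff, show (k : ℤ) - 1 - 1 = k - 2 by ring]; ring
    rw [Move.assigns, runAssigns_append]
    constructor <;> simp [runAssigns, Move.singles,
      Move.doubles, Move.degree, h'.a_eq, h'.b_eq, h'.k_eq, h'.c₀_eq, h'.c₁_eq, h'.c₂_eq, h'.cum_eq, h'.tot_eq, h3, h4,
      genCoeff_succ_right, cumCoeff_succ_right, e1, e2, e3]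
    · ring
    · ring
  | trade =>
    obtain ⟨h', h3, h4⟩ := h.lower hm.1
    -- The variable a still holds the old count when the coefficients are updated. The partial sum
    -- is corrected in two halves, one with the old coefficients and one with the new c₁, since
    -- `cumCoeff_trade` involves both.
    obtain ⟨a, rfl⟩ := Nat.exists_eq_add_of_le' hm.2
    have e0 := genCoeff_trade a b k
    have e1 := genCoeff_trade a b (k - 1)
    have e2 := genCoeff_trade a b (k - 2)
    have e3 := cumCoeff_trade a b k
    rw [show (k : ℤ) - 1 - 2 = k - 3 by ring] at e1
    rw [show (k : ℤ) - 2 - 2 = k - 4 by ring] at e2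
    push_cast at e0 e1 e2
    rw [Move.assigns, runAssigns_append]
    constructor <;> simp [runAssigns, Move.singles,
      Move.doubles, Move.degree, h'.a_eq, h'.b_eq, h'.k_eq, h'.c₀_eq, h'.c₁_eq, h'.c₂_eq, h'.cum_eq, h'.tot_eq, h3, h4,
      e0, e1, e2, e3]
    · ring
    · ring
    · ring
    · ring
    · ring

open Classical in
/-- The cells from address `3 * n` on are the indicators of the members of a set. -/
def Flags (n : ℕ) (mem : ℕ → ℝ) (F : Set ℕ) : Prop :=
  ∀ q : ℕ, mem (3 * n + q) = if q ∈ F then 1 else 0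

theorem Flags.insert {n : ℕ} {mem : ℕ → ℝ} {F : Set ℕ} (h : Flags n mem F) (q : ℕ) :
    Flags n (Function.update mem (3 * n + q) 1) (F ∪ {q}) := by
  classical
  intro r
  rcases eq_or_ne r q with rfl | hr
  · simp
  · rw [Function.update_of_ne (by omega), h r]
    simp [hr]

section

open Val

/-- The current test of a sweep. If it accepts, the current position is flagged. -/
def testCmd : Cmd Var :=
  ite (level * tot) (2 * cum) (ite (level * tot) (2 * (tot - cum + c₀)) (store pos 1) skip) skip

end

theorem spec_testCmd {s : Store Var} {n a b k : ℕ} {α : ℝ} {F : Set ℕ} {p : ℤ}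
    (hs : SweepState s.var a b k) (hl : s.var .level = α) (hf : Flags n s.mem F)
    (hpos : s.var .pos = 3 * n + p) (hp : 0 ≤ p) :
    Spec testCmd s 30 fun s' => s'.var = s.var ∧
      Flags n s'.mem (F ∪ {q | (q : ℤ) = p ∧ TailTest α a b k}) := by
  lift p to ℕ using hp
  have hneg : ¬ TailTest α a b k →
      Flags n s.mem (F ∪ {q | (q : ℤ) = p ∧ TailTest α a b k}) := by
    intro h
    simpa [h] using hf
  have e1 : (Val.level * Val.tot).eval s.var = α * 2 ^ (a + b) := by simp [hl, hs.tot_eq]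
  have e2 : (2 * Val.cum).eval s.var = 2 * cumCoeff a b k := by simp [hs.cum_eq]
  have e3 : (2 * (Val.tot - Val.cum + Val.c₀)).eval s.var =
      2 * (2 ^ (a + b) - cumCoeff a b k + genCoeff a b k) := by
    simp [hs.cum_eq, hs.tot_eq, hs.c₀_eq]
  unfold testCmd
  -- The numerical budgets are bounds for the sizes of these expressions, which `decide` computes.
  refine (Spec.ite (t := 20) (fun h1 => (Spec.ite (t := 3) (fun h2 => ?_) fun h2 => ?_).mono
    (by decide) fun _ h => h) fun h1 => ?_).mono (by decide) fun _ h => h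
  · rw [e1, e2] at h1
    rw [e1, e3] at h2
    refine (spec_store (3 * n + p) (by simp [hpos]) ⟨rfl, ?_⟩).mono (by decide) fun _ h => h
    convert hf.insert p using 2
    · simp
    · ext q
      simp [TailTest, h1, h2]
  · rw [e1, e3] at h2
    exact (spec_skip ⟨rfl, hneg fun h => h2 h.2⟩).mono (by omega) fun _ h => h
  · rw [e1, e2] at h1
    exact (spec_skip ⟨rfl, hneg fun h => h1 h.1⟩).mono (by omega) fun _ h => h

theorem runAssigns_of_notMem {V : Type} [DecidableEq V] {l : List (V × Expr V)} {v : V}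
    (h : v ∉ l.map Prod.fst) (x : V → ℝ) : runAssigns l x v = x v := by
  induction l generalizing x with
  | nil => rfl
  | cons p l ih =>
    simp only [List.map_cons, List.mem_cons, not_or] at h
    rw [runAssigns, ih h.2, Function.update_of_ne h.1]

theorem sweepSet_succ (m : Move) (α : ℝ) (a b k : ℕ) (pos δ : ℤ) (i : ℕ) :
    sweepSet m α a b k pos δ (i + 1) = sweepSet m α a b k pos δ i ∪ {q | (q : ℤ) = pos + δ * i ∧
      TailTest α (m.singles a i) (m.doubles b i) (m.degree k i)} := by
  ext q
  simp only [sweepSet, Set.mem_union, Set.mem_ofPred_eq, Nat.lt_succ_iff_lt_or_eq, or_and_right,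
    exists_or, exists_eq_left]

theorem Move.Valid.after {m : Move} {a b k cnt i : ℕ} (h : m.Valid a b k cnt) (hi : i < cnt) :
    m.Valid (m.singles a i) (m.doubles b i) (m.degree k i) 1 := by
  cases m <;> simp only [Move.Valid, Move.singles, Move.doubles, Move.degree] at * <;> omega

theorem Move.singles_succ (m : Move) (a i : ℕ) : m.singles (m.singles a i) 1 = m.singles a (i + 1) := by
  cases m <;> simp only [Move.singles] <;> omega

theorem Move.doubles_succ (m : Move) (b i : ℕ) : m.doubles (m.doubles b i) 1 = m.doubles b (i + 1) := by
  cases m <;> simp only [Move.doubles] <;> omega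

theorem Move.degree_succ (m : Move) (k i : ℕ) : m.degree (m.degree k i) 1 = m.degree k (i + 1) := by
  cases m <;> simp only [Move.degree] <;> omega

theorem Move.sweep_zero (m : Move) (a b k : ℕ) :
    m.singles a 0 = a ∧ m.doubles b 0 = b ∧ m.degree k 0 = k := by
  cases m <;> simp [Move.singles, Move.doubles, Move.degree]

theorem SweepState.congr {x y : Var → ℝ} {a b k : ℕ} (h : SweepState x a b k)
    (hy : ∀ v, v ∈ [Var.a, .b, .k, .c₀, .c₁, .c₂, .cum, .tot] → y v = x v) :
    SweepState y a b k := by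
  constructor
  · rw [hy _ (by simp), h.a_eq]
  · rw [hy _ (by simp), h.b_eq]
  · rw [hy _ (by simp), h.k_eq]
  · rw [hy _ (by simp), h.c₀_eq]
  · rw [hy _ (by simp), h.c₁_eq]
  · rw [hy _ (by simp), h.c₂_eq]
  · rw [hy _ (by simp), h.cum_eq]
  · rw [hy _ (by simp), h.tot_eq]

theorem Move.assigns_of_notMem (m : Move) (x : Var → ℝ) {v : Var}
    (hv : v ∉ [Var.a, .b, .k, .c₀, .c₁, .c₂, .c₃, .c₄, .cum, .tot]) :
    runAssigns m.assigns x v = x v := by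
  refine runAssigns_of_notMem (fun h => hv ?_) x
  revert h
  cases m <;> cases v <;> decide

/-- Powers are not a machine operation; the total 2^(a+b) is prepared by doubling once and then
maintained by the moves. -/
theorem spec_powerLoop {s : Store Var} {N : ℕ} (h : s.var .steps = N) (ht : s.var .tot = 1) :
    Spec (loop 1 Val.steps (assigns [(.tot, 2 * Val.tot), (.steps, Val.steps - 1)])) s
      ((N + 1) * 12) fun s' => s'.var .tot = 2 ^ N := by
  have key := Spec.loop (V := Var) (e := 1) (e' := Val.steps)
    (c := assigns [(.tot, 2 * Val.tot), (.steps, Val.steps - 1)]) (N := N) (t := 8)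
    (I := fun i s => s.var .steps = (N : ℝ) - i ∧ s.var .tot = 2 ^ i)
    (fun i hi s hs => by
      have hi' : (i : ℝ) + 1 ≤ N := by exact_mod_cast hi
      refine ⟨by simp [hs.1]; linarith, spec_assigns _ _ ?_⟩
      simp [runAssigns, hs.1, hs.2, pow_succ']
      ring)
    (fun s hs => by simp [hs.1]) (s := s) (by simp [h, ht])
  exact key.mono le_rfl fun s h => h.2

/-- One step of the computation of the initial coefficients. -/
def coeffStep : Cmd Var := assigns (Move.assigns .coeff ++ [(.rem, Val.rem - 1)])

theorem spec_coeffLoop {s : Store Var} {a b k : ℕ} (hs : SweepState s.var a b 0)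
    (hk : s.var .rem = k) : Spec (loop 1 Val.rem coeffStep) s ((k + 1) * (4 + coeffStep.size))
      fun s' => SweepState s'.var a b k := by
  have key := Spec.loop (V := Var) (e := 1) (e' := Val.rem) (c := coeffStep) (N := k)
    (t := coeffStep.size)
    (I := fun i s => s.var .rem = (k : ℝ) - i ∧ SweepState s.var a b i)
    (fun i hi s hs => by
      have hi' : (i : ℝ) + 1 ≤ k := by exact_mod_cast hi
      refine ⟨by simp [hs.1]; linarith, spec_assigns _ _ ?_⟩
      rw [runAssigns_append]
      refine ⟨?_, ?_⟩
      · simp [runAssigns, Move.assigns_of_notMem, hs.1]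
        ring
      · refine (hs.2.move (m := .coeff) trivial).congr fun x hx => runAssigns_of_notMem ?_ _
        rintro h
        simp only [List.map_cons, List.map_nil, List.mem_singleton] at h
        subst h
        simp at hx)
    (fun s hs => by simp [hs.1]) (s := s) ⟨by simp [hk], hs⟩
  exact key.mono le_rfl fun s h => h.2

/-- One step of the main loop of a sweep. -/
def sweepStep (m : Move) (δ : ℤ) : Cmd Var :=
  seq testCmd (assigns (m.assigns ++ [(.pos, Val.pos + Expr.num δ), (.cnt, Val.cnt - 1)]))

/-- Round i tests the polynomial reached after i moves. Nonnegativity of the position is needed only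
at the tests, where it is used as an address. -/
theorem spec_sweepLoop {m : Move} {δ : ℤ} {s : Store Var} {n a b k cnt : ℕ} {α : ℝ} {F : Set ℕ}
    {p : ℤ} (hs : SweepState s.var a b k) (hl : s.var .level = α) (hf : Flags n s.mem F)
    (hcnt : s.var .cnt = cnt) (hpos : s.var .pos = 3 * n + p) (hm : m.Valid a b k cnt)
    (hp : ∀ i < cnt, 0 ≤ p + δ * i) :
    Spec (loop 1 Val.cnt (sweepStep m δ)) s ((cnt + 1) * (4 + (30 + (sweepStep m δ).size)))
      fun s' => Flags n s'.mem (F ∪ sweepSet m α a b k p δ cnt) := by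
  have key := Spec.loop (V := Var) (e := 1) (e' := Val.cnt) (c := sweepStep m δ) (N := cnt)
    (t := 30 + (sweepStep m δ).size)
    (I := fun i s => s.var .cnt = (cnt : ℝ) - i ∧ s.var .level = α ∧
      s.var .pos = 3 * n + ((p + δ * i : ℤ) : ℝ) ∧
      SweepState s.var (m.singles a i) (m.doubles b i) (m.degree k i) ∧
      Flags n s.mem (F ∪ sweepSet m α a b k p δ i))
    (fun i hi s ⟨h1, h2, h3, h4, h5⟩ => by
      have hi' : (i : ℝ) + 1 ≤ cnt := by exact_mod_cast hi
      refine ⟨by simp [h1]; linarith, ?_⟩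
      refine ((spec_testCmd h4 h2 h5 h3 (hp i hi)).seq fun s' h => spec_assigns _ _
        (Q := fun s => s.var .cnt = (cnt : ℝ) - (i + 1 : ℕ) ∧ s.var .level = α ∧
          s.var .pos = 3 * n + ((p + δ * (i + 1 : ℕ) : ℤ) : ℝ) ∧
          SweepState s.var (m.singles a (i + 1)) (m.doubles b (i + 1)) (m.degree k (i + 1)) ∧
          Flags n s.mem (F ∪ sweepSet m α a b k p δ (i + 1))) ?_).mono
        (by simp only [sweepStep, Cmd.size]; omega) fun _ h => h
      rw [runAssigns_append, h.1, sweepSet_succ, ← Set.union_assoc]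
      refine ⟨?_, ?_, ?_, ?_, h.2⟩
      · simp [runAssigns, Move.assigns_of_notMem, h1]
        ring
      · simp [runAssigns, Move.assigns_of_notMem, h2]
      · simp [runAssigns, Move.assigns_of_notMem, h3]
        ring
      · have h6 := h4.move (hm.after hi)
        rw [Move.singles_succ, Move.doubles_succ, Move.degree_succ] at h6
        refine h6.congr fun x hx => runAssigns_of_notMem ?_ _
        intro h
        simp only [List.map_cons, List.map_nil, List.mem_cons, List.not_mem_nil, or_false] at h
        rcases h with rfl | rfl <;> simp at hx)
    (fun s hs => by simp [hs.1]) (s := s) (by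
      obtain ⟨e1, e2, e3⟩ := m.sweep_zero a b k
      refine ⟨by simp [hcnt], hl, by simp [hpos], by rwa [e1, e2, e3], ?_⟩
      convert hf using 1
      simp [sweepSet])
  exact key.mono le_rfl fun s h => h.2.2.2.2

section

open Val

/-- The assignments that prepare a sweep. -/
def sweepInit : List (Var × Expr Var) :=
  [(.steps, a + b), (.k, 0), (.c₀, 1), (.c₁, 0), (.c₂, 0), (.cum, 1), (.tot, 1)]

/-- A sweep, once the variables `a`, `b`, `rem` (the initial degree), `pos` and `cnt` are set. -/
def sweepCmd (m : Move) (δ : ℤ) : Cmd Var :=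
  ite 1 cnt
    (seq (assigns sweepInit)
    (seq (loop 1 steps (assigns [(.tot, 2 * tot), (.steps, steps - 1)]))
    (seq (loop 1 rem coeffStep)
    (loop 1 cnt (sweepStep m δ)))))
    skip

end

/-- A bound for the time per step of a sweep. -/
def sweepCost (m : Move) (δ : ℤ) : ℕ :=
  4 + ((assigns sweepInit).size + (12 + ((4 + coeffStep.size) + (34 + (sweepStep m δ).size))))

/-- The parameters have to be meaningful only for a nonempty sweep, since the initial guard skips an
empty one. -/
theorem spec_sweepCmd {m : Move} {δ : ℤ} {s : Store Var} {n a b k cnt N : ℕ} {α : ℝ} {F : Set ℕ}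
    {p : ℤ} (hl : s.var .level = α) (hcnt : s.var .cnt = cnt) (hf : Flags n s.mem F)
    (h : 0 < cnt → s.var .a = a ∧ s.var .b = b ∧ s.var .rem = k ∧ s.var .pos = 3 * n + p ∧
      m.Valid a b k cnt ∧ ∀ i < cnt, 0 ≤ p + δ * i) (hN : a + b + k + cnt ≤ N) :
    Spec (sweepCmd m δ) s ((N + 1) * sweepCost m δ) fun s' =>
      Flags n s'.mem (F ∪ sweepSet m α a b k p δ cnt) := by
  unfold sweepCmd
  refine (Spec.ite (t := (assigns sweepInit).size + ((a + b + 1) * 12 +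
    ((k + 1) * (4 + coeffStep.size) + (cnt + 1) * (4 + (30 + (sweepStep m δ).size)))))
    (fun h1 => ?_) fun h1 => ?_).mono ?_ fun _ h => h
  · have hc : 0 < cnt := by
      have : (1 : ℝ) ≤ cnt := by simpa [hcnt] using h1
      exact_mod_cast this
    obtain ⟨ha, hb, hk, hpos, hm, hp⟩ := h hc
    refine Spec.seq (spec_assigns _ _ (Q := fun s' => s'.var .steps = (a + b : ℕ) ∧
      s'.var .tot = 1 ∧ s'.var .rem = k ∧ s'.var .level = α ∧ s'.var .cnt = cnt ∧
      s'.var .pos = 3 * n + p ∧ s'.mem = s.mem ∧ s'.var .a = a ∧ s'.var .b = b ∧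
      s'.var .k = 0 ∧ s'.var .c₀ = 1 ∧ s'.var .c₁ = 0 ∧ s'.var .c₂ = 0 ∧ s'.var .cum = 1) ?_) ?_
    · simp [sweepInit, runAssigns, ha, hb, hk, hl, hcnt, hpos]
    rintro s1 ⟨i1, i2, i3, i4, i5, i6, i7, i8, i9, i10, i11, i12, i13, i14⟩
    refine Spec.seq (spec_powerLoop i1 i2).frame ?_
    rintro s2 ⟨j1, j2, j3⟩
    have hs2 : SweepState s2.var a b 0 := by
      constructor
      · rw [j2 _ rfl, i8]
      · rw [j2 _ rfl, i9]
      · rw [j2 _ rfl, i10, Nat.cast_zero]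
      · rw [j2 _ rfl, i11, Nat.cast_zero, genCoeff_zero]
      · rw [j2 _ rfl, i12, genCoeff_of_neg _ _ (by norm_num)]
      · rw [j2 _ rfl, i13, genCoeff_of_neg _ _ (by norm_num)]
      · rw [j2 _ rfl, i14, Nat.cast_zero, cumCoeff_zero]
      · exact j1
    refine Spec.seq (spec_coeffLoop hs2 ((j2 _ rfl).trans i3)).frame ?_
    rintro s3 ⟨k1, k2, k3⟩
    refine spec_sweepLoop k1 ?_ ?_ ?_ ?_ hm hp
    · rw [k2 _ rfl, j2 _ rfl, i4]
    · rwa [k3 rfl, j3 rfl, i7]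
    · rw [k2 _ rfl, j2 _ rfl, i5]
    · rw [k2 _ rfl, j2 _ rfl, i6]
  · have hc : cnt = 0 := by
      by_contra hne
      refine h1 ?_
      simpa [hcnt] using Nat.one_le_iff_ne_zero.2 hne
    subst hc
    refine (spec_skip ?_).mono (Nat.zero_le _) fun _ h => h
    convert hf using 1
    simp [sweepSet]
  · have e1 : (a + b + 1) * 12 ≤ (N + 1) * 12 := by gcongr; omega
    have e2 : (k + 1) * (4 + coeffStep.size) ≤ (N + 1) * (4 + coeffStep.size) := by gcongr; omega
    have e3 : (cnt + 1) * (4 + (30 + (sweepStep m δ).size)) ≤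
      (N + 1) * (34 + (sweepStep m δ).size) := by
      rw [← add_assoc 4 30]
      gcongr
      omega
    have e4 : (assigns sweepInit).size ≤ (N + 1) * (assigns sweepInit).size :=
      Nat.le_mul_of_pos_left _ (Nat.succ_pos N)
    have e5 : Expr.size (1 : Expr Var) + Val.cnt.size + 2 = 4 := rfl
    rw [e5, sweepCost]
    linarith [Nat.zero_le N]

end RandExp

namespace RandExp

open RAM RAM.Cmd

theorem Inputs.congr {x y : Var → ℝ} {n n₁ n₂ n₃ n₄ : ℕ} {α : ℝ} (h : Inputs x n α n₁ n₂ n₃ n₄)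
    (hy : ∀ v, v ∈ [Var.size, .level, .n₁, .n₂, .n₃, .n₄] → y v = x v) :
    Inputs y n α n₁ n₂ n₃ n₄ := by
  constructor
  · rw [hy _ (by simp), h.size_eq]
  · rw [hy _ (by simp), h.level_eq]
  · rw [hy _ (by simp), h.n₁_eq]
  · rw [hy _ (by simp), h.n₂_eq]
  · rw [hy _ (by simp), h.n₃_eq]
  · rw [hy _ (by simp), h.n₄_eq]

theorem Inputs.update {x : Var → ℝ} {n n₁ n₂ n₃ n₄ : ℕ} {α : ℝ} (h : Inputs x n α n₁ n₂ n₃ n₄)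
    {v : Var} (hv : v ∉ [Var.size, .level, .n₁, .n₂, .n₃, .n₄]) (r : ℝ) :
    Inputs (Function.update x v r) n α n₁ n₂ n₃ n₄ :=
  h.congr fun w hw => Function.update_of_ne (fun (e : w = v) => hv (e ▸ hw)) _ _

/-- The parameters of a sweep, as expressions in the inputs. -/
structure SweepParams where
  a : Expr Var
  b : Expr Var
  k : Expr Var
  pos : Expr Var
  cnt : Expr Var

/-- A sweep with given parameters. -/
def SweepParams.cmd (e : SweepParams) (m : Move) (δ : ℤ) : Cmd Var :=
  seq (assigns [(.a, e.a), (.b, e.b), (.rem, e.k), (.pos, 3 * Val.size + e.pos), (.cnt, e.cnt)])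
    (sweepCmd m δ)

/-- A bound for the time per unit of a sweep with given parameters. -/
def SweepParams.cost (e : SweepParams) (m : Move) (δ : ℤ) : ℕ :=
  (assigns [(.a, e.a), (.b, e.b), (.rem, e.k), (.pos, 3 * Val.size + e.pos), (.cnt, e.cnt)]).size +
    10 * sweepCost m δ

theorem SweepParams.spec {e : SweepParams} {m : Move} {δ : ℤ} {s : Store Var}
    {n n₁ n₂ n₃ n₄ : ℕ} {α : ℝ} (hs : Inputs s.var n α n₁ n₂ n₃ n₄) {F : Set ℕ}
    (hf : Flags n s.mem F) {a b k cnt : ℕ} {p : ℤ}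
    (he : ∀ y, Inputs y n α n₁ n₂ n₃ n₄ → e.cnt.eval y = cnt ∧ (0 < cnt → e.a.eval y = a ∧
      e.b.eval y = b ∧ e.k.eval y = k ∧ e.pos.eval y = p))
    (hm : 0 < cnt → m.Valid a b k cnt ∧ ∀ i < cnt, 0 ≤ p + δ * i)
    (hN : a + b + k + cnt ≤ 10 * n + 9) :
    Spec (e.cmd m δ) s ((n + 1) * e.cost m δ) fun s' =>
      Inputs s'.var n α n₁ n₂ n₃ n₄ ∧ Flags n s'.mem (F ∪ sweepSet m α a b k p δ cnt) := by
  have hfr : ∀ v ∈ [Var.size, .level, .n₁, .n₂, .n₃, .n₄], (e.cmd m δ).writes v = false := by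
    intro v hv
    cases m <;> simp only [List.mem_cons, List.not_mem_nil, or_false] at hv <;>
      rcases hv with rfl | rfl | rfl | rfl | rfl | rfl <;> rfl
  have key : Spec (e.cmd m δ) s ((n + 1) * e.cost m δ) fun s' =>
      Flags n s'.mem (F ∪ sweepSet m α a b k p δ cnt) := by
    have h1 := hs.update (v := .a) (by simp) (e.a.eval s.var)
    have h2 := h1.update (v := .b) (by simp) (e.b.eval (Function.update s.var .a (e.a.eval s.var)))
    have h3 : Inputs (runAssigns [(.a, e.a), (.b, e.b), (.rem, e.k)] s.var) n α n₁ n₂ n₃ n₄ :=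
      h2.update (by simp) _
    have h4 : Inputs (runAssigns [(.a, e.a), (.b, e.b), (.rem, e.k),
      (.pos, 3 * Val.size + e.pos)] s.var) n α n₁ n₂ n₃ n₄ := h3.update (by simp) _
    have h5 : Inputs (runAssigns [(.a, e.a), (.b, e.b), (.rem, e.k),
      (.pos, 3 * Val.size + e.pos), (.cnt, e.cnt)] s.var) n α n₁ n₂ n₃ n₄ := h4.update (by simp) _
    refine (Spec.seq (spec_assigns _ _ (Q := fun s' => s'.var .level = α ∧ s'.var .cnt = cnt ∧
      Flags n s'.mem F ∧ (0 < cnt → s'.var .a = a ∧ s'.var .b = b ∧ s'.var .rem = k ∧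
        s'.var .pos = 3 * n + p)) ⟨h5.level_eq, ?_, hf, fun hc => ⟨?_, ?_, ?_, ?_⟩⟩)
      fun s' h => spec_sweepCmd h.1 h.2.1 h.2.2.1
        (fun hc => ⟨(h.2.2.2 hc).1, (h.2.2.2 hc).2.1, (h.2.2.2 hc).2.2.1, (h.2.2.2 hc).2.2.2,
          (hm hc).1, (hm hc).2⟩) hN).mono ?_ fun _ h => h
    · simp only [runAssigns, Function.update_self]
      exact (he _ h4).1
    · simpa [runAssigns] using ((he _ hs).2 hc).1
    · simpa [runAssigns] using ((he _ h1).2 hc).2.1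
    · simpa [runAssigns] using ((he _ h2).2 hc).2.2.1
    · have e1 := ((he _ h3).2 hc).2.2.2
      simp only [runAssigns] at e1
      simp [runAssigns, e1, hs.size_eq]
    · rw [SweepParams.cost, mul_add]
      refine add_le_add (Nat.le_mul_of_pos_left _ (Nat.succ_pos n)) ?_
      -- The bound 10 * n + 9 on the parameters was chosen so that adding one gives 10 * (n + 1).
      rw [← mul_assoc]
      refine Nat.mul_le_mul_right _ ?_
      omega
  exact key.frame.mono le_rfl fun s' h => ⟨hs.congr fun v hv => h.2.1 v (hfr v hv), h.1⟩

/-! ### The output -/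

/-- One step of the output: the candidate with index `i` is listed if it is flagged. -/
def outputStep (off : Expr Var) : Cmd Var :=
  seq (load .data₁ (3 * Val.size + Val.i))
    (seq (ite 1 Val.data₁
      (seq (store Val.out ((off + Val.i) / Val.size)) (assigns [(.out, Val.out + 1)])) skip)
      (assigns [(.i, Val.i + 1)]))

/-- The list of the flagged candidates `(off + i) / n`. -/
def outputCmd (off : Expr Var) : Cmd Var :=
  seq (assigns [(.i, 0), (.out, 0)])
    (seq (loop Val.i Val.size (outputStep off)) (assigns [(.size, Val.out)]))

/-- The first `K` cells list the flagged candidates with index less than `q`. -/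
structure Listed (mem : ℕ → ℝ) (n : ℕ) (r : ℝ) (F : Set ℕ) (q K : ℕ) : Prop where
  le : K ≤ q
  injOn : Set.InjOn mem (Set.Iio K)
  image : mem '' Set.Iio K = {τ | ∃ j < q, j ∈ F ∧ τ = (r + j) / n}

theorem Listed.skip {mem : ℕ → ℝ} {n : ℕ} {r : ℝ} {F : Set ℕ} {q K : ℕ}
    (h : Listed mem n r F q K) (hq : q ∉ F) : Listed mem n r F (q + 1) K := by
  refine ⟨h.le.trans (Nat.le_succ q), h.injOn, h.image.trans ?_⟩
  ext τ
  constructor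
  · rintro ⟨j, hj, hF, e⟩
    exact ⟨j, by omega, hF, e⟩
  · rintro ⟨j, hj, hF, e⟩
    have : j ≠ q := fun e => hq (e ▸ hF)
    exact ⟨j, by omega, hF, e⟩

/-- The new entry differs from the earlier ones because j ↦ (r + j) / n is injective. -/
theorem Listed.append {mem : ℕ → ℝ} {n : ℕ} (hn : 1 ≤ n) {r : ℝ} {F : Set ℕ} {q K : ℕ}
    (h : Listed mem n r F q K) (hq : q ∈ F) :
    Listed (Function.update mem K ((r + q) / n)) n r F (q + 1) (K + 1) := by
  have hn' : (n : ℝ) ≠ 0 := by positivity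
  have hup : ∀ j ∈ Set.Iio K, Function.update mem K ((r + q) / n) j = mem j := fun j hj =>
    Function.update_of_ne (ne_of_lt hj) _ _
  have hIio : Set.Iio (K + 1) = insert K (Set.Iio K) := by
    ext j
    simp only [Set.mem_Iio, Set.mem_insert_iff]
    omega
  have himg : Function.update mem K ((r + q) / n) '' Set.Iio K =
      {τ | ∃ j < q, j ∈ F ∧ τ = (r + j) / n} := by
    rw [Set.image_congr hup, h.image]
  refine ⟨Nat.succ_le_succ h.le, ?_, ?_⟩
  · rw [hIio, Set.injOn_insert (by simp)]
    refine ⟨h.injOn.congr fun j hj => (hup j hj).symm, ?_⟩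
    rw [himg, Function.update_self]
    rintro ⟨j, hj, -, e⟩
    rw [div_left_inj' hn', add_right_inj, Nat.cast_inj] at e
    omega
  · rw [hIio, Set.image_insert_eq, himg, Function.update_self]
    ext τ
    constructor
    · rintro (rfl | ⟨j, hj, hF, e⟩)
      · exact ⟨q, Nat.lt_succ_self q, hq, rfl⟩
      · exact ⟨j, by omega, hF, e⟩
    · rintro ⟨j, hj, hF, e⟩
      rcases Nat.lt_succ_iff_lt_or_eq.1 hj with hj | rfl
      · exact Or.inr ⟨j, hj, hF, e⟩
      · exact Or.inl e

theorem spec_outputStep {off : Expr Var} {s : Store Var} {n n₁ n₂ n₃ n₄ q K : ℕ} {α r : ℝ}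
    {F : Set ℕ} (hn : 1 ≤ n) (hs : Inputs s.var n α n₁ n₂ n₃ n₄)
    (hoff : ∀ y, Inputs y n α n₁ n₂ n₃ n₄ → off.eval y = r) (hq : q ≤ n)
    (hi : s.var .i = q) (hout : s.var .out = K) (hf : Flags n s.mem F)
    (hl : Listed s.mem n r F q K) :
    Spec (outputStep off) s (outputStep off).size fun s' => Inputs s'.var n α n₁ n₂ n₃ n₄ ∧
      s'.var .i = (q + 1 : ℕ) ∧ Flags n s'.mem F ∧
      ∃ K' : ℕ, s'.var .out = K' ∧ Listed s'.mem n r F (q + 1) K' := by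
  have hKq := hl.le
  have hflag := hf q
  have h1 : Spec (load .data₁ (3 * Val.size + Val.i)) s
      ((3 * Val.size + Val.i : Expr Var).size + 1) fun s' => Inputs s'.var n α n₁ n₂ n₃ n₄ ∧
        s'.var .i = q ∧ s'.var .out = K ∧ s'.var .data₁ = s.mem (3 * n + q) ∧ s'.mem = s.mem := by
    refine spec_load (3 * n + q) (by simp [hs.size_eq, hi]) ⟨hs.update (by simp) _, ?_, ?_, ?_, rfl⟩
    · simp [hi]
    · simp [hout]
    · simp
  have h2 : ∀ s' : Store Var, (Inputs s'.var n α n₁ n₂ n₃ n₄ ∧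
        s'.var .i = q ∧ s'.var .out = K ∧ s'.var .data₁ = s.mem (3 * n + q) ∧ s'.mem = s.mem) →
      Spec (ite 1 Val.data₁
        (seq (store Val.out ((off + Val.i) / Val.size)) (assigns [(.out, Val.out + 1)])) skip) s'
      ((1 : Expr Var).size + Val.data₁.size + 2 +
        ((Val.out.size + ((off + Val.i) / Val.size).size + 1) +
          (assigns [(Var.out, Val.out + 1)]).size))
      fun s' => Inputs s'.var n α n₁ n₂ n₃ n₄ ∧ s'.var .i = q ∧ Flags n s'.mem F ∧
        ∃ K' : ℕ, s'.var .out = K' ∧ Listed s'.mem n r F (q + 1) K' := by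
    rintro s' ⟨i1, i2, i3, i4, i5⟩
    refine Spec.ite (fun hle => ?_) fun hle => ?_
    · have hqF : q ∈ F := by
        by_contra hqF
        rw [if_neg hqF] at hflag
        norm_num [i4, hflag] at hle
      refine Spec.seq (spec_store K (by simp [i3]) (Q := fun s'' => s''.var = s'.var ∧
        s''.mem = Function.update s.mem K ((r + q) / n)) ⟨rfl, ?_⟩) ?_
      · simp [i5, hoff _ i1, i2, i1.size_eq]
      · rintro s'' ⟨j1, j2⟩
        refine spec_assigns _ _ ⟨?_, ?_, ?_, K + 1, ?_, ?_⟩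
        · rw [j1]
          exact i1.update (by simp) _
        · simp [runAssigns, j1, i2]
        · intro j
          simp only [j2]
          -- The output cell satisfies K ≤ q ≤ n < 3n, so writing it destroys no flag, although the
          -- input data may be overwritten.
          rw [Function.update_of_ne (by omega), hf j]
        · simp [runAssigns, j1, i3]
        · simp only [j2]
          exact hl.append hn hqF
    · have hqF : q ∉ F := by
        intro hqF
        rw [if_pos hqF] at hflag
        norm_num [i4, hflag] at hle
      refine (spec_skip ?_).mono (Nat.zero_le _) fun _ h => h
      rw [i5]
      exact ⟨i1, i2, hf, K, i3, hl.skip hqF⟩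
  refine (h1.seq fun s' hs' => (h2 s' hs').seq fun s'' h => spec_assigns _ _ (Q := fun s' =>
    Inputs s'.var n α n₁ n₂ n₃ n₄ ∧ s'.var .i = (q + 1 : ℕ) ∧ Flags n s'.mem F ∧
      ∃ K' : ℕ, s'.var .out = K' ∧ Listed s'.mem n r F (q + 1) K') ?_).mono ?_ fun _ h => h
  · obtain ⟨i1, i2, i3, K', i4, i5⟩ := h
    refine ⟨i1.update (by simp) _, ?_, i3, K', ?_, i5⟩
    · simp [runAssigns, i2]
    · simp [runAssigns, i4]
  · simp only [outputStep, Cmd.size]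
    omega

/-- A bound for the time per unit of the output. -/
def outputCost (off : Expr Var) : ℕ :=
  (assigns [(Var.i, (0 : Expr Var)), (.out, 0)]).size + (2 * (4 + (outputStep off).size) +
    (assigns [(Var.size, Val.out)]).size)

theorem spec_outputCmd {off : Expr Var} {s : Store Var} {n n₁ n₂ n₃ n₄ : ℕ} {α r : ℝ}
    {F : Set ℕ} (hn : 1 ≤ n) (hs : Inputs s.var n α n₁ n₂ n₃ n₄)
    (hoff : ∀ y, Inputs y n α n₁ n₂ n₃ n₄ → off.eval y = r) (hf : Flags n s.mem F) :
    Spec (outputCmd off) s ((n + 1) * outputCost off) fun s' => ∃ K : ℕ, s'.var .size = K ∧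
      Set.InjOn s'.mem (Set.Iio K) ∧
      s'.mem '' Set.Iio K = {τ | ∃ q ≤ n, q ∈ F ∧ τ = (r + q) / n} := by
  -- The loop makes n + 1 rounds, one for each candidate index from 0 to n.
  have hloop := fun s' => Spec.loop (V := Var) (e := Val.i) (e' := Val.size) (c := outputStep off)
    (N := n + 1) (t := (outputStep off).size) (I := fun q s' => Inputs s'.var n α n₁ n₂ n₃ n₄ ∧
      s'.var .i = q ∧ Flags n s'.mem F ∧ ∃ K' : ℕ, s'.var .out = K' ∧ Listed s'.mem n r F q K')
    (fun q hq s' ⟨i1, i2, i3, K, i4, i5⟩ => ⟨by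
      have : (q : ℝ) ≤ n := by exact_mod_cast Nat.lt_succ_iff.1 hq
      simpa [i1.size_eq, i2] using this,
      spec_outputStep hn i1 hoff (Nat.lt_succ_iff.1 hq) i2 i4 i3 i5⟩)
    (fun s' ⟨i1, i2, _⟩ => by simp [i1.size_eq, i2]) (s := s')
  refine (Spec.seq (spec_assigns _ _ (Q := fun s' => Inputs s'.var n α n₁ n₂ n₃ n₄ ∧
      s'.var .i = (0 : ℕ) ∧ Flags n s'.mem F ∧ ∃ K' : ℕ, s'.var .out = K' ∧
      Listed s'.mem n r F 0 K') ⟨?_, ?_, hf, 0, ?_, ?_⟩) fun s1 h1 => Spec.seq (hloop s1 h1)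
      fun s2 h2 => spec_assigns _ _ ?_).mono ?_ fun _ h => h
  · exact (hs.update (v := .i) (by simp) 0).congr fun v hv => by
      have h1 : v ≠ .out := by rintro rfl; simp at hv
      have h2 : v ≠ .i := by rintro rfl; simp at hv
      simp [runAssigns, h1, h2]
  · simp [runAssigns]
  · simp [runAssigns]
  · exact ⟨le_rfl, by simp, by simp⟩
  · obtain ⟨i1, i2, i3, K, i4, i5⟩ := h2
    refine ⟨K, by simp [runAssigns, i4], i5.injOn, i5.image.trans ?_⟩
    simp
  · have e : Val.i.size + Val.size.size + 2 = 4 := rfl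
    rw [e, outputCost]
    nlinarith [Nat.zero_le n, Nat.zero_le ((assigns [(Var.i, (0 : Expr Var)), (.out, 0)]).size * n),
      Nat.zero_le ((assigns [(Var.size, Val.out)]).size * n), Nat.zero_le ((outputStep off).size * n)]

end RandExp

namespace RAM.Cmd

theorem Spec.seq_mul {V : Type} [DecidableEq V] {c c' : Cmd V} {s : Store V} {n t t' : ℕ}
    {Q R : Store V → Prop} (h : Spec c s (n * t) Q) (h' : ∀ s, Q s → Spec c' s (n * t') R) :
    Spec (c.seq c') s (n * (t + t')) R := by
  rw [mul_add]
  exact h.seq h'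

end RAM.Cmd

namespace RandExp

open RAM RAM.Cmd Finset

/-! ### The summary of the data by counts -/

/-- One step of the summation, after the data of unit `i` have been loaded. -/
def countIncs (e₁ e₂ e₃ e₄ : Expr Var) : List (Var × Expr Var) :=
  [(.n₁, Val.n₁ + e₁), (.n₂, Val.n₂ + e₂), (.n₃, Val.n₃ + e₃), (.n₄, Val.n₄ + e₄),
    (.i, Val.i + 1)]

/-- The summation of four functions of the data of a unit. -/
def countCmd (fetch : Cmd Var) (e₁ e₂ e₃ e₄ : Expr Var) : Cmd Var :=
  seq (assigns [(.n₁, 0), (.n₂, 0), (.n₃, 0), (.n₄, 0), (.i, 0)])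
    (loop (Val.i + 1) Val.size (seq fetch (assigns (countIncs e₁ e₂ e₃ e₄))))

/-- A bound for the time per unit of the summation. -/
def countCost (fetch : Cmd Var) (e₁ e₂ e₃ e₄ : Expr Var) : ℕ :=
  (assigns [(Var.n₁, (0 : Expr Var)), (.n₂, 0), (.n₃, 0), (.n₄, 0), (.i, 0)]).size +
    (6 + (fetch.size + (assigns (countIncs e₁ e₂ e₃ e₄)).size))

theorem sum_range_succ_dite {n i : ℕ} (hi : i < n) (g : Fin n → ℕ) :
    ∑ j ∈ range (i + 1), (if h : j < n then g ⟨j, h⟩ else 0) =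
      ∑ j ∈ range i, (if h : j < n then g ⟨j, h⟩ else 0) + g ⟨i, hi⟩ := by
  rw [sum_range_succ, dif_pos hi]

theorem sum_range_dite {n : ℕ} (g : Fin n → ℕ) :
    ∑ j ∈ range n, (if h : j < n then g ⟨j, h⟩ else 0) = ∑ j, g j := by
  rw [sum_range]
  simp

/-- The invariant consists of the partial sums. The four increments are evaluated one after the
other in stores that already changed, so `hf` asks for their values in every store with the same
loaded data. -/
theorem spec_countCmd {fetch : Cmd Var} {e₁ e₂ e₃ e₄ : Expr Var} {s : Store Var} {n : ℕ} {α : ℝ}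
    (hw : ∀ v ∈ [Var.size, .level, .n₁, .n₂, .n₃, .n₄, .i], fetch.writes v = false)
    (hm : fetch.stores = false) {g₁ g₂ g₃ g₄ : Fin n → ℕ} (hsize : s.var .size = n)
    (hlevel : s.var .level = α)
    (hf : ∀ (i : Fin n) (s' : Store Var), s'.mem = s.mem → s'.var .size = n → s'.var .i = (i : ℕ) →
      Spec fetch s' fetch.size fun s'' => ∀ y : Var → ℝ, y .data₁ = s''.var .data₁ →
        y .data₂ = s''.var .data₂ → y .data₃ = s''.var .data₃ →
        e₁.eval y = g₁ i ∧ e₂.eval y = g₂ i ∧ e₃.eval y = g₃ i ∧ e₄.eval y = g₄ i) :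
    Spec (countCmd fetch e₁ e₂ e₃ e₄) s ((n + 1) * countCost fetch e₁ e₂ e₃ e₄) fun s' =>
      Inputs s'.var n α (∑ i, g₁ i) (∑ i, g₂ i) (∑ i, g₃ i) (∑ i, g₄ i) ∧ s'.mem = s.mem := by
  set S : (Fin n → ℕ) → ℕ → ℕ := fun g i =>
    ∑ j ∈ range i, (if h : j < n then g ⟨j, h⟩ else 0) with hS
  have hloop := fun s' => Spec.loop (V := Var) (e := Val.i + 1) (e' := Val.size)
    (c := seq fetch (assigns (countIncs e₁ e₂ e₃ e₄))) (N := n)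
    (t := fetch.size + (assigns (countIncs e₁ e₂ e₃ e₄)).size)
    (I := fun i s' => Inputs s'.var n α (S g₁ i) (S g₂ i) (S g₃ i) (S g₄ i) ∧ s'.var .i = i ∧
      s'.mem = s.mem)
    (fun i hi s' ⟨h1, h2, h3⟩ => by
      have hi' : (i : ℝ) + 1 ≤ n := by exact_mod_cast hi
      refine ⟨by simpa [h1.size_eq, h2] using hi', ?_⟩
      refine Spec.seq (hf ⟨i, hi⟩ s' h3 h1.size_eq h2).frame fun s'' ⟨j1, j2, j3⟩ =>
        spec_assigns _ _ ?_
      have k1 : Inputs s''.var n α (S g₁ i) (S g₂ i) (S g₃ i) (S g₄ i) := h1.congr fun v hv =>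
        j2 v (hw v (by simp only [List.mem_cons, List.not_mem_nil, or_false] at hv ⊢; tauto))
      have k2 : s''.var .i = i := (j2 _ (hw _ (by simp))).trans h2
      have E : ∀ y : Var → ℝ, y .data₁ = s''.var .data₁ ∧
        y .data₂ = s''.var .data₂ ∧ y .data₃ = s''.var .data₃ →
        e₁.eval y = g₁ ⟨i, hi⟩ ∧ e₂.eval y = g₂ ⟨i, hi⟩ ∧ e₃.eval y = g₃ ⟨i, hi⟩ ∧
          e₄.eval y = g₄ ⟨i, hi⟩ := fun y hy => j1 y hy.1 hy.2.1 hy.2.2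
      have H : ∀ g : Fin n → ℕ, S g (i + 1) = S g i + g ⟨i, hi⟩ := sum_range_succ_dite hi
      refine ⟨⟨?_, ?_, ?_, ?_, ?_, ?_⟩, ?_, (j3 hm).trans h3⟩
      · simp [runAssigns, countIncs, k1.size_eq]
      · simp [runAssigns, countIncs, k1.level_eq]
      · simp [runAssigns, countIncs, k1.n₁_eq, H, (E _ _).1]
      · simp [runAssigns, countIncs, k1.n₂_eq, H, (E _ _).2.1]
      · simp [runAssigns, countIncs, k1.n₃_eq, H, (E _ _).2.2.1]
      · simp [runAssigns, countIncs, k1.n₄_eq, H, (E _ _).2.2.2]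
      · simp [runAssigns, countIncs, k2])
    (fun s' ⟨h1, h2, _⟩ => by simp [h1.size_eq, h2]) (s := s')
  have e1 : (Val.i + 1 : Expr Var).size + Val.size.size + 2 = 6 := rfl
  simp only [e1] at hloop
  refine ((spec_assigns _ _ (Q := fun s' => Inputs s'.var n α (S g₁ 0) (S g₂ 0) (S g₃ 0) (S g₄ 0) ∧
    s'.var .i = (0 : ℕ) ∧ s'.mem = s.mem) ⟨⟨?_, ?_, ?_, ?_, ?_, ?_⟩, ?_, rfl⟩).mono
      (Nat.le_mul_of_pos_left _ (Nat.succ_pos n)) fun _ h => h).seq_mul fun s1 h1 =>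
      (hloop s1 h1).mono le_rfl fun s2 h2 => ?_
  · simp [runAssigns, hsize]
  · simp [runAssigns, hlevel]
  · simp [runAssigns, S]
  · simp [runAssigns, S]
  · simp [runAssigns, S]
  · simp [runAssigns, S]
  · simp [runAssigns]
  · simp only [hS, sum_range_dite] at h2
    exact ⟨h2.1, h2.2.2⟩

/-! ### The observed data in memory -/

section

variable {n : ℕ} (Yobs : Fin n → Bool) (Zobs : Assignment n) (l : List ℝ)

theorem getD_observedData_outcome (i : Fin n) :
    (observedData Yobs Zobs ++ l).getD i 0 = val (Yobs i) := by
  rw [List.getD_eq_getElem?_getD, observedData, List.append_assoc,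
    List.getElem?_append_left (by simp)]
  simp

theorem getD_observedData_assignment (i : Fin n) :
    (observedData Yobs Zobs ++ l).getD (n + i) 0 = val (Zobs i) := by
  rw [List.getD_eq_getElem?_getD, observedData, List.append_assoc,
    List.getElem?_append_right (by simp), List.getElem?_append_left (by simp)]
  simp

theorem getD_observedData_right (i : ℕ) :
    (observedData Yobs Zobs ++ l).getD (2 * n + i) 0 = l.getD i 0 := by
  rw [List.getD_eq_getElem?_getD, List.getElem?_append_right (by simp [observedData]; omega),
    List.getD_eq_getElem?_getD]
  congr 2
  simp [observedData]
  omega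

theorem getD_pairingData (mate : Fin n → Fin n) (i : Fin n) :
    (pairingData mate).getD i 0 = (mate i : ℕ) := by
  simp [pairingData]

/-- The flag area starts beyond the input, where the initial memory is zero. -/
theorem flags_empty {data : List ℝ} (h : data.length ≤ 3 * n) :
    Flags n (fun k => data.getD k 0) ∅ := by
  intro q
  simp only [Set.mem_empty_iff_false, if_false]
  exact List.getD_eq_default _ _ (by omega)

end

/-! ### The balanced Bernoulli design -/

/-- Loads the outcome and the assignment of unit `i`. -/
def fetchUnit : Cmd Var := seq (load .data₁ Val.i) (load .data₂ (Val.size + Val.i))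

theorem spec_fetchUnit {n : ℕ} (i : Fin n) {Yobs : Fin n → Bool} {Zobs : Assignment n} {l : List ℝ}
    {s : Store Var} (hs : s.mem = fun k => (observedData Yobs Zobs ++ l).getD k 0)
    (hsize : s.var .size = n) (hi : s.var .i = (i : ℕ)) :
    Spec fetchUnit s fetchUnit.size fun s' =>
      s'.var .data₁ = val (Yobs i) ∧ s'.var .data₂ = val (Zobs i) := by
  refine Spec.seq (spec_load (i : ℕ) (by simp [hi]) rfl) ?_
  rintro s' rfl
  refine spec_load (n + i) (by simp [hi, hsize]) ⟨?_, ?_⟩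
  · have := getD_observedData_outcome Yobs Zobs l i
    simpa [hs] using this
  · have := getD_observedData_assignment Yobs Zobs l i
    simpa [hs] using this

/-- The computation of the numbers of units with given assignment and outcome. -/
def cellCmd : Cmd Var :=
  countCmd fetchUnit (Val.data₁ * Val.data₂) ((1 - Val.data₁) * Val.data₂)
    (Val.data₁ * (1 - Val.data₂)) ((1 - Val.data₁) * (1 - Val.data₂))

/-- A bound for the time per unit of `cellCmd`. -/
def cellCost : ℕ :=
  countCost fetchUnit (Val.data₁ * Val.data₂) ((1 - Val.data₁) * Val.data₂)
    (Val.data₁ * (1 - Val.data₂)) ((1 - Val.data₁) * (1 - Val.data₂))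

theorem spec_cellCmd {n : ℕ} {Yobs : Fin n → Bool} {Zobs : Assignment n} {l : List ℝ} {α : ℝ}
    {s : Store Var} (hs : s.mem = fun k => (observedData Yobs Zobs ++ l).getD k 0)
    (hsize : s.var .size = n) (hlevel : s.var .level = α) :
    Spec cellCmd s ((n + 1) * cellCost) fun s' =>
      Inputs s'.var n α (cellCount Yobs Zobs true true) (cellCount Yobs Zobs true false)
        (cellCount Yobs Zobs false true) (cellCount Yobs Zobs false false) ∧ s'.mem = s.mem := by
  simp only [cellCount, card_filter]
  refine spec_countCmd (by decide) rfl hsize hlevel fun i s' h1 h2 h3 =>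
    (spec_fetchUnit i (h1.trans hs) h2 h3).mono le_rfl ?_
  rintro s'' ⟨j1, j2⟩ y y1 y2 -
  simp only [Expr.eval_mul, Expr.eval_sub, Expr.eval_var, y1, y2, j1, j2]
  cases Zobs i <;> cases Yobs i <;> simp [val]

/-- The parameters of a sweep for the balanced Bernoulli design. -/
def bernoulliSweep₁ : SweepParams := ⟨0, Val.n₁ + Val.n₃, 2 * Val.n₁, Val.n₂ + Val.n₃, 1⟩

/-- The parameters of a sweep for the balanced Bernoulli design. -/
def bernoulliSweep₂ : SweepParams := ⟨Val.n₃ + Val.n₂, Val.n₁, 2 * Val.n₁ + Val.n₂, 0, Val.n₃⟩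

/-- The parameters of a sweep for the balanced Bernoulli design. -/
def bernoulliSweep₃ : SweepParams :=
  ⟨Val.n₂, Val.n₁ + Val.n₃, 2 * Val.n₁ + Val.n₂, Val.n₃, Val.n₄ + 1⟩

/-- The parameters of a sweep for the balanced Bernoulli design. -/
def bernoulliSweep₄ : SweepParams :=
  ⟨Val.n₁ + Val.n₄, Val.n₃, 2 * Val.n₃ + Val.n₄, Val.n₁ + Val.n₂ + Val.n₃ + Val.n₄, Val.n₁⟩

/-- The parameters of a sweep for the balanced Bernoulli design. -/
def bernoulliSweep₅ : SweepParams :=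
  ⟨Val.n₄, Val.n₁ + Val.n₃, 2 * Val.n₃ + Val.n₄, Val.n₂ + Val.n₃ + Val.n₄, Val.n₂ + 1⟩

/-- The algorithm for the balanced Bernoulli design. -/
def bernoulliCmd : Cmd Var :=
  seq cellCmd <| seq (bernoulliSweep₁.cmd .single 1) <| seq (bernoulliSweep₂.cmd .trade 1) <|
    seq (bernoulliSweep₃.cmd .single 1) <| seq (bernoulliSweep₄.cmd .trade (-1)) <|
    seq (bernoulliSweep₅.cmd .single (-1)) <| outputCmd (0 - Val.n₃ - Val.n₂)

/-- A bound for the time per unit of `bernoulliCmd`. -/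
def bernoulliCost : ℕ :=
  cellCost + (bernoulliSweep₁.cost .single 1 + (bernoulliSweep₂.cost .trade 1 +
    (bernoulliSweep₃.cost .single 1 + (bernoulliSweep₄.cost .trade (-1) +
    (bernoulliSweep₅.cost .single (-1) + outputCost (0 - Val.n₃ - Val.n₂))))))

theorem spec_bernoulliCmd {n : ℕ} (hn : 1 ≤ n) {α : ℝ} (hα : α < 1) (Yobs : Fin n → Bool)
    (Zobs : Assignment n) {s : Store Var} (hsize : s.var .size = n) (hlevel : s.var .level = α)
    (hs : s.mem = fun k => (observedData Yobs Zobs).getD k 0) :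
    Spec bernoulliCmd s ((n + 1) * bernoulliCost) fun s' => ∃ K : ℕ, s'.var .size = K ∧
      Set.InjOn s'.mem (Set.Iio K) ∧ s'.mem '' Set.Iio K =
        confidenceSet (bernoulliDesign n (1 / 2)) (1 / 2) α Yobs Zobs := by
  have hc := card_eq_cellCounts Yobs Zobs
  have h0 := spec_cellCmd (l := []) (by simpa using hs) hsize hlevel
  have hf : Flags n s.mem ∅ := hs ▸ flags_empty (by simp [observedData]; omega)
  rw [confidenceSet_bernoulli hn hα Yobs Zobs rfl rfl rfl rfl, bernoulliAccepted]
  -- From here on only the four counts and their sum n matter; all remaining side conditions are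
  -- linear arithmetic.
  generalize cellCount Yobs Zobs true true = c₁, cellCount Yobs Zobs true false = c₂,
    cellCount Yobs Zobs false true = c₃, cellCount Yobs Zobs false false = c₄ at *
  refine h0.seq_mul fun s1 ⟨i1, m1⟩ => ?_
  rw [← m1] at hf
  have h1 := SweepParams.spec (e := bernoulliSweep₁) (m := .single) (δ := 1) i1 hf (a := 0)
    (b := c₁ + c₃) (k := 2 * c₁) (cnt := 1) (p := c₂ + c₃)
    (fun y hy => by simp [bernoulliSweep₁, hy.n₁_eq, hy.n₂_eq, hy.n₃_eq])
    (fun _ => ⟨by simp only [Move.Valid]; omega, by intros; omega⟩) (by omega)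
  rw [Set.empty_union] at h1
  refine h1.seq_mul fun s2 ⟨i2, f2⟩ => ?_
  refine (SweepParams.spec i2 f2 (a := c₃ + c₂) (b := c₁) (k := 2 * c₁ + c₂) (cnt := c₃) (p := 0)
    (fun y hy => by simp [bernoulliSweep₂, hy.n₁_eq, hy.n₂_eq, hy.n₃_eq])
    (fun _ => ⟨by simp only [Move.Valid]; omega, by intros; omega⟩)
    (by omega)).seq_mul fun s3 ⟨i3, f3⟩ => ?_
  refine (SweepParams.spec i3 f3 (a := c₂) (b := c₁ + c₃) (k := 2 * c₁ + c₂) (cnt := c₄ + 1)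
    (p := c₃) (fun y hy => by simp [bernoulliSweep₃, hy.n₁_eq, hy.n₂_eq, hy.n₃_eq, hy.n₄_eq])
    (fun _ => ⟨by simp only [Move.Valid]; omega, by intros; omega⟩)
    (by omega)).seq_mul fun s4 ⟨i4, f4⟩ => ?_
  refine (SweepParams.spec i4 f4 (a := c₁ + c₄) (b := c₃) (k := 2 * c₃ + c₄) (cnt := c₁)
    (p := c₁ + c₂ + c₃ + c₄)
    (fun y hy => by simp [bernoulliSweep₄, hy.n₁_eq, hy.n₂_eq, hy.n₃_eq, hy.n₄_eq])
    (fun _ => ⟨by simp only [Move.Valid]; omega, by intros; omega⟩)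
    (by omega)).seq_mul fun s5 ⟨i5, f5⟩ => ?_
  refine (SweepParams.spec i5 f5 (a := c₄) (b := c₁ + c₃) (k := 2 * c₃ + c₄) (cnt := c₂ + 1)
    (p := c₂ + c₃ + c₄)
    (fun y hy => by simp [bernoulliSweep₅, hy.n₁_eq, hy.n₂_eq, hy.n₃_eq, hy.n₄_eq])
    (fun _ => ⟨by simp only [Move.Valid]; omega, by intros; omega⟩)
    (by omega)).seq_mul fun s6 ⟨i6, f6⟩ => ?_
  exact spec_outputCmd hn i6 (fun y hy => by simp [hy.n₂_eq, hy.n₃_eq]) f6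

/-! ### The matched-pairs design -/

/-- Loads the outcome and the assignment of unit `i` and the outcome of its partner. -/
def fetchPair : Cmd Var :=
  seq (load .data₃ (2 * Val.size + Val.i)) (seq (load .data₃ Val.data₃) fetchUnit)

/-- The first load yields the index of the partner, which the second one uses as the address of its
outcome. -/
theorem spec_fetchPair {n : ℕ} (i : Fin n) {Yobs : Fin n → Bool} {Zobs : Assignment n}
    {mate : Fin n → Fin n} {s : Store Var}
    (hs : s.mem = fun k => (observedData Yobs Zobs ++ pairingData mate).getD k 0)
    (hsize : s.var .size = n) (hi : s.var .i = (i : ℕ)) :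
    Spec fetchPair s fetchPair.size fun s' => s'.var .data₁ = val (Yobs i) ∧
      s'.var .data₂ = val (Zobs i) ∧ s'.var .data₃ = val (Yobs (mate i)) := by
  refine Spec.seq (spec_load (2 * n + i) (by simp [hi, hsize]) rfl) ?_
  rintro s1 rfl
  have h1 := getD_observedData_right Yobs Zobs (pairingData mate) i
  rw [getD_pairingData] at h1
  refine Spec.seq (spec_load (mate i : ℕ) (by simpa [hs] using h1) rfl) ?_
  rintro s2 rfl
  have h2 := getD_observedData_outcome Yobs Zobs (pairingData mate) (mate i)
  have h3 := (spec_fetchUnit (s := ⟨Function.update (Function.update s.var .data₃ (s.mem (2 * n + i)))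
    .data₃ (s.mem (mate i)), s.mem⟩) i hs (by simp [hsize]) (by simp [hi])).frame
  refine h3.mono le_rfl fun s' h => ⟨h.1.1, h.1.2, (h.2.1 .data₃ rfl).trans ?_⟩
  simpa [hs] using h2

/-- The computation of the numbers of pairs with given difference of the observed outcomes. -/
def pairCmd : Cmd Var :=
  countCmd fetchPair (Val.data₂ * (Val.data₁ * (1 - Val.data₃)))
    (Val.data₂ * ((1 - Val.data₁) * Val.data₃))
    (Val.data₂ * (Val.data₁ * Val.data₃ + (1 - Val.data₁) * (1 - Val.data₃))) 0

/-- A bound for the time per unit of `pairCmd`. -/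
def pairCost : ℕ :=
  countCost fetchPair (Val.data₂ * (Val.data₁ * (1 - Val.data₃)))
    (Val.data₂ * ((1 - Val.data₁) * Val.data₃))
    (Val.data₂ * (Val.data₁ * Val.data₃ + (1 - Val.data₁) * (1 - Val.data₃))) 0

theorem spec_pairCmd {n : ℕ} {Yobs : Fin n → Bool} {Zobs : Assignment n} {mate : Fin n → Fin n}
    {α : ℝ} {s : Store Var}
    (hs : s.mem = fun k => (observedData Yobs Zobs ++ pairingData mate).getD k 0)
    (hsize : s.var .size = n) (hlevel : s.var .level = α) :
    Spec pairCmd s ((n + 1) * pairCost) fun s' =>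
      Inputs s'.var n α (pairCount mate Yobs Zobs 1) (pairCount mate Yobs Zobs (-1))
        (pairCount mate Yobs Zobs 0) 0 ∧ s'.mem = s.mem := by
  have h0 : 0 = ∑ _i : Fin n, 0 := by simp
  rw [h0]
  simp only [pairCount, card_filter]
  refine spec_countCmd (by decide) rfl hsize hlevel fun i s' h1 h2 h3 =>
    (spec_fetchPair i (h1.trans hs) h2 h3).mono le_rfl ?_
  rintro s'' ⟨j1, j2, j3⟩ y y1 y2 y3
  simp only [Expr.eval_mul, Expr.eval_sub, Expr.eval_add, Expr.eval_var, y1, y2, y3, j1, j2, j3,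
    pairDiff]
  rcases Bool.eq_false_or_eq_true (Zobs i) with h | h <;>
    rcases Bool.eq_false_or_eq_true (Yobs i) with h' | h' <;>
    rcases Bool.eq_false_or_eq_true (Yobs (mate i)) with h'' | h'' <;> simp [h, h', h'', val, ival]

/-- The parameters of a sweep for the matched-pairs design. -/
def matchedSweep₁ : SweepParams :=
  ⟨0, Val.n₂, 2 * Val.n₂, 2 * Val.n₁ + 2 * Val.n₂ + Val.n₃, Val.n₁ + 1⟩

/-- The parameters of a sweep for the matched-pairs design. -/
def matchedSweep₂ : SweepParams := ⟨0, Val.n₁, 2 * Val.n₁, Val.n₃, Val.n₂ + 1⟩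

/-- The parameters of a sweep for the matched-pairs design. -/
def matchedSweep₃ : SweepParams :=
  ⟨Val.n₃, Val.n₂, Val.n₃ + 2 * Val.n₂, 2 * (Val.n₁ + Val.n₂ + Val.n₃), Val.n₁ + 1⟩

/-- The parameters of a sweep for the matched-pairs design. -/
def matchedSweep₄ : SweepParams :=
  ⟨Val.n₃ + 1, Val.n₂, Val.n₃ + 2 * Val.n₂, 2 * (Val.n₁ + Val.n₂ + Val.n₃) - 1, Val.n₁⟩

/-- The parameters of a sweep for the matched-pairs design. -/
def matchedSweep₅ : SweepParams := ⟨Val.n₃, Val.n₁, Val.n₃ + 2 * Val.n₁, 0, Val.n₂ + 1⟩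

/-- The parameters of a sweep for the matched-pairs design. -/
def matchedSweep₆ : SweepParams := ⟨Val.n₃ + 1, Val.n₁, Val.n₃ + 2 * Val.n₁, 1, Val.n₂⟩

/-- The parameters of a sweep for the matched-pairs design. -/
def matchedSweep₇ : SweepParams :=
  ⟨Val.n₃, Val.n₁ + Val.n₂, 2 * Val.n₂, 2 * Val.n₂, Val.n₃ + 1⟩

/-- The parameters of a sweep for the matched-pairs design. -/
def matchedSweep₈ : SweepParams :=
  ⟨Val.n₃ - 1, Val.n₁ + Val.n₂, 2 * Val.n₂, 2 * Val.n₂ + 1, Val.n₃⟩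

/-- The algorithm for the matched-pairs design. -/
def matchedPairsCmd : Cmd Var :=
  seq pairCmd <| seq (matchedSweep₁.cmd .double (-2)) <| seq (matchedSweep₂.cmd .double 2) <|
    seq (matchedSweep₃.cmd .double (-2)) <| seq (matchedSweep₄.cmd .double (-2)) <|
    seq (matchedSweep₅.cmd .double 2) <| seq (matchedSweep₆.cmd .double 2) <|
    seq (matchedSweep₇.cmd .coeff 2) <| seq (matchedSweep₈.cmd .coeff 2) <|
    outputCmd (0 - 2 * Val.n₂ - Val.n₃)

/-- A bound for the time per unit of `matchedPairsCmd`. -/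
def matchedPairsCost : ℕ :=
  pairCost + (matchedSweep₁.cost .double (-2) + (matchedSweep₂.cost .double 2 +
    (matchedSweep₃.cost .double (-2) + (matchedSweep₄.cost .double (-2) +
    (matchedSweep₅.cost .double 2 + (matchedSweep₆.cost .double 2 +
    (matchedSweep₇.cost .coeff 2 + (matchedSweep₈.cost .coeff 2 +
    outputCost (0 - 2 * Val.n₂ - Val.n₃)))))))))

theorem spec_matchedPairsCmd {n : ℕ} (hn : 1 ≤ n) {α : ℝ} (hα : α < 1) {mate : Fin n → Fin n}
    (hmate : IsPairing mate) (Yobs : Fin n → Bool) {Zobs : Assignment n}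
    (hZ : RespectsPairing mate Zobs) {s : Store Var} (hsize : s.var .size = n)
    (hlevel : s.var .level = α)
    (hs : s.mem = fun k => (observedData Yobs Zobs ++ pairingData mate).getD k 0) :
    Spec matchedPairsCmd s ((n + 1) * matchedPairsCost) fun s' => ∃ K : ℕ, s'.var .size = K ∧
      Set.InjOn s'.mem (Set.Iio K) ∧ s'.mem '' Set.Iio K =
        confidenceSet (matchedPairsDesign mate) (1 / 2) α Yobs Zobs := by
  have hc := card_eq_pairCounts hmate hZ Yobs
  have h0 := spec_pairCmd hs hsize hlevel
  have hf : Flags n s.mem ∅ := hs ▸ flags_empty (by simp [observedData, pairingData]; omega)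
  rw [confidenceSet_matchedPairs hn hα hmate Yobs hZ rfl rfl rfl, matchedAccepted]
  generalize pairCount mate Yobs Zobs 1 = A, pairCount mate Yobs Zobs (-1) = C,
    pairCount mate Yobs Zobs 0 = E at *
  refine h0.seq_mul fun s1 ⟨i1, m1⟩ => ?_
  rw [← m1] at hf
  have h1 := SweepParams.spec (e := matchedSweep₁) (m := .double) (δ := -2) i1 hf (a := 0)
    (b := C) (k := 2 * C) (cnt := A + 1) (p := 2 * A + 2 * C + E)
    (fun y hy => by simp [matchedSweep₁, hy.n₁_eq, hy.n₂_eq, hy.n₃_eq])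
    (fun _ => ⟨by simp only [Move.Valid]; omega, by intros; omega⟩) (by omega)
  rw [Set.empty_union] at h1
  refine h1.seq_mul fun s2 ⟨i2, f2⟩ => ?_
  refine (SweepParams.spec i2 f2 (a := 0) (b := A) (k := 2 * A) (cnt := C + 1) (p := E)
    (fun y hy => by simp [matchedSweep₂, hy.n₁_eq, hy.n₂_eq, hy.n₃_eq])
    (fun _ => ⟨by simp only [Move.Valid]; omega, by intros; omega⟩)
    (by omega)).seq_mul fun s3 ⟨i3, f3⟩ => ?_
  refine (SweepParams.spec i3 f3 (a := E) (b := C) (k := E + 2 * C) (cnt := A + 1)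
    (p := 2 * (A + C + E)) (fun y hy => by simp [matchedSweep₃, hy.n₁_eq, hy.n₂_eq, hy.n₃_eq])
    (fun _ => ⟨by simp only [Move.Valid]; omega, by intros; omega⟩)
    (by omega)).seq_mul fun s4 ⟨i4, f4⟩ => ?_
  refine (SweepParams.spec i4 f4 (a := E + 1) (b := C) (k := E + 2 * C) (cnt := A)
    (p := 2 * (A + C + E) - 1)
    (fun y hy => by simp [matchedSweep₄, hy.n₁_eq, hy.n₂_eq, hy.n₃_eq])
    (fun _ => ⟨by simp only [Move.Valid]; omega, by intros; omega⟩)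
    (by omega)).seq_mul fun s5 ⟨i5, f5⟩ => ?_
  refine (SweepParams.spec i5 f5 (a := E) (b := A) (k := E + 2 * A) (cnt := C + 1) (p := 0)
    (fun y hy => by simp [matchedSweep₅, hy.n₁_eq, hy.n₂_eq, hy.n₃_eq])
    (fun _ => ⟨by simp only [Move.Valid]; omega, by intros; omega⟩)
    (by omega)).seq_mul fun s6 ⟨i6, f6⟩ => ?_
  refine (SweepParams.spec i6 f6 (a := E + 1) (b := A) (k := E + 2 * A) (cnt := C) (p := 1)
    (fun y hy => by simp [matchedSweep₆, hy.n₁_eq, hy.n₂_eq, hy.n₃_eq])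
    (fun _ => ⟨by simp only [Move.Valid]; omega, by intros; omega⟩)
    (by omega)).seq_mul fun s7 ⟨i7, f7⟩ => ?_
  refine (SweepParams.spec (m := .coeff) i7 f7 (a := E) (b := A + C) (k := 2 * C) (cnt := E + 1) (p := 2 * C)
    (fun y hy => by simp [matchedSweep₇, hy.n₁_eq, hy.n₂_eq, hy.n₃_eq])
    (fun _ => ⟨trivial, by intros; omega⟩) (by omega)).seq_mul fun s8 ⟨i8, f8⟩ => ?_
  refine (SweepParams.spec (m := .coeff) i8 f8 (a := E - 1) (b := A + C) (k := 2 * C) (cnt := E)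
    -- For E = 0 the real value E - 1 differs from the truncated one, but the sweep is then empty
    -- and only its length is checked.
    (p := 2 * C + 1) (fun y hy => ⟨by simp [matchedSweep₈, hy.n₃_eq], fun hE => by
      simp [matchedSweep₈, hy.n₁_eq, hy.n₂_eq, hy.n₃_eq, Nat.cast_sub (Nat.succ_le_of_lt hE)]⟩)
    (fun _ => ⟨trivial, by intros; omega⟩) (by omega)).seq_mul fun s9 ⟨i9, f9⟩ => ?_
  exact spec_outputCmd hn i9 (fun y hy => by simp [hy.n₂_eq, hy.n₃_eq]) f9

/-! ### The running time -/

/-- The numbering of the variables. -/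
def Var.index (v : Var) : ℕ := v.ctorIdx

theorem Var.index_injective : Function.Injective Var.index := by
  intro v w h
  cases v <;> cases w <;> first | rfl | exact absurd h (by decide)

/-- The linear bound suffices because log n ≥ 1 from n = 3 on. -/
theorem isBigO_linear (C : ℕ) : (fun n : ℕ => (((n + 1) * C + 1 : ℕ) : ℝ)) =O[atTop]
    fun n : ℕ => (n : ℝ) * Real.log n ^ 2 := by
  refine IsBigO.of_bound (2 * C + 1) ?_
  filter_upwards [eventually_ge_atTop 3] with n hn
  have hn' : (3 : ℝ) ≤ n := by exact_mod_cast hn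
  have hlog : 1 ≤ Real.log n := by
    rw [Real.le_log_iff_exp_le (by linarith)]
    linarith [Real.exp_one_lt_d9]
  have h1 : (1 : ℝ) ≤ Real.log n ^ 2 := one_le_pow₀ hlog
  rw [Real.norm_of_nonneg (by positivity), Real.norm_of_nonneg (by positivity)]
  have hC : (0 : ℝ) ≤ C := Nat.cast_nonneg C
  calc (((n + 1) * C + 1 : ℕ) : ℝ) ≤ (2 * C + 1) * n := by
        push_cast
        nlinarith
    _ ≤ (2 * C + 1) * (n * Real.log n ^ 2) := by
        gcongr
        exact le_mul_of_one_le_right (by linarith) h1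

end RandExp

theorem theorem3 :
    -- the balanced Bernoulli design
    (∃ (P : RAM.Program) (t : ℕ → ℕ),
      ((fun n : ℕ => (t n : ℝ)) =O[atTop] fun n : ℕ => (n : ℝ) * Real.log n ^ 2) ∧
      ∀ n : ℕ, 1 ≤ n → ∀ α : ℝ, 0 < α → α < 1 →
        ∀ (Yobs : Fin n → Bool) (Zobs : RandExp.Assignment n),
          ∃ c : RAM.Config,
            RAM.HaltsWithin P (RAM.input n α (RandExp.observedData Yobs Zobs)) (t n) c ∧
            RAM.Outputs c
              (RandExp.confidenceSet (RandExp.bernoulliDesign n (1 / 2)) (1 / 2) α Yobs Zobs)) ∧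
    -- the matched-pairs design
    (∃ (P : RAM.Program) (t : ℕ → ℕ),
      ((fun n : ℕ => (t n : ℝ)) =O[atTop] fun n : ℕ => (n : ℝ) * Real.log n ^ 2) ∧
      ∀ n : ℕ, 1 ≤ n → ∀ α : ℝ, 0 < α → α < 1 →
        ∀ mate : Fin n → Fin n, RandExp.IsPairing mate →
        ∀ (Yobs : Fin n → Bool) (Zobs : RandExp.Assignment n),
          RandExp.RespectsPairing mate Zobs →
          ∃ c : RAM.Config,
            RAM.HaltsWithin P
              (RAM.input n α (RandExp.observedData Yobs Zobs ++ RandExp.pairingData mate))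
              (t n) c ∧
            RAM.Outputs c
              (RandExp.confidenceSet (RandExp.matchedPairsDesign mate) (1 / 2) α Yobs Zobs)) := by
  -- The costs per unit are numerals independent of the data, the pairing and α; the last summand 1
  -- pays for the initial register move.
  refine ⟨⟨RAM.Cmd.program RandExp.Var.index RandExp.bernoulliCmd,
    fun n => (n + 1) * RandExp.bernoulliCost + 1, RandExp.isBigO_linear _, ?_⟩,
    ⟨RAM.Cmd.program RandExp.Var.index RandExp.matchedPairsCmd,
    fun n => (n + 1) * RandExp.matchedPairsCost + 1, RandExp.isBigO_linear _, ?_⟩⟩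
  · intro n hn α _ hα Yobs Zobs
    exact RAM.Cmd.Spec.haltsWithin RandExp.Var.index_injective (v := .size) (w := .level) rfl rfl
      fun s h1 h2 h3 => RandExp.spec_bernoulliCmd hn hα Yobs Zobs h1 h2 h3
  · intro n hn α _ hα mate hm Yobs Zobs hZ
    exact RAM.Cmd.Spec.haltsWithin RandExp.Var.index_injective (v := .size) (w := .level) rfl rfl
      fun s h1 h2 h3 => RandExp.spec_matchedPairsCmd hn hα hm Yobs hZ h1 h2 h3
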